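/- **Setting.** In the triangular grid let $a,b,c$ be the three positive directions, at angles of $120^\circ$ ($a+b+c=0$). A *domain* $D$ is a finite union of triangles of the grid; its *contour* is the set of edges lying in exactly one of its triangles. A *lozenge* is the union of two triangles sharing an edge (its middle segment), and a *tiling* of $D$ is a set of lozenges included in $D$ with disjoint interiors and union $D$. An edge of $D$ is *valid* for a tiling $T$ if it is not the middle segment of a lozenge of $T$. The *height* $h_T(x)$ is the number of positively followed edges minus the number of negatively followed edges on a $T$-valid path from a fixed reference vertex on the contour to $x$. We say that $D$ *admits heights* if $D$ is connected, $h_T$ is well defined for every tiling $T$ (every closed $T$-valid path has evaluation $0$), and the heights on the contour do not depend on $T$. Put $T\preccurlyeq T'$ if $h_T\le h_{T'}$ everywhere, and write $\mathcal L(D)$ for the set of tilings so ordered, $\mathrm{Min}(D)$ and $\mathrm{Max}(D)$ for its least and greatest elements. *Cubes.* $T$ is identified with its pile of cubes: the pairs $(v,h)$ with $h_{\mathrm{Min}(D)}(v)\le h<h_T(v)$ and $h\equiv h_{\mathrm{Min}(D)}(v) \pmod 3$. Adding a cube above $v$ raises the height of $v$ by $3$. For a cube $C$, $\mathrm{Min}_C(D)$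 is the infimum of the tilings containing $C$; for a finite family, $\mathrm{Min}_{(C_i)}(D)=\sup_i \mathrm{Min}_{C_i}(D)$ ($=\mathrm{Min}(D)$ for the empty family). *Fracture zones.* A vertex is *solid* if its heights in $\mathrm{Min}(D)$ and $\mathrm{Max}(D)$ agree. A *fracture line* is a repetition-free closed path of solid vertices that is valid for some tiling. A *fracture zone* is a minimal non-empty union of triangles of $D$ whose contour is a union of fracture lines. *Seeds.* A *seed* of $T$ is a vertex $v$ whose surrounding hexagon of side $1$ is tiled in $T$ by its minimal tiling. A finite pile of cubes in $\mathbb N^3$ is *compact* if with a cube it contains all those obtained by decreasing one coordinate; placed at $v$, it defines a *pseudo-hexagon*, whose minimal tiling consists of the base-plane squares below its cubes. The *range* of a seed $v$ in $T$ is the union of the compact piles at $v$ for which $T$ contains the minimal tiling of the pseudo-hexagon; a *filling* of $v$ is a compact pile included in the range. A seed of $T$ is *proper* if the region of the plane covered by its range is included in that of no other seed of $T$. Let $D^0=\mathrm{Min}(D)$; the proper seeds *of order $k$* are the proper seeds of $D^k$, and $D^{k+1}$ is obtained from $D^k$ by filling all their ranges completely. The *degree* $d(D)$ is the least $n$ with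 $D^n=\mathrm{Max}(D)$. **Algorithm.** Input: $D$. (1) Compute the fracture zones of $D$. For a zone that is a single lozenge, return the one-element lattice. For any other zone $F$: (2) build $F^0,\dots,F^{d(F)}$ and start with an empty list $L$. (3) For $k=0,\dots,d(F)-1$: generate all fillings of each proper seed of order $k$, as plane partitions limited by the plane partition of its range (slice by slice, by recursion, for each weight), and form their cartesian product, each element of which is a family $(C_i)$ of cubes. If $k=0$, add $\mathrm{Min}(F)+(C_i)$ to $L$ for every family. If $k\ge 1$, for every non-empty family, and for every tiling $t$ in $L$ such that $t\preccurlyeq F^k$ and $t$ contains all the cubes of $\mathrm{Min}_{(C_i)}(F)$ other than the $C_i$, add $t+(C_i)$ to $L$. (4) Link each $T$ in $L$ to the tilings obtained by adding one cube on an inner local minimum of $h_T$. (5) Return the product of the diagrams of all the zones, tilings of the zones being glued together. **Theorem.** Every simply connected domain (connected, with connected complement) admits heights. Let $D$ be a tileable domain that admits heights. Then the algorithm outputs the lattice of the tilings of $D$: its list of tilings contains every tiling of $D$ exactly once and nothing else; its list of links contains every pair $(T,T')$ such that $T'$ covers $T$ in $\mathcal L(D)$ exactly once and nothing else; $\preccurlyeq$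 is the reflexive transitive closure of the links; and $\mathcal L(D)$ is a distributive lattice. Moreover: - the fracture zones form a partition of $D$; restriction to the zones is a bijection from the tilings of $D$ onto the families of tilings of the zones, and $T\preccurlyeq T'$ if and only if this holds on each zone, so $\mathcal L(D)$ is the product of the lattices of the zones; - each zone $F$ admits heights, and the diagram computed for it is that of $\mathcal L(F)$ in the same sense, each tiling of $F$ being generated exactly once; - if $F$ is not a lozenge, then $d(F)\ge 1$ and $\mathrm{Min}(F)=F^0\prec F^1\prec\cdots\prec F^{d(F)}=\mathrm{Max}(F)$ is a chain of tilings of $F$. -/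

import Mathlib

namespace LozengeTiling

noncomputable section

/-! ### The triangular grid -/

/-- Vertices of the triangular grid, in the basis given by the directions `a` and `b` below. -/
abbrev Vertex := ℤ × ℤ

/-- The three positive directions `a`, `b`, `c`, at angles of 120 degrees: `a + b + c = 0`. -/
def step : Fin 3 → Vertex := ![(1, 0), (0, 1), (-1, -1)]

/-- An edge of the grid, positively directed: it goes from `src` to `src + step dir`. -/
structure Edge where
  src : Vertex
  dir : Fin 3
deriving DecidableEq

def Edge.tgt (e : Edge) : Vertex := e.src + step e.dir

/-- A triangle of the grid.  With `v = corner`, it is `{v, v + a, v + a + b}` if `kind = false` and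
`{v, v + b, v + a + b}` if `kind = true`; these are the two orientations of triangles. -/
structure Tri where
  corner : Vertex
  kind : Bool
deriving DecidableEq

def Tri.edges (t : Tri) : Finset Edge :=
  if t.kind then
    {⟨t.corner, 1⟩, ⟨t.corner + step 1, 0⟩, ⟨t.corner + step 0 + step 1, 2⟩}
  else
    {⟨t.corner, 0⟩, ⟨t.corner + step 0, 1⟩, ⟨t.corner + step 0 + step 1, 2⟩}

def Tri.verts (t : Tri) : Finset Vertex := t.edges.image Edge.src

/-- A domain is a finite union of triangles of the grid. -/
abbrev Domain := Finset Tri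

def edges (D : Domain) : Finset Edge := D.biUnion Tri.edges

def verts (D : Domain) : Finset Vertex := D.biUnion Tri.verts

/-- The contour of `D`: the edges that belong to exactly one triangle of `D`. -/
def contour (D : Domain) : Finset Edge :=
  (edges D).filter fun e => (D.filter fun t => e ∈ t.edges).card = 1

def contourVerts (D : Domain) : Finset Vertex :=
  (contour D).image Edge.src ∪ (contour D).image Edge.tgt

/-- The domain (a union of closed triangles) is connected. -/
def IsConnectedDomain (D : Domain) : Prop :=
  ∀ t ∈ D, ∀ t' ∈ D,
    Relation.ReflTransGen (fun s s' : Tri => s' ∈ D ∧ (s.verts ∩ s'.verts).Nonempty) t t'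

/-- The complement of the domain in the plane (an open set) is connected: one goes from a triangle
outside `D` to any other one by crossing edges that are not in `D`. -/
def HasConnectedComplement (D : Domain) : Prop :=
  ∀ t, t ∉ D → ∀ t', t' ∉ D →
    Relation.ReflTransGen (fun s s' : Tri => s' ∉ D ∧ (s.edges ∩ s'.edges).Nonempty) t t'

/-- A polygon is a simply connected domain. -/
def IsPolygon (D : Domain) : Prop := IsConnectedDomain D ∧ HasConnectedComplement D

/-! ### Lozenges and tilings -/

/-- The lozenge with middle segment `e`: the union of the two triangles that contain `e`.
A lozenge is encoded by its middle segment. -/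
def lozenge (e : Edge) : Finset Tri :=
  if e.dir = 0 then {⟨e.src, false⟩, ⟨e.src - step 1, true⟩}
  else if e.dir = 1 then {⟨e.src, true⟩, ⟨e.src - step 0, false⟩}
  else {⟨e.src + step 2, false⟩, ⟨e.src + step 2, true⟩}

/-- A set of lozenges is a tiling of `D`. -/
def IsTiling (D : Domain) (T : Finset Edge) : Prop :=
  (∀ e ∈ T, lozenge e ⊆ D) ∧ (T : Set Edge).PairwiseDisjoint lozenge ∧ T.biUnion lozenge = D

/-- The type of the tilings of `D`. -/
def TilingOf (D : Domain) : Type := {T : Finset Edge // IsTiling D T}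

/-! ### Valid paths and height functions -/

/-- An edge of `D` is valid for `T` if it does not cut the interior of a lozenge of `T`. -/
def ValidEdge (D : Domain) (T : Finset Edge) (e : Edge) : Prop := e ∈ edges D ∧ e ∉ T

/-- `ValidPath D T u v n`: there is a `T`-valid path from `u` to `v` in `D` whose image by the
evaluation function is `n` (each edge counts `1` if followed positively and `-1` otherwise). -/
inductive ValidPath (D : Domain) (T : Finset Edge) : Vertex → Vertex → ℤ → Prop
  | nil (v : Vertex) : ValidPath D T v v 0
  | fwd {u : Vertex} {n : ℤ} (e : Edge) :
      ValidPath D T u e.src n → ValidEdge D T e → ValidPath D T u e.tgt (n + 1)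
  | bwd {u : Vertex} {n : ℤ} (e : Edge) :
      ValidPath D T u e.tgt n → ValidEdge D T e → ValidPath D T u e.src (n - 1)

/-- The domains for which height functions are consistent: `D` is connected, the height functions
induced by its tilings are well defined, and on the contour they do not depend on the tiling. -/
structure AdmitsHeights (D : Domain) : Prop where
  connected : IsConnectedDomain D
  closed_path : ∀ T, IsTiling D T → ∀ v n, ValidPath D T v v n → n = 0
  contour_height : ∀ T T', IsTiling D T → IsTiling D T' →
    ∀ u ∈ contourVerts D, ∀ v ∈ contourVerts D, ∀ n m,
      ValidPath D T u v n → ValidPath D T' u v m → n = m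

open Classical in
/-- A reference vertex on the contour of `D`. -/
def baseVertex (D : Domain) : Vertex :=
  if h : (contourVerts D).Nonempty then h.choose else 0

open Classical in
/-- The height function of `T` (with respect to the reference vertex). -/
def height (D : Domain) (T : Finset Edge) (v : Vertex) : ℤ :=
  if h : ∃ n, ValidPath D T (baseVertex D) v n then h.choose else 0

/-- The order on tilings induced by the height functions. -/
def TilingLE (D : Domain) (T T' : Finset Edge) : Prop :=
  ∀ v ∈ verts D, height D T v ≤ height D T' v

def TilingLT (D : Domain) (T T' : Finset Edge) : Prop := TilingLE D T T' ∧ T ≠ T'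

/-- `T'` covers `T` among the tilings of `D`. -/
def TilingCovBy (D : Domain) (T T' : Finset Edge) : Prop :=
  IsTiling D T ∧ IsTiling D T' ∧ TilingLT D T T' ∧
    ∀ S, IsTiling D S → ¬ (TilingLT D T S ∧ TilingLT D S T')

/-- The set of lozenges rebuilt from a height function: one erases the edges along which the height
varies by `2` in absolute value, which are the middle segments of the lozenges. -/
def ofHeight (D : Domain) (h : Vertex → ℤ) : Finset Edge :=
  (edges D).filter fun e => |h e.tgt - h e.src| = 2

/-- Infimum of a set of tilings, encoded by the minimum of the height functions. -/
def infTiling (D : Domain) (S : Set (Finset Edge)) : Finset Edge :=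
  ofHeight D fun v => sInf ((fun T => height D T v) '' S)

/-- Supremum of a set of tilings, encoded by the maximum of the height functions. -/
def supTiling (D : Domain) (S : Set (Finset Edge)) : Finset Edge :=
  ofHeight D fun v => sSup ((fun T => height D T v) '' S)

def minTiling (D : Domain) : Finset Edge := infTiling D {T | IsTiling D T}

def maxTiling (D : Domain) : Finset Edge := supTiling D {T | IsTiling D T}

/-! ### Fracture zones -/

/-- A vertex is solid if its height is the same in the minimal and maximal tilings of `D`. -/
def IsSolid (D : Domain) (v : Vertex) : Prop :=
  v ∈ verts D ∧ height D (maxTiling D) v - height D (minTiling D) v = 0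

/-- The graph whose edges are the `T`-valid edges of `D`. -/
def validGraph (D : Domain) (T : Finset Edge) : SimpleGraph Vertex :=
  SimpleGraph.fromRel fun u v => ∃ e, ValidEdge D T e ∧ e.src = u ∧ e.tgt = v

/-- `L` is the set of edges of a fracture line of `D`: a repetition-free closed path of solid
vertices that is valid for some tiling of `D`. -/
def IsFractureLine (D : Domain) (L : Finset Edge) : Prop :=
  ∃ T, IsTiling D T ∧ ∃ (v : Vertex) (p : (validGraph D T).Walk v v),
    p.IsCycle ∧ (∀ u ∈ p.support, IsSolid D u) ∧
      ∀ e : Edge, e ∈ L ↔ s(e.src, e.tgt) ∈ p.edges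

/-- A non-empty part of `D` whose contour is made of fracture lines of `D`. -/
def IsDelimitedByFractureLines (D F : Domain) : Prop :=
  F.Nonempty ∧ F ⊆ D ∧ ∀ e ∈ contour F, ∃ L, IsFractureLine D L ∧ e ∈ L ∧ L ⊆ contour F

/-- A fracture zone: delimited by fracture lines, and not broken any further by them. -/
def IsFractureZone (D F : Domain) : Prop :=
  IsDelimitedByFractureLines D F ∧
    ∀ F', IsDelimitedByFractureLines D F' → F' ⊆ F → F' = F

open Classical in
def fractureZones (D : Domain) : Finset Domain := D.powerset.filter (IsFractureZone D)

/-- The lozenges of `T` that lie in `F`. -/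
def restrict (T : Finset Edge) (F : Domain) : Finset Edge := T.filter fun e => lozenge e ⊆ F

/-! ### Cubes -/

/-- A cube `(v, h)` of the cubical tessellation of space, projected along `(1, 1, 1)`: both its lowest
corner, at height `h`, and its highest corner, at height `h + 3`, are projected onto `v`. Moving it
by one unit along an axis changes `(v, h)` into `(v + step d, h + 1)`. -/
abbrev Cube := Vertex × ℤ

/-- The pile of cubes associated with a tiling: what lies between `Min(D)` and `T`. -/
def cubes (D : Domain) (T : Finset Edge) : Finset Cube :=
  (verts D).biUnion fun v =>
    ((Finset.Ico (height D (minTiling D) v) (height D T v)).filter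
      fun h => 3 ∣ h - height D (minTiling D) v).image fun h => (v, h)

/-- `T + C`: the cubes of `C` are added to the tiling `T`, each raising the height of a vertex
by `3`. -/
def addCubes (D : Domain) (T : Finset Edge) (C : Finset Cube) : Finset Edge :=
  ofHeight D fun v => height D T v + 3 * ((C.filter fun c => c.1 = v).card : ℤ)

/-- `Min_C(D)`: the infimum of the tilings of `D` that contain the cube `C`. -/
def cubeMinTiling (D : Domain) (c : Cube) : Finset Edge :=
  infTiling D {T | IsTiling D T ∧ c ∈ cubes D T}

/-- `Min_{(C_i)}(D)`: the supremum of the `Min_{C_i}(D)`; it is `Min(D)` for the empty family. -/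
def familyMinTiling (D : Domain) (C : Finset Cube) : Finset Edge :=
  supTiling D (insert (minTiling D) (cubeMinTiling D '' (C : Set Cube)))

/-! ### Piles of cubes, pseudo-hexagons, seeds and ranges -/

/-- A pile of unit cubes in the positive octant, each given by the coordinates of its lowest
corner. -/
abbrev Pile := Finset (ℕ × ℕ × ℕ)

def CompactPile (P : Pile) : Prop :=
  ∀ i j k, (i, j, k) ∈ P →
    (∀ i' ≤ i, (i', j, k) ∈ P) ∧ (∀ j' ≤ j, (i, j', k) ∈ P) ∧ (∀ k' ≤ k, (i, j, k') ∈ P)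

/-- Projection of the point `(i, j, k)` when the origin is projected onto `v`. -/
def proj (v : Vertex) (i j k : ℕ) : Vertex :=
  v + (i : ℤ) • step 0 + (j : ℤ) • step 1 + (k : ℤ) • step 2

/-- The minimal tiling of the pseudo-hexagon defined by the compact pile `P` with origin above `v`.
All cubes being removed, there remain the squares of the three base planes below the cubes; the
square orthogonal to the axis `d` with lowest corner above `w` is the lozenge with middle segment
from `w - step d` to `w`. -/
def walls (v : Vertex) (P : Pile) : Finset Edge :=
  P.biUnion fun q =>
    {⟨proj v 0 q.2.1 q.2.2 - step 0, 0⟩, ⟨proj v q.1 0 q.2.2 - step 1, 1⟩,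
      ⟨proj v q.1 q.2.1 0 - step 2, 2⟩}

/-- There is a seed of `T` at `v`: the hexagon of side 1 around `v` has its minimal tiling. -/
def IsSeed (T : Finset Edge) (v : Vertex) : Prop := ∀ d : Fin 3, (⟨v - step d, d⟩ : Edge) ∈ T

open Classical in
/-- The range in `T` of the seed at `v`, as a pile of cubes: the union of the compact piles at `v`
that define a pseudo-hexagon on which `T` is the minimal tiling. Such a pile has fewer than
`T.card + 1` cubes along each axis. -/
def rangePile (T : Finset Edge) (v : Vertex) : Pile :=
  (Finset.range (T.card + 1) ×ˢ Finset.range (T.card + 1) ×ˢ Finset.range (T.card + 1)).filter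
    fun q => ∃ P : Pile, CompactPile P ∧ q ∈ P ∧ walls v P ⊆ T

/-- The range in `T` of the seed at `v`, as a part of the domain. -/
def rangeDomain (T : Finset Edge) (v : Vertex) : Domain :=
  (walls v (rangePile T v)).biUnion lozenge

/-- A seed of `T` is proper if its range is embedded in the range of no other seed of `T`. -/
def IsProperSeed (T : Finset Edge) (v : Vertex) : Prop :=
  IsSeed T v ∧ ∀ w, IsSeed T w → rangeDomain T v ⊆ rangeDomain T w → w = v

open Classical in
def properSeeds (D : Domain) (T : Finset Edge) : Finset Vertex :=
  (verts D).filter (IsProperSeed T)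

/-- The cube with coordinates `q` with respect to the seed at `v` of `T`. -/
def cubeAt (D : Domain) (T : Finset Edge) (v : Vertex) (q : ℕ × ℕ × ℕ) : Cube :=
  (proj v q.1 q.2.1 q.2.2, height D T v + ((q.1 + q.2.1 + q.2.2 : ℕ) : ℤ))

/-- The tilings `D^n`: `D^0 = Min(D)`, and `D^(n+1)` is obtained by maximally filling the ranges of
the proper seeds of order `n`, which are the proper seeds of the tiling `D^n`. -/
def stage (D : Domain) : ℕ → Finset Edge
  | 0 => minTiling D
  | n + 1 => addCubes D (stage D n) ((properSeeds D (stage D n)).biUnion fun v =>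
      (rangePile (stage D n) v).image (cubeAt D (stage D n) v))

/-- The degree `d(D)`: the least `n` such that `D^n = Max(D)`. -/
def degree (D : Domain) : ℕ := sInf {n | stage D n = maxTiling D}

/-! ### Generation of limited partitions and limited plane partitions -/

/-- `loop(t, (a_1, …, a_q), (p_{q+1}, …, p_n))`, with `a = a_q`; the parts still to be added are
returned. The admissible `k` form an interval, run through downwards. -/
def limitedPartitionsLoop : ℕ → ℕ → List ℕ → List (List ℕ)
  | t, _, [] => if t = 0 then [[]] else []
  | t, a, p :: ps =>
    if t = 0 then [List.replicate (ps.length + 1) 0]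
    else if ps.length = 0 then [[t]]
    else
      ((List.range' 1 (min p (min t a))).reverse.filter
        fun j => t ≤ j + (ps.map fun x => min x j).sum).flatMap
          fun k => (limitedPartitionsLoop (t - k) k ps).map fun l => k :: l

/-- The partitions of `s` limited by the partition `p`, for `s ≤ p.sum`. -/
def limitedPartitions (s : ℕ) (p : List ℕ) : List (List ℕ) := limitedPartitionsLoop s s p

/-- `loop(t, (A_1, …, A_q), (P_{q+1}, …, P_n))`, with `A = A_q`; the slices still to be added are
returned. -/
def limitedPlanePartitionsLoop : ℕ → List ℕ → List (List ℕ) → List (List (List ℕ))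
  | t, _, [] => if t = 0 then [[]] else []
  | t, A, P :: Ps =>
    if t = 0 then [(P :: Ps).map fun Q => List.replicate Q.length 0]
    else if Ps.length = 0 then (limitedPartitions t (List.zipWith min A P)).map fun l => [l]
    else
      (((List.range (min t (List.zipWith min A P).sum + 1)).flatMap
        fun u => limitedPartitions u (List.zipWith min A P)).filter
          fun k => t ≤ k.sum + (Ps.map fun Q => (List.zipWith min k Q).sum).sum).flatMap
            fun k => (limitedPlanePartitionsLoop (t - k.sum) k Ps).map fun l => k :: l

/-- The plane partitions of `s` limited by the plane partition `P`, given by its slices, for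
`s` at most the weight of `P`. -/
def limitedPlanePartitions (s : ℕ) (P : List (List ℕ)) : List (List (List ℕ)) :=
  limitedPlanePartitionsLoop s (P.headD []) P

/-- The plane partition of a compact pile: its entries are the numbers of cubes in the columns. -/
def planePartition (P : Pile) : List (List ℕ) :=
  (List.range (P.filter fun q => q.2.1 = 0 ∧ q.2.2 = 0).card).map fun i =>
    (List.range (P.filter fun q => q.1 = i ∧ q.2.2 = 0).card).map fun j =>
      (P.filter fun q => q.1 = i ∧ q.2.1 = j).card

/-- The pile of cubes of a plane partition. -/
def pileOf (A : List (List ℕ)) : Pile :=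
  (Finset.range A.length).biUnion fun i =>
    (Finset.range (A.getD i []).length).biUnion fun j =>
      (Finset.range ((A.getD i []).getD j 0)).image fun k => (i, j, k)

/-- All the fillings of a seed with range `P`: the plane partitions limited by `P`, of every
weight. -/
def fillings (P : Pile) : List Pile :=
  ((List.range (((planePartition P).map List.sum).sum + 1)).flatMap
    fun s => limitedPlanePartitions s (planePartition P)).map pileOf

/-! ### The main algorithm -/

/-- The diagram of a lattice of tilings: a list of tilings, and a list of links `(T, T')` that join
a tiling `T` to a tiling `T'` immediately above it. -/
structure Diagram where
  tilings : List (Finset Edge)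
  links : List (Finset Edge × Finset Edge)

/-- Steps 3.1 and 3.2: the families of cubes obtained by choosing a filling for each proper seed of
order `k`. -/
def families (D : Domain) (k : ℕ) : List (Finset Cube) :=
  (properSeeds D (stage D k)).toList.foldr
    (fun v acc => (fillings (rangePile (stage D k) v)).flatMap fun P =>
      acc.map fun C => P.image (cubeAt D (stage D k) v) ∪ C) [∅]

open Classical in
/-- Steps 3.3 and 3.4 for the families of cubes of order `k`, where `L` is the list of the tilings
already found. For `k = 0`, the cubes are added to the empty pile `D^0`. For `k > 0`, the empty
family is skipped: it contains no cube of order `k`. -/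
def newTilings (D : Domain) (k : ℕ) (L : List (Finset Edge)) : List (Finset Edge) :=
  if k = 0 then (families D 0).map fun C => addCubes D (stage D 0) C
  else ((families D k).filter fun C => C ≠ ∅).flatMap fun C =>
    (L.filter fun t => cubes D (familyMinTiling D C) \ C ⊆ cubes D t ∧
      TilingLE D t (stage D k)).map fun t => addCubes D t C

/-- Steps 2 and 3: the list of the tilings of a fertile zone. -/
def zoneTilings (D : Domain) : List (Finset Edge) :=
  (List.range (degree D)).foldl (fun L k => L ++ newTilings D k L) []

open Classical in
/-- The inner vertices that are local minima of the height function of `T`. -/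
def localMinima (D : Domain) (T : Finset Edge) : Finset Vertex :=
  (verts D \ contourVerts D).filter fun v => ∀ d : Fin 3,
    height D T v ≤ height D T (v + step d) ∧ height D T v ≤ height D T (v - step d)

/-- Step 4: each tiling is linked to the tilings obtained by adding one cube on a local minimum. -/
def zoneLinks (D : Domain) : List (Finset Edge × Finset Edge) :=
  (zoneTilings D).flatMap fun T =>
    (localMinima D T).toList.map fun v => (T, addCubes D T {(v, height D T v)})

open Classical in
/-- The diagram computed for one fracture zone: trivial for a lozenge, steps 2 to 4 otherwise. -/
def zoneDiagram (F : Domain) : Diagram :=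
  if h : ∃ e, F = lozenge e then ⟨[{h.choose}], []⟩ else ⟨zoneTilings F, zoneLinks F⟩

/-- The product of two diagrams; tilings of disjoint zones are glued together. -/
def Diagram.prod (X Y : Diagram) : Diagram where
  tilings := X.tilings.flatMap fun S => Y.tilings.map fun T => S ∪ T
  links := (X.links.flatMap fun l => Y.tilings.map fun T => (l.1 ∪ T, l.2 ∪ T)) ++
    X.tilings.flatMap fun S => Y.links.map fun l => (S ∪ l.1, S ∪ l.2)

/-- The main algorithm: the product of the diagrams of all the fracture zones of `D`. -/
def mainAlgorithm (D : Domain) : Diagram :=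
  (fractureZones D).toList.foldr (fun F X => (zoneDiagram F).prod X) ⟨[∅], []⟩

/-- `X` is the diagram of the lattice of the tilings of `D`, every tiling of `D` and every covering
pair of tilings being listed exactly once. -/
structure Diagram.Represents (X : Diagram) (D : Domain) : Prop where
  tilings_nodup : X.tilings.Nodup
  mem_tilings : ∀ T, T ∈ X.tilings ↔ IsTiling D T
  links_nodup : X.links.Nodup
  mem_links : ∀ T T', (T, T') ∈ X.links ↔ TilingCovBy D T T'
  le_iff : ∀ T T', IsTiling D T → IsTiling D T' →
    (TilingLE D T T' ↔ Relation.ReflTransGen (fun S S' => (S, S') ∈ X.links) T T')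
  lattice : ∃ _inst : DistribLattice (TilingOf D),
    ∀ A B : TilingOf D, A ≤ B ↔ TilingLE D A.1 B.1

end

end LozengeTiling

open LozengeTiling

namespace LozengeTiling

/-! ### Incidence in the triangular grid -/

/-! Along an edge of direction `a`, `b` or `c` a height rises by 1, or falls by 2 if the edge cuts a
lozenge. Heights of two tilings are therefore congruent mod 3, and a function within the bounds -2
and 1 on every edge, with the right class mod 3 and the right contour values, is a height function
(`ofHeight_spec`). These conditions pass to pointwise minima and maxima, so the tilings form a
sublattice of the integer functions on the vertices, which gives distributivity, `Min` and `Max`. In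
a simply connected domain a closed path bounds a 2-chain that vanishes outside the domain, while the
slope of a tiling has zero circulation around each triangle inside; hence closed valid paths have
evaluation 0.

Contours are unions of cycles, so the sets delimited by fracture lines are those whose contour
consists of solid edges, which no tiling cuts (`isDelimited_iff`). The zones are thus the connected
components of the domain cut along its solid edges. No lozenge straddles two zones and heights on
their contours are frozen, so restriction and gluing are mutually inverse and the order is the
product order. If a zone has a single tiling, all its vertices are solid, and minimality reduces it
to a lozenge.

In a zone a tiling is determined by its pile of cubes, and inclusion of piles is the order
(`cubes_subset_iff`). A set of cubes each resting on the surface or on other cubes of the set can be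
added, lowest cube first (`RestsOn.exists_tiling`). A cube in the range of a seed determines the
seed and its coordinates (`FitsAt.eq_of_cubeAt_eq`): going backwards in one direction, the surface
is met after as many steps as the coordinate indicates. So the ranges are disjoint, every seed is
proper, and the addable sets inside the ranges are exactly the independent choices of fillings
(`restsOn_iff_fillings`). The recursion on plane partitions lists each filling once (`mem_fillings`,
`nodup_fillings`), since it always keeps the remaining weight within what the remaining slices can
hold.

Since `D^(k+1)` is `D^k` plus all range cubes, a tiling below `D^(k+1)` splits uniquely into its
infimum with `D^k` and a family of order `k`. The condition tested on `t` ensures that the supremum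
of `t` and the least tiling containing the family adds nothing but the family
(`mem_newTilings_succ`). By induction each tiling below `D^k` is listed once, and the chain grows
strictly until it reaches `Max`. Finally, covers are additions of one cube on a seed, seeds are the
inner local minima, and a cover in a product moves exactly one zone. -/

theorem mem_lozenge {t : Tri} {e : Edge} : t ∈ lozenge e ↔ e ∈ t.edges := by
  rcases e with ⟨⟨x, y⟩, d⟩
  rcases t with ⟨⟨p, q⟩, k⟩
  fin_cases d <;> cases k <;> simp [lozenge, Tri.edges, step] <;> omega

theorem lozenge_nonempty (e : Edge) : (lozenge e).Nonempty := by
  unfold lozenge; split_ifs <;> exact Finset.insert_nonempty _ _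

theorem exists_lozenge_eq (e : Edge) : ∃ t t', t ≠ t' ∧ lozenge e = {t, t'} := by
  unfold lozenge; split_ifs <;> exact ⟨_, _, by simp, rfl⟩

theorem card_lozenge (e : Edge) : (lozenge e).card = 2 := by
  obtain ⟨t, t', h, h'⟩ := exists_lozenge_eq e
  rw [h', Finset.card_pair h]

/-- The edges of a triangle form a positively directed cycle. -/
theorem Tri.exists_edges_eq (t : Tri) : ∃ e f g : Edge, t.edges = {e, f, g} ∧ e ≠ f ∧ f ≠ g ∧ e ≠ g ∧
    e.tgt = f.src ∧ f.tgt = g.src ∧ g.tgt = e.src := by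
  rcases t with ⟨⟨p, q⟩, k⟩
  cases k
  · exact ⟨⟨(p, q), 0⟩, ⟨(p + 1, q), 1⟩, ⟨(p + 1, q + 1), 2⟩, by simp [Tri.edges, step], by simp,
      by simp, by simp, by simp [Edge.tgt, step], by simp [Edge.tgt, step],
      by simp [Edge.tgt, step]⟩
  · exact ⟨⟨(p, q), 1⟩, ⟨(p, q + 1), 0⟩, ⟨(p + 1, q + 1), 2⟩, by simp [Tri.edges, step], by simp,
      by simp, by simp, by simp [Edge.tgt, step], by simp [Edge.tgt, step],
      by simp [Edge.tgt, step]⟩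

theorem Tri.exists_edges_eq_of_mem {t : Tri} {e : Edge} (he : e ∈ t.edges) :
    ∃ f g : Edge, t.edges = {e, f, g} ∧ e ≠ f ∧ f ≠ g ∧ e ≠ g ∧
    e.tgt = f.src ∧ f.tgt = g.src ∧ g.tgt = e.src := by
  obtain ⟨a, b, c, h, hab, hbc, hac, h1, h2, h3⟩ := t.exists_edges_eq
  rw [h] at he ⊢
  simp only [Finset.mem_insert, Finset.mem_singleton] at he
  rcases he with rfl | rfl | rfl
  · exact ⟨b, c, rfl, hab, hbc, hac, h1, h2, h3⟩
  · refine ⟨c, a, ?_, hbc, hac.symm, hab.symm, h2, h3, h1⟩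
    ext; simp; tauto
  · refine ⟨a, b, ?_, hac.symm, hab, hbc.symm, h3, h1, h2⟩
    ext; simp; tauto

theorem Tri.sum_edges_sub {M : Type*} [AddCommGroup M] (t : Tri) (f : Vertex → M) :
    ∑ e ∈ t.edges, (f e.tgt - f e.src) = 0 := by
  obtain ⟨a, b, c, h, hab, hbc, hac, h1, h2, h3⟩ := t.exists_edges_eq
  rw [h, Finset.sum_insert (by simp [hab, hac]), Finset.sum_pair hbc, h1, h2, h3]
  abel

theorem Tri.src_mem_verts {t : Tri} {e : Edge} (he : e ∈ t.edges) : e.src ∈ t.verts :=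
  Finset.mem_image_of_mem _ he

theorem Tri.tgt_mem_verts {t : Tri} {e : Edge} (he : e ∈ t.edges) : e.tgt ∈ t.verts := by
  obtain ⟨f, g, h, -, -, -, h1, -, -⟩ := Tri.exists_edges_eq_of_mem he
  rw [h1]
  exact Tri.src_mem_verts (by simp [h])

theorem mem_edges {D : Domain} {e : Edge} : e ∈ edges D ↔ ∃ t ∈ D, e ∈ t.edges := by
  simp [edges]

theorem mem_verts {D : Domain} {v : Vertex} : v ∈ verts D ↔ ∃ t ∈ D, v ∈ t.verts := by
  simp [verts]

theorem mem_edges_of_mem {D : Domain} {t : Tri} (ht : t ∈ D) {e : Edge} (he : e ∈ t.edges) :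
    e ∈ edges D := mem_edges.2 ⟨t, ht, he⟩

theorem src_mem_verts {D : Domain} {e : Edge} (he : e ∈ edges D) : e.src ∈ verts D := by
  obtain ⟨t, ht, h⟩ := mem_edges.1 he
  exact mem_verts.2 ⟨t, ht, Tri.src_mem_verts h⟩

theorem tgt_mem_verts {D : Domain} {e : Edge} (he : e ∈ edges D) : e.tgt ∈ verts D := by
  obtain ⟨t, ht, h⟩ := mem_edges.1 he
  exact mem_verts.2 ⟨t, ht, Tri.tgt_mem_verts h⟩

theorem mem_edges_of_lozenge_subset {D : Domain} {e : Edge} (h : lozenge e ⊆ D) : e ∈ edges D := by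
  obtain ⟨t, ht⟩ := lozenge_nonempty e
  exact mem_edges_of_mem (h ht) (mem_lozenge.1 ht)

theorem filter_mem_edges (D : Domain) (e : Edge) :
    (D.filter fun t => e ∈ t.edges) = D ∩ lozenge e := by
  ext t; simp [mem_lozenge]

/-- An edge lies on the contour iff exactly one of its two triangles is in the domain. -/
theorem mem_contour {D : Domain} {e : Edge} :
    e ∈ contour D ↔ ∃ t t', lozenge e = {t, t'} ∧ t ∈ D ∧ t' ∉ D := by
  obtain ⟨a, b, hab, h⟩ := exists_lozenge_eq e
  rw [contour, Finset.mem_filter, filter_mem_edges, mem_edges]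
  constructor
  · rintro ⟨-, h1⟩
    rw [h] at h1 ⊢
    by_cases ha : a ∈ D <;> by_cases hb : b ∈ D
    · rw [Finset.inter_eq_right.2 (by simp [Finset.insert_subset_iff, ha, hb]),
        Finset.card_pair hab] at h1
      omega
    · exact ⟨a, b, rfl, ha, hb⟩
    · exact ⟨b, a, Finset.pair_comm _ _, hb, ha⟩
    · rw [Finset.card_eq_one] at h1
      obtain ⟨c, hc⟩ := h1
      have := (Finset.ext_iff.1 hc c)
      simp at this
      rcases this with ⟨h1, rfl | rfl⟩ <;> contradiction
  · rintro ⟨t, t', h', ht, ht'⟩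
    refine ⟨⟨t, ht, mem_lozenge.1 (by simp [h'])⟩, ?_⟩
    rw [h', Finset.card_eq_one]
    refine ⟨t, ?_⟩
    ext x
    simp only [Finset.mem_inter, Finset.mem_insert, Finset.mem_singleton]
    constructor
    · rintro ⟨h1, rfl | rfl⟩
      · rfl
      · contradiction
    · rintro rfl; exact ⟨ht, Or.inl rfl⟩

theorem contour_subset_edges (D : Domain) : contour D ⊆ edges D := Finset.filter_subset _ _

theorem lozenge_subset_of_notMem_contour {D : Domain} {e : Edge} (he : e ∈ edges D)
    (h : e ∉ contour D) : lozenge e ⊆ D := by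
  obtain ⟨t, ht, h1⟩ := mem_edges.1 he
  intro t' ht'
  by_contra hn
  refine h (mem_contour.2 ⟨t, t', ?_, ht, hn⟩)
  have hne : t ≠ t' := by rintro rfl; exact hn ht
  refine (Finset.eq_of_subset_of_card_le ?_ ?_).symm
  · simp [Finset.insert_subset_iff, mem_lozenge.2 h1, ht']
  · rw [Finset.card_pair hne, card_lozenge]

theorem notMem_contour_of_lozenge_subset {D : Domain} {e : Edge} (h : lozenge e ⊆ D) :
    e ∉ contour D := by
  intro h'
  obtain ⟨t, t', h1, -, h2⟩ := mem_contour.1 h'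
  exact h2 (h (by simp [h1]))

theorem contour_nonempty {D : Domain} (hD : D.Nonempty) : (contour D).Nonempty := by
  -- Across its edge of direction `a` for one orientation, `b` for the other, a triangle has a
  -- neighbour whose corner has a smaller coordinate sum. For an extremal triangle this neighbour is
  -- outside.
  obtain ⟨t, ht, hmin⟩ := D.exists_min_image (fun t => t.corner.1 + t.corner.2) hD
  rcases t with ⟨⟨x, y⟩, k⟩
  cases k
  · refine ⟨⟨(x, y), 0⟩, mem_contour.2 ⟨_, ⟨(x, y - 1), true⟩, by simp [lozenge, step], ht, ?_⟩⟩
    intro h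
    have := hmin _ h
    simp at this
  · refine ⟨⟨(x, y), 1⟩, mem_contour.2 ⟨_, ⟨(x - 1, y), false⟩, by simp [lozenge, step], ht, ?_⟩⟩
    intro h
    have := hmin _ h
    simp at this

theorem contourVerts_nonempty {D : Domain} (hD : D.Nonempty) : (contourVerts D).Nonempty := by
  obtain ⟨e, he⟩ := contour_nonempty hD
  exact ⟨e.src, Finset.mem_union_left _ (Finset.mem_image_of_mem _ he)⟩

theorem mem_contourVerts {D : Domain} {v : Vertex} :
    v ∈ contourVerts D ↔ ∃ e ∈ contour D, e.src = v ∨ e.tgt = v := by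
  simp only [contourVerts, Finset.mem_union, Finset.mem_image]
  constructor
  · rintro (⟨e, h, h'⟩ | ⟨e, h, h'⟩)
    exacts [⟨e, h, Or.inl h'⟩, ⟨e, h, Or.inr h'⟩]
  · rintro ⟨e, h, h' | h'⟩
    exacts [Or.inl ⟨e, h, h'⟩, Or.inr ⟨e, h, h'⟩]

theorem contourVerts_subset_verts (D : Domain) : contourVerts D ⊆ verts D := by
  intro v hv
  obtain ⟨e, he, rfl | rfl⟩ := mem_contourVerts.1 hv
  exacts [src_mem_verts (contour_subset_edges D he), tgt_mem_verts (contour_subset_edges D he)]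

theorem baseVertex_mem {D : Domain} (hD : D.Nonempty) : baseVertex D ∈ contourVerts D := by
  rw [baseVertex, dif_pos (contourVerts_nonempty hD)]
  exact (contourVerts_nonempty hD).choose_spec

/-! ### Tilings as exact choices of an edge in each triangle -/

/-- A triangle is covered by a lozenge exactly when the middle segment is one of its edges, so
disjointness and covering become one local condition per triangle. This is the form in which
constructed sets of edges are checked to be tilings. -/
theorem isTiling_iff {D : Domain} {T : Finset Edge} :
    IsTiling D T ↔ (∀ e ∈ T, lozenge e ⊆ D) ∧ ∀ t ∈ D, ∃! e, e ∈ T ∧ e ∈ t.edges := by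
  constructor
  · rintro ⟨h1, h2, h3⟩
    refine ⟨h1, fun t ht => ?_⟩
    rw [← h3] at ht
    obtain ⟨e, he, hte⟩ := Finset.mem_biUnion.1 ht
    refine ⟨e, ⟨he, mem_lozenge.1 hte⟩, ?_⟩
    rintro f ⟨hf, htf⟩
    by_contra hne
    exact Finset.disjoint_left.1 (h2 hf he hne) (mem_lozenge.2 htf) hte
  · rintro ⟨h1, h2⟩
    refine ⟨h1, ?_, ?_⟩
    · intro e he f hf hne
      refine Finset.disjoint_left.2 fun t hte htf => hne ?_
      exact (h2 t (h1 e he hte)).unique ⟨he, mem_lozenge.1 hte⟩ ⟨hf, mem_lozenge.1 htf⟩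
    · ext t
      simp only [Finset.mem_biUnion]
      constructor
      · rintro ⟨e, he, hte⟩; exact h1 e he hte
      · intro ht
        obtain ⟨e, ⟨he, hte⟩, -⟩ := h2 t ht
        exact ⟨e, he, mem_lozenge.2 hte⟩

theorem IsTiling.eq_of_mem {D : Domain} {T : Finset Edge} (h : IsTiling D T) {t : Tri}
    {e f : Edge} (he : e ∈ T) (hf : f ∈ T) (hte : e ∈ t.edges) (htf : f ∈ t.edges) : e = f :=
  ((isTiling_iff.1 h).2 t (h.1 e he (mem_lozenge.2 hte))).unique ⟨he, hte⟩ ⟨hf, htf⟩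

theorem IsTiling.mem_edges {D : Domain} {T : Finset Edge} (h : IsTiling D T) {e : Edge}
    (he : e ∈ T) : e ∈ edges D := mem_edges_of_lozenge_subset (h.1 e he)

theorem IsTiling.notMem_of_contour {D : Domain} {T : Finset Edge} (h : IsTiling D T) {e : Edge}
    (he : e ∈ contour D) : e ∉ T := fun he' => notMem_contour_of_lozenge_subset (h.1 e he') he

/-- The variation of heights along the edges prescribed by a set of lozenges. -/
def slope (T : Finset Edge) (e : Edge) : ℤ := if e ∈ T then -2 else 1

/-- Exactly one of the three edges is cut, and -2 + 1 + 1 = 0. -/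
theorem IsTiling.sum_slope {D : Domain} {T : Finset Edge} (h : IsTiling D T) {t : Tri}
    (ht : t ∈ D) : ∑ e ∈ t.edges, slope T e = 0 := by
  obtain ⟨e, ⟨he, hte⟩, hu⟩ := (isTiling_iff.1 h).2 t ht
  obtain ⟨f, g, heq, hef, hfg, heg, -⟩ := Tri.exists_edges_eq_of_mem hte
  have hf : f ∉ T := fun h' => hef (hu f ⟨h', by simp [heq]⟩).symm
  have hg : g ∉ T := fun h' => heg (hu g ⟨h', by simp [heq]⟩).symm
  rw [heq, Finset.sum_insert (by simp [hef, heg]), Finset.sum_pair hfg]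
  simp [slope, he, hf, hg]

/-! ### Valid paths and heights -/

theorem ValidPath.trans {D : Domain} {T : Finset Edge} {u v w : Vertex} {n m : ℤ}
    (h : ValidPath D T u v n) (h' : ValidPath D T v w m) : ValidPath D T u w (n + m) := by
  induction h' with
  | nil => simpa using h
  | fwd e _ he ih => rw [← add_assoc]; exact ih.fwd e he
  | bwd e _ he ih => rw [← add_sub_assoc]; exact ih.bwd e he

theorem ValidPath.symm {D : Domain} {T : Finset Edge} {u v : Vertex} {n : ℤ}
    (h : ValidPath D T u v n) : ValidPath D T v u (-n) := by
  induction h with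
  | nil => simpa using ValidPath.nil _
  | @fwd n e _ he ih =>
    have := ((ValidPath.nil e.tgt).bwd e he).trans ih
    convert this using 1; ring
  | @bwd n e _ he ih =>
    have := ((ValidPath.nil e.src).fwd e he).trans ih
    convert this using 1; ring

/-- `h` varies along the edges of `D` as the tiling `T` prescribes. -/
def IsHeightOf (D : Domain) (T : Finset Edge) (h : Vertex → ℤ) : Prop :=
  ∀ e ∈ edges D, h e.tgt = h e.src + slope T e

theorem ValidPath.eq_add {D : Domain} {T : Finset Edge} {h : Vertex → ℤ} (hh : IsHeightOf D T h)
    {u v : Vertex} {n : ℤ} (p : ValidPath D T u v n) : h v = h u + n := by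
  induction p with
  | nil => simp
  | fwd e _ he ih => rw [hh e he.1, ih, slope, if_neg he.2]; ring
  | bwd e _ he ih =>
    have := hh e he.1
    rw [ih, slope, if_neg he.2] at this
    linarith

/-- A function that is constant along the edges of `D` is constant along paths. -/
theorem ValidPath.eq_of_forall_edge {D : Domain} {T : Finset Edge} {M : Type*} {h : Vertex → M}
    (hh : ∀ e ∈ edges D, h e.tgt = h e.src) {u v : Vertex} {n : ℤ} (p : ValidPath D T u v n) :
    h v = h u := by
  induction p with
  | nil => rfl
  | fwd e _ he ih => rw [hh e he.1, ih]
  | bwd e _ he ih => rw [← hh e he.1, ih]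

/-- If an edge of a triangle of `D` belongs to `T`, the two other ones form a valid path. -/
theorem IsTiling.validPath_of_mem {D : Domain} {T : Finset Edge} (hT : IsTiling D T) {e : Edge}
    (he : e ∈ T) : ValidPath D T e.src e.tgt (-2) := by
  obtain ⟨t, ht⟩ := lozenge_nonempty e
  have htD := hT.1 e he ht
  rw [mem_lozenge] at ht
  obtain ⟨f, g, heq, hef, hfg, heg, h1, h2, h3⟩ := Tri.exists_edges_eq_of_mem ht
  have hf : ValidEdge D T f := ⟨mem_edges_of_mem htD (by simp [heq]),
    fun h => hef (hT.eq_of_mem he h ht (by simp [heq]))⟩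
  have hg : ValidEdge D T g := ⟨mem_edges_of_mem htD (by simp [heq]),
    fun h => heg (hT.eq_of_mem he h ht (by simp [heq]))⟩
  have p := (ValidPath.nil g.tgt).bwd g hg
  rw [← h2] at p
  have q := p.bwd f hf
  rw [h3, ← h1] at q
  simpa using q

theorem IsTiling.exists_validPath_edge {D : Domain} {T : Finset Edge} (hT : IsTiling D T)
    {e : Edge} (he : e ∈ edges D) : ValidPath D T e.src e.tgt (slope T e) := by
  by_cases h : e ∈ T
  · simpa [slope, h] using hT.validPath_of_mem h
  · simpa [slope, h] using (ValidPath.nil e.src).fwd e ⟨he, h⟩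

theorem IsTiling.exists_validPath_tri {D : Domain} {T : Finset Edge} (hT : IsTiling D T)
    {t : Tri} (ht : t ∈ D) {u v : Vertex} (hu : u ∈ t.verts) (hv : v ∈ t.verts) :
    ∃ n, ValidPath D T u v n := by
  obtain ⟨e, he, rfl⟩ := Finset.mem_image.1 hu
  obtain ⟨f, g, heq, -, -, -, h1, h2, h3⟩ := Tri.exists_edges_eq_of_mem he
  obtain ⟨e', he', rfl⟩ := Finset.mem_image.1 hv
  rw [heq] at he'
  simp only [Finset.mem_insert, Finset.mem_singleton] at he'
  rcases he' with rfl | rfl | rfl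
  · exact ⟨_, ValidPath.nil _⟩
  · rw [← h1]
    exact ⟨_, hT.exists_validPath_edge (mem_edges_of_mem ht he)⟩
  · rw [← h3]
    exact ⟨_, (hT.exists_validPath_edge (mem_edges_of_mem ht (by simp [heq]))).symm⟩

/-- A cut edge can be replaced by the other two sides of an adjacent triangle, so the vertices of
one triangle are always joined; consecutive triangles of a connected domain share a vertex. -/
theorem IsTiling.exists_validPath {D : Domain} {T : Finset Edge} (hT : IsTiling D T)
    (hD : IsConnectedDomain D) {u v : Vertex} (hu : u ∈ verts D) (hv : v ∈ verts D) :
    ∃ n, ValidPath D T u v n := by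
  obtain ⟨t, ht, hut⟩ := mem_verts.1 hu
  obtain ⟨t', ht', hvt⟩ := mem_verts.1 hv
  have key : t' ∈ D ∧ ∀ v ∈ t'.verts, ∃ n, ValidPath D T u v n := by
    have := hD t ht t' ht'
    clear hvt hv ht'
    induction this with
    | refl => exact ⟨ht, fun v hv => hT.exists_validPath_tri ht hut hv⟩
    | tail _ hs ih =>
      obtain ⟨hs, w, hw⟩ := hs
      rw [Finset.mem_inter] at hw
      obtain ⟨n, hn⟩ := ih.2 w hw.1
      refine ⟨hs, fun v hv => ?_⟩
      obtain ⟨m, hm⟩ := hT.exists_validPath_tri hs hw.2 hv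
      exact ⟨_, hn.trans hm⟩
  exact key.2 v hvt

theorem nonempty_of_mem_verts {D : Domain} {v : Vertex} (hv : v ∈ verts D) : D.Nonempty := by
  obtain ⟨t, ht, -⟩ := mem_verts.1 hv
  exact ⟨t, ht⟩

theorem baseVertex_mem_verts {D : Domain} (hD : D.Nonempty) : baseVertex D ∈ verts D :=
  contourVerts_subset_verts D (baseVertex_mem hD)

theorem IsTiling.validPath_height {D : Domain} {T : Finset Edge} (hT : IsTiling D T)
    (hD : IsConnectedDomain D) {v : Vertex} (hv : v ∈ verts D) :
    ValidPath D T (baseVertex D) v (height D T v) := by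
  have h := hT.exists_validPath hD (baseVertex_mem_verts (nonempty_of_mem_verts hv)) hv
  rw [height, dif_pos h]
  exact h.choose_spec

theorem IsTiling.isHeightOf_height {D : Domain} {T : Finset Edge} (hT : IsTiling D T)
    (hD : IsConnectedDomain D) (hc : ∀ v n, ValidPath D T v v n → n = 0) :
    IsHeightOf D T (height D T) := by
  intro e he
  have h1 := hT.validPath_height hD (src_mem_verts he)
  have h2 := hT.validPath_height hD (tgt_mem_verts he)
  have := hc _ _ ((h1.trans (hT.exists_validPath_edge he)).trans h2.symm)
  linarith

namespace AdmitsHeights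

variable {D : Domain} {T T' : Finset Edge}

theorem isHeightOf (hD : AdmitsHeights D) (hT : IsTiling D T) : IsHeightOf D T (height D T) :=
  hT.isHeightOf_height hD.connected (hD.closed_path T hT)

theorem height_base (hD : AdmitsHeights D) (hT : IsTiling D T) (hne : D.Nonempty) :
    height D T (baseVertex D) = 0 :=
  hD.closed_path T hT _ _ (hT.validPath_height hD.connected (baseVertex_mem_verts hne))

theorem height_contour (hD : AdmitsHeights D) (hT : IsTiling D T) (hT' : IsTiling D T')
    {v : Vertex} (hv : v ∈ contourVerts D) : height D T v = height D T' v := by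
  have hv' := contourVerts_subset_verts D hv
  exact hD.contour_height T T' hT hT' _ (baseVertex_mem (nonempty_of_mem_verts hv')) v hv _ _
    (hT.validPath_height hD.connected hv') (hT'.validPath_height hD.connected hv')

/-- A height function for `T` agrees with `height D T` up to a constant. -/
theorem eq_height_add (hD : AdmitsHeights D) (hT : IsTiling D T) {h : Vertex → ℤ}
    (hh : IsHeightOf D T h) {v : Vertex} (hv : v ∈ verts D) :
    h v = height D T v + h (baseVertex D) := by
  rw [(hT.validPath_height hD.connected hv).eq_add hh]; ring

/-- The two possible variations 1 and -2 agree mod 3, so the difference is constant mod 3; it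
vanishes at the reference vertex. -/
theorem height_congr (hD : AdmitsHeights D) (hT : IsTiling D T) (hT' : IsTiling D T')
    {v : Vertex} (hv : v ∈ verts D) : (3 : ℤ) ∣ height D T v - height D T' v := by
  have key : ((height D T v - height D T' v : ℤ) : ZMod 3)
      = ((height D T (baseVertex D) - height D T' (baseVertex D) : ℤ) : ZMod 3) := by
    refine ValidPath.eq_of_forall_edge (h := fun v => ((height D T v - height D T' v : ℤ) : ZMod 3))
      ?_ (hT.validPath_height hD.connected hv)
    intro e he
    simp only [hD.isHeightOf hT e he, hD.isHeightOf hT' e he, slope]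
    rw [← sub_eq_zero, ← Int.cast_sub, ZMod.intCast_zmod_eq_zero_iff_dvd]
    split_ifs <;> omega
  have hne := nonempty_of_mem_verts hv
  rw [hD.height_base hT hne, hD.height_base hT' hne] at key
  exact (ZMod.intCast_zmod_eq_zero_iff_dvd _ 3).1 (by simpa using key)

theorem height_tgt_le (hD : AdmitsHeights D) (hT : IsTiling D T) {e : Edge} (he : e ∈ edges D) :
    height D T e.tgt ≤ height D T e.src + 1 := by
  rw [hD.isHeightOf hT e he, slope]; split_ifs <;> omega

theorem height_src_le (hD : AdmitsHeights D) (hT : IsTiling D T) {e : Edge} (he : e ∈ edges D) :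
    height D T e.src ≤ height D T e.tgt + 2 := by
  rw [hD.isHeightOf hT e he, slope]; split_ifs <;> omega

theorem mem_iff_height (hD : AdmitsHeights D) (hT : IsTiling D T) {e : Edge} (he : e ∈ edges D) :
    e ∈ T ↔ height D T e.tgt ≠ height D T e.src + 1 := by
  rw [hD.isHeightOf hT e he, slope]; split_ifs with h <;> simp [h]

theorem eq_of_height_eq (hD : AdmitsHeights D) (hT : IsTiling D T) (hT' : IsTiling D T')
    (h : ∀ v ∈ verts D, height D T v = height D T' v) : T = T' := by
  have key : ∀ {T T'}, IsTiling D T → IsTiling D T' →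
      (∀ v ∈ verts D, height D T v = height D T' v) → T ⊆ T' := by
    intro T T' hT hT' h e he
    have hed := hT.mem_edges he
    rw [hD.mem_iff_height hT hed, h _ (src_mem_verts hed), h _ (tgt_mem_verts hed)] at he
    exact (hD.mem_iff_height hT' hed).2 he
  exact (key hT hT' h).antisymm (key hT' hT fun v hv => (h v hv).symm)

theorem tilingLE_antisymm (hD : AdmitsHeights D) (hT : IsTiling D T) (hT' : IsTiling D T')
    (h : TilingLE D T T') (h' : TilingLE D T' T) : T = T' :=
  hD.eq_of_height_eq hT hT' fun v hv => (h v hv).antisymm (h' v hv)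

/-- The functions that satisfy the local constraints are the height functions. -/
theorem ofHeight_spec (hD : AdmitsHeights D) (hT : IsTiling D T) {h : Vertex → ℤ}
    (h1 : ∀ e ∈ edges D, h e.tgt ≤ h e.src + 1) (h2 : ∀ e ∈ edges D, h e.src ≤ h e.tgt + 2)
    (h3 : ∀ v ∈ verts D, (3 : ℤ) ∣ h v - height D T v)
    (h4 : ∀ v ∈ contourVerts D, h v = height D T v) :
    IsTiling D (ofHeight D h) ∧ ∀ v ∈ verts D, height D (ofHeight D h) v = h v := by
  have hmem : ∀ e ∈ edges D, e ∈ ofHeight D h ↔ h e.tgt = h e.src - 2 := by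
    intro e he
    have a := h1 e he
    have b := h2 e he
    simp only [ofHeight, Finset.mem_filter, he, true_and]
    rw [abs_eq (by norm_num)]
    omega
  -- `h1` and `h2` confine each variation to the interval from -2 to 1, and `h3` makes it congruent
  -- mod 3 to a variation of `T`. Only 1 and -2 remain.
  have hslope : IsHeightOf D (ofHeight D h) h := by
    intro e he
    have a := h1 e he
    have b := h2 e he
    have c := h3 _ (src_mem_verts he)
    have d := h3 _ (tgt_mem_verts he)
    have k := hD.isHeightOf hT e he
    rw [slope] at k ⊢
    simp only [hmem e he]
    split_ifs at k ⊢ <;> omega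
  have htil : IsTiling D (ofHeight D h) := by
    refine isTiling_iff.2 ⟨fun e he => ?_, fun t ht => ?_⟩
    · have hed : e ∈ edges D := (Finset.mem_filter.1 he).1
      -- At both ends of a contour edge `h` agrees with the height of `T`, which rises by 1 there;
      -- an erased edge would fall by 2.
      refine lozenge_subset_of_notMem_contour hed fun hc => ?_
      have k := hD.isHeightOf hT e hed
      rw [slope, if_neg (hT.notMem_of_contour hc), ← h4 _ (mem_contourVerts.2 ⟨e, hc, Or.inl rfl⟩),
        ← h4 _ (mem_contourVerts.2 ⟨e, hc, Or.inr rfl⟩), (hmem e hed).1 he] at k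
      omega
    · obtain ⟨a, b, c, heq, hab, hbc, hac, e1, e2, e3⟩ := t.exists_edges_eq
      have sa := hslope a (mem_edges_of_mem ht (by simp [heq]))
      have sb := hslope b (mem_edges_of_mem ht (by simp [heq]))
      have sc := hslope c (mem_edges_of_mem ht (by simp [heq]))
      rw [e1] at sa
      rw [e2] at sb
      rw [e3] at sc
      rw [heq]
      -- The variations around the triangle, each 1 or -2, add up to 0, so exactly one of them is
      -- -2. This discards five of the eight cases.
      by_cases ha : a ∈ ofHeight D h <;> by_cases hb : b ∈ ofHeight D h <;>
        by_cases hc : c ∈ ofHeight D h <;> simp only [slope, ha, hb, hc, if_true, if_false] at sa sb sc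
      any_goals omega
      · refine ⟨a, ⟨ha, by simp⟩, fun y hy => ?_⟩
        rcases hy with ⟨hy, hy'⟩
        simp only [Finset.mem_insert, Finset.mem_singleton] at hy'
        rcases hy' with rfl | rfl | rfl <;> first | rfl | contradiction
      · refine ⟨b, ⟨hb, by simp⟩, fun y hy => ?_⟩
        rcases hy with ⟨hy, hy'⟩
        simp only [Finset.mem_insert, Finset.mem_singleton] at hy'
        rcases hy' with rfl | rfl | rfl <;> first | rfl | contradiction
      · refine ⟨c, ⟨hc, by simp⟩, fun y hy => ?_⟩
        rcases hy with ⟨hy, hy'⟩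
        simp only [Finset.mem_insert, Finset.mem_singleton] at hy'
        rcases hy' with rfl | rfl | rfl <;> first | rfl | contradiction
  refine ⟨htil, fun v hv => ?_⟩
  have hne := nonempty_of_mem_verts hv
  have := hD.eq_height_add htil hslope hv
  rw [h4 _ (baseVertex_mem hne), hD.height_base hT hne] at this
  omega

theorem ofHeight_height (hD : AdmitsHeights D) (hT : IsTiling D T) {h : Vertex → ℤ}
    (hh : ∀ v ∈ verts D, h v = height D T v) : ofHeight D h = T := by
  have := hD.ofHeight_spec hT (h := h) ?_ ?_ ?_ ?_
  · exact hD.eq_of_height_eq this.1 hT fun v hv => (this.2 v hv).trans (hh v hv)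
  · intro e he
    rw [hh _ (src_mem_verts he), hh _ (tgt_mem_verts he)]
    exact hD.height_tgt_le hT he
  · intro e he
    rw [hh _ (src_mem_verts he), hh _ (tgt_mem_verts he)]
    exact hD.height_src_le hT he
  · intro v hv; simp [hh v hv]
  · intro v hv; exact hh v (contourVerts_subset_verts D hv)

theorem finite_tilings (D : Domain) : {T | IsTiling D T}.Finite :=
  (edges D).powerset.finite_toSet.subset fun T hT => by
    rw [Finset.mem_coe, Finset.mem_powerset]
    exact fun e he => IsTiling.mem_edges hT he

/-! ### Infima and suprema of tilings -/

/-- The set is finite, so the minimum at each vertex is attained by one of its tilings. Each of the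
four conditions of `ofHeight_spec` then follows from the same condition for the tiling that attains
the minimum at the larger end of the inequality. -/
theorem infTiling_spec (hD : AdmitsHeights D) {S : Set (Finset Edge)} (hne : S.Nonempty)
    (hS : ∀ T ∈ S, IsTiling D T) : IsTiling D (infTiling D S) ∧
      ∀ v ∈ verts D, IsLeast ((fun T => height D T v) '' S) (height D (infTiling D S) v) := by
  have hfin : S.Finite := (finite_tilings D).subset hS
  have hleast : ∀ v, IsLeast ((fun T => height D T v) '' S) (sInf ((fun T => height D T v) '' S)) :=
    fun v => ⟨Int.csInf_mem (hne.image _) (hfin.image _).bddBelow,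
      fun x hx => csInf_le (hfin.image _).bddBelow hx⟩
  obtain ⟨T₀, hT₀⟩ := hne
  have := hD.ofHeight_spec (hS T₀ hT₀) (h := fun v => sInf ((fun T => height D T v) '' S)) ?_ ?_ ?_ ?_
  · refine ⟨this.1, fun v hv => ?_⟩
    rw [infTiling, this.2 v hv]
    exact hleast v
  · intro e he
    obtain ⟨⟨T, hT, h⟩, -⟩ := hleast e.src
    refine ((hleast e.tgt).2 ⟨T, hT, rfl⟩).trans ?_
    rw [← h]
    exact hD.height_tgt_le (hS T hT) he
  · intro e he
    obtain ⟨⟨T, hT, h⟩, -⟩ := hleast e.tgt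
    refine ((hleast e.src).2 ⟨T, hT, rfl⟩).trans ?_
    rw [← h]
    exact hD.height_src_le (hS T hT) he
  · intro v hv
    obtain ⟨⟨T, hT, h⟩, -⟩ := hleast v
    rw [← h]
    exact hD.height_congr (hS T hT) (hS T₀ hT₀) hv
  · intro v hv
    obtain ⟨⟨T, hT, h⟩, -⟩ := hleast v
    rw [← h]
    exact hD.height_contour (hS T hT) (hS T₀ hT₀) hv

theorem supTiling_spec (hD : AdmitsHeights D) {S : Set (Finset Edge)} (hne : S.Nonempty)
    (hS : ∀ T ∈ S, IsTiling D T) : IsTiling D (supTiling D S) ∧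
      ∀ v ∈ verts D, IsGreatest ((fun T => height D T v) '' S) (height D (supTiling D S) v) := by
  have hfin : S.Finite := (finite_tilings D).subset hS
  have hgr : ∀ v, IsGreatest ((fun T => height D T v) '' S) (sSup ((fun T => height D T v) '' S)) :=
    fun v => ⟨Int.csSup_mem (hne.image _) (hfin.image _).bddAbove,
      fun x hx => le_csSup (hfin.image _).bddAbove hx⟩
  obtain ⟨T₀, hT₀⟩ := hne
  have := hD.ofHeight_spec (hS T₀ hT₀) (h := fun v => sSup ((fun T => height D T v) '' S)) ?_ ?_ ?_ ?_
  · refine ⟨this.1, fun v hv => ?_⟩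
    rw [supTiling, this.2 v hv]
    exact hgr v
  · intro e he
    obtain ⟨⟨T, hT, h⟩, -⟩ := hgr e.tgt
    have := (hgr e.src).2 ⟨T, hT, rfl⟩
    have h' := hD.height_tgt_le (hS T hT) he
    simp only at this h ⊢
    omega
  · intro e he
    obtain ⟨⟨T, hT, h⟩, -⟩ := hgr e.src
    have := (hgr e.tgt).2 ⟨T, hT, rfl⟩
    have h' := hD.height_src_le (hS T hT) he
    simp only at this h ⊢
    omega
  · intro v hv
    obtain ⟨⟨T, hT, h⟩, -⟩ := hgr v
    rw [← h]
    exact hD.height_congr (hS T hT) (hS T₀ hT₀) hv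
  · intro v hv
    obtain ⟨⟨T, hT, h⟩, -⟩ := hgr v
    rw [← h]
    exact hD.height_contour (hS T hT) (hS T₀ hT₀) hv

theorem isTiling_infTiling (hD : AdmitsHeights D) {S : Set (Finset Edge)} (hne : S.Nonempty)
    (hS : ∀ T ∈ S, IsTiling D T) : IsTiling D (infTiling D S) := (hD.infTiling_spec hne hS).1

theorem isTiling_supTiling (hD : AdmitsHeights D) {S : Set (Finset Edge)} (hne : S.Nonempty)
    (hS : ∀ T ∈ S, IsTiling D T) : IsTiling D (supTiling D S) := (hD.supTiling_spec hne hS).1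

theorem infTiling_le (hD : AdmitsHeights D) {S : Set (Finset Edge)}
    (hS : ∀ T ∈ S, IsTiling D T) (hT : T ∈ S) : TilingLE D (infTiling D S) T :=
  fun v hv => ((hD.infTiling_spec ⟨T, hT⟩ hS).2 v hv).2 ⟨T, hT, rfl⟩

theorem le_supTiling (hD : AdmitsHeights D) {S : Set (Finset Edge)}
    (hS : ∀ T ∈ S, IsTiling D T) (hT : T ∈ S) : TilingLE D T (supTiling D S) :=
  fun v hv => ((hD.supTiling_spec ⟨T, hT⟩ hS).2 v hv).2 ⟨T, hT, rfl⟩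

theorem isTiling_minTiling (hD : AdmitsHeights D) (hne : ∃ T, IsTiling D T) :
    IsTiling D (minTiling D) := hD.isTiling_infTiling hne fun _ h => h

theorem isTiling_maxTiling (hD : AdmitsHeights D) (hne : ∃ T, IsTiling D T) :
    IsTiling D (maxTiling D) := hD.isTiling_supTiling hne fun _ h => h

theorem minTiling_le (hD : AdmitsHeights D) (hT : IsTiling D T) : TilingLE D (minTiling D) T :=
  hD.infTiling_le (fun _ h => h) hT

theorem le_maxTiling (hD : AdmitsHeights D) (hT : IsTiling D T) : TilingLE D T (maxTiling D) :=
  hD.le_supTiling (fun _ h => h) hT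

/-- Binary infimum and supremum. -/
theorem height_infTiling_pair (hD : AdmitsHeights D) (hT : IsTiling D T) (hT' : IsTiling D T')
    {v : Vertex} (hv : v ∈ verts D) :
    height D (infTiling D {T, T'}) v = min (height D T v) (height D T' v) := by
  have h := (hD.infTiling_spec (S := {T, T'}) ⟨T, by simp⟩ (by rintro _ (rfl | rfl) <;> assumption)).2
    v hv
  rw [Set.image_pair] at h
  exact h.unique isLeast_pair

theorem height_supTiling_pair (hD : AdmitsHeights D) (hT : IsTiling D T) (hT' : IsTiling D T')
    {v : Vertex} (hv : v ∈ verts D) :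
    height D (supTiling D {T, T'}) v = max (height D T v) (height D T' v) := by
  have h := (hD.supTiling_spec (S := {T, T'}) ⟨T, by simp⟩ (by rintro _ (rfl | rfl) <;> assumption)).2
    v hv
  rw [Set.image_pair] at h
  exact h.unique isGreatest_pair

theorem isTiling_infTiling_pair (hD : AdmitsHeights D) (hT : IsTiling D T) (hT' : IsTiling D T') :
    IsTiling D (infTiling D {T, T'}) :=
  hD.isTiling_infTiling ⟨T, by simp⟩ (by rintro _ (rfl | rfl) <;> assumption)

theorem isTiling_supTiling_pair (hD : AdmitsHeights D) (hT : IsTiling D T) (hT' : IsTiling D T') :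
    IsTiling D (supTiling D {T, T'}) :=
  hD.isTiling_supTiling ⟨T, by simp⟩ (by rintro _ (rfl | rfl) <;> assumption)

/-- The tilings of `D` form a distributive lattice for the order of heights. -/
theorem exists_distribLattice (hD : AdmitsHeights D) : ∃ _inst : DistribLattice (TilingOf D),
    ∀ A B : TilingOf D, A ≤ B ↔ TilingLE D A.1 B.1 := by
  -- Heights embed the tilings into integer functions on the vertices and turn suprema and infima
  -- into pointwise ones, so distributivity is pulled back from ℤ.
  let toFun : TilingOf D → (verts D → ℤ) := fun A v => height D A.1 v
  have hinj : Function.Injective toFun := fun A B h =>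
    Subtype.ext (hD.eq_of_height_eq A.2 B.2 fun v hv => congrFun h ⟨v, hv⟩)
  let _ : Max (TilingOf D) := ⟨fun A B => ⟨_, hD.isTiling_supTiling_pair A.2 B.2⟩⟩
  let _ : Min (TilingOf D) := ⟨fun A B => ⟨_, hD.isTiling_infTiling_pair A.2 B.2⟩⟩
  let _ : LE (TilingOf D) := ⟨fun A B => TilingLE D A.1 B.1⟩
  let _ : LT (TilingOf D) := ⟨fun A B => toFun A < toFun B⟩
  exact ⟨hinj.distribLattice toFun
    (by intro A B; exact ⟨fun h v hv => h ⟨v, hv⟩, fun h v => h v v.2⟩) Iff.rfl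
    (fun A B => funext fun v => hD.height_supTiling_pair A.2 B.2 v.2)
    (fun A B => funext fun v => hD.height_infTiling_pair A.2 B.2 v.2), fun A B => Iff.rfl⟩

end AdmitsHeights

/-! ### Simply connected domains have height functions -/

/-- Indefinite sum of a function on `ℤ`. -/
def zsum (f : ℤ → ℤ) : ℤ → ℤ
  | Int.ofNat n => ∑ i ∈ Finset.range n, f i
  | Int.negSucc n => -∑ i ∈ Finset.range (n + 1), f (-1 - i)

theorem zsum_add_one (f : ℤ → ℤ) (n : ℤ) : zsum f (n + 1) = zsum f n + f n := by
  rcases n with n | n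
  · exact Finset.sum_range_succ (fun i : ℕ => f i) n
  · rcases n with - | n
    · simp [zsum]
    · have : (Int.negSucc (n + 1) + 1) = Int.negSucc n := rfl
      rw [this]
      simp only [zsum]
      rw [Finset.sum_range_succ _ (n + 1)]
      have : (Int.negSucc (n + 1)) = -1 - ((n + 1 : ℕ) : ℤ) := by
        rw [Int.negSucc_eq]; push_cast; ring
      rw [this]
      ring

/-- The integral of `ω` along the path from the origin to `v` that is first parallel to `a`, then
parallel to `b`. -/
def primitive (ω : Edge → ℤ) (v : Vertex) : ℤ :=
  zsum (fun x => ω ⟨(x, 0), 0⟩) v.1 + zsum (fun y => ω ⟨(v.1, y), 1⟩) v.2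

/-- The circulation of `ω` around a triangle. -/
def circulation (ω : Edge → ℤ) (t : Tri) : ℤ := ∑ e ∈ t.edges, ω e

theorem circulation_false (ω : Edge → ℤ) (x y : ℤ) : circulation ω ⟨(x, y), false⟩ =
    ω ⟨(x, y), 0⟩ + ω ⟨(x + 1, y), 1⟩ + ω ⟨(x + 1, y + 1), 2⟩ := by
  simp [circulation, Tri.edges, step, add_assoc]

theorem circulation_true (ω : Edge → ℤ) (x y : ℤ) : circulation ω ⟨(x, y), true⟩ =
    ω ⟨(x, y), 1⟩ + ω ⟨(x, y + 1), 0⟩ + ω ⟨(x + 1, y + 1), 2⟩ := by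
  simp [circulation, Tri.edges, step, add_assoc]

/-- The value of a 2-chain on the exterior derivative of `ω`. -/
def chainSum (w : Tri →₀ ℤ) (ω : Edge → ℤ) : ℤ := w.sum fun t a => a * circulation ω t

theorem chainSum_zero (ω : Edge → ℤ) : chainSum 0 ω = 0 := by simp [chainSum]

theorem chainSum_add (w w' : Tri →₀ ℤ) (ω : Edge → ℤ) :
    chainSum (w + w') ω = chainSum w ω + chainSum w' ω :=
  Finsupp.sum_add_index' (by simp) (by intros; ring)

theorem chainSum_neg (w : Tri →₀ ℤ) (ω : Edge → ℤ) : chainSum (-w) ω = -chainSum w ω := by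
  have := chainSum_add w (-w) ω
  rw [add_neg_cancel, chainSum_zero] at this
  linarith

theorem chainSum_single (t : Tri) (ω : Edge → ℤ) :
    chainSum (Finsupp.single t 1) ω = circulation ω t := by
  simp [chainSum, Finsupp.sum_single_index]

theorem chainSum_eq_zero {w : Tri →₀ ℤ} {ω : Edge → ℤ}
    (h : ∀ t, w t = 0 ∨ circulation ω t = 0) : chainSum w ω = 0 :=
  Finset.sum_eq_zero fun t _ => by rcases h t with h | h <;> simp [h]

/-- Discrete Poincaré lemma: up to circulations, every `ω` is the variation of its primitive. -/
theorem exists_chain_edge (e : Edge) : ∃ w : Tri →₀ ℤ, ∀ ω : Edge → ℤ,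
    ω e = primitive ω e.tgt - primitive ω e.src + chainSum w ω := by
  have h0 : ∀ x y : ℤ, ∃ w : Tri →₀ ℤ, ∀ ω : Edge → ℤ,
      ω ⟨(x, y), 0⟩ = primitive ω (x + 1, y) - primitive ω (x, y) + chainSum w ω := by
    intro x y
    -- Shifting an edge of direction `a` by `b` sweeps a parallelogram made of one triangle of each
    -- kind; the contributions of their common diagonal cancel. Induction then starts on the axis `y
    -- = 0`, where `primitive` integrates `ω` itself.
    have up : ∀ (y : ℤ) (ω : Edge → ℤ), ω ⟨(x, y + 1), 0⟩ - (primitive ω (x + 1, y + 1)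
        - primitive ω (x, y + 1)) = ω ⟨(x, y), 0⟩ - (primitive ω (x + 1, y) - primitive ω (x, y))
        + circulation ω ⟨(x, y), true⟩ - circulation ω ⟨(x, y), false⟩ := by
      intro y ω
      simp only [primitive, zsum_add_one, circulation_true, circulation_false]
      ring
    induction y using Int.induction_on with
    | zero =>
      refine ⟨0, fun ω => ?_⟩
      have z : ∀ f, zsum f 0 = 0 := fun f => by
        show ∑ i ∈ Finset.range 0, _ = _
        simp
      simp [primitive, zsum_add_one, z, chainSum_zero]
    | succ y ih =>
      obtain ⟨w, hw⟩ := ih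
      refine ⟨w + (Finsupp.single ⟨(x, y), true⟩ 1 + -Finsupp.single ⟨(x, y), false⟩ 1), fun ω => ?_⟩
      rw [chainSum_add, chainSum_add, chainSum_neg, chainSum_single, chainSum_single]
      linarith [up y ω, hw ω]
    | pred y ih =>
      obtain ⟨w, hw⟩ := ih
      refine ⟨w + (Finsupp.single ⟨(x, -(y : ℤ) - 1), false⟩ 1 +
        -Finsupp.single ⟨(x, -(y : ℤ) - 1), true⟩ 1), fun ω => ?_⟩
      rw [chainSum_add, chainSum_add, chainSum_neg, chainSum_single, chainSum_single]
      have := up (-(y : ℤ) - 1) ω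
      rw [sub_add_cancel] at this
      linarith [hw ω]
  rcases e with ⟨⟨x, y⟩, d⟩
  fin_cases d
  · simpa [Edge.tgt, step] using h0 x y
  · refine ⟨0, fun ω => ?_⟩
    simp [Edge.tgt, step, primitive, zsum_add_one, chainSum_zero]
  -- An edge of direction `c` closes a triangle whose other two edges have directions `a` and `b`,
  -- already treated.
  · obtain ⟨w, hw⟩ := h0 (x - 1) (y - 1)
    refine ⟨-w + Finsupp.single ⟨(x - 1, y - 1), false⟩ 1, fun ω => ?_⟩
    have h1 := hw ω
    have h2 := circulation_false ω (x - 1) (y - 1)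
    have h3 : primitive ω (x, y) = primitive ω (x, y - 1) + ω ⟨(x, y - 1), 1⟩ := by
      have := zsum_add_one (fun y => ω ⟨(x, y), 1⟩) (y - 1)
      rw [sub_add_cancel] at this
      simp only [primitive, this]
      ring
    simp only [sub_add_cancel] at h1 h2
    rw [chainSum_add, chainSum_neg, chainSum_single]
    simp only [Edge.tgt, step]
    simp
    rw [← sub_eq_add_neg, ← sub_eq_add_neg]
    linarith

theorem exists_eq_primitive_sub {ω : Edge → ℤ} (h : ∀ t, circulation ω t = 0) (e : Edge) :
    ω e = primitive ω e.tgt - primitive ω e.src := by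
  obtain ⟨w, hw⟩ := exists_chain_edge e
  rw [hw ω, chainSum_eq_zero fun t => Or.inr (h t), add_zero]

/-- The chain `w` depends on the path only, not on `ω`. The same `w` can thus be tested against edge
indicators, to learn where it vanishes, and then against the slope of a tiling. For a closed path it
plays, up to orientation, the role of the winding numbers. -/
theorem ValidPath.exists_chain {D : Domain} {T : Finset Edge} {u v : Vertex} {n : ℤ}
    (p : ValidPath D T u v n) : ∃ w : Tri →₀ ℤ, ∀ (ω : Edge → ℤ) (k : ℤ),
      (∀ e, ValidEdge D T e → ω e = k) →
      k * n = primitive ω v - primitive ω u + chainSum w ω := by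
  induction p with
  | nil => exact ⟨0, fun ω k _ => by simp [chainSum_zero]⟩
  | fwd e _ he ih =>
    obtain ⟨w, hw⟩ := ih
    obtain ⟨w', hw'⟩ := exists_chain_edge e
    refine ⟨w + w', fun ω k hk => ?_⟩
    rw [chainSum_add]
    linarith [hw ω k hk, hw' ω, hk e he]
  | bwd e _ he ih =>
    obtain ⟨w, hw⟩ := ih
    obtain ⟨w', hw'⟩ := exists_chain_edge e
    refine ⟨w + -w', fun ω k hk => ?_⟩
    rw [chainSum_add, chainSum_neg]
    linarith [hw ω k hk, hw' ω, hk e he]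

/-- Circulations follow every edge positively, so the two triangles on `e` contribute with the same
sign although they turn in opposite senses. This reads off the boundary coefficient of `w` at `e`.
-/
theorem chainSum_indicator (w : Tri →₀ ℤ) {e : Edge} {t t' : Tri} (hne : t ≠ t')
    (h : lozenge e = {t, t'}) : chainSum w (fun f => if f = e then 1 else 0) = w t + w t' := by
  have hc : ∀ s, circulation (fun f => if f = e then 1 else 0) s
      = if s = t ∨ s = t' then 1 else 0 := by
    intro s
    simp only [circulation, Finset.sum_ite_eq', ← mem_lozenge, h, Finset.mem_insert,
      Finset.mem_singleton]
  unfold chainSum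
  rw [Finsupp.sum_of_support_subset w (s := w.support ∪ {t, t'}) Finset.subset_union_left _
    (by simp)]
  simp only [hc, mul_ite, mul_one, mul_zero]
  rw [← Finset.sum_filter, ← Finset.sum_pair hne]
  refine Finset.sum_congr ?_ fun _ _ => rfl
  ext s
  simp only [Finset.mem_filter, Finset.mem_union, Finset.mem_insert, Finset.mem_singleton]
  tauto

theorem Tri.infinite : Infinite Tri :=
  Infinite.of_injective (fun n : ℕ => (⟨((n : ℤ), 0), false⟩ : Tri)) fun m n h => by
    simpa using h

/-- The chain bounded by the path vanishes far away, and vanishing propagates across edges that the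
path cannot use, hence over the whole connected complement. Inside `D` the slope of `T` has zero
circulation, so the evaluation of the path is 0. -/
theorem closed_path_of_connected_complement {D : Domain} (hD : HasConnectedComplement D)
    {T : Finset Edge} (hT : IsTiling D T) {v : Vertex} {n : ℤ} (p : ValidPath D T v v n) :
    n = 0 := by
  obtain ⟨w, hw⟩ := p.exists_chain
  have hadj : ∀ s s', s ∉ D → s' ∉ D → (s.edges ∩ s'.edges).Nonempty → w s = 0 → w s' = 0 := by
    rintro s s' hs hs' ⟨e, he⟩ h0
    rw [Finset.mem_inter] at he
    by_cases hne : s = s'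
    · rwa [← hne]
    have hl : lozenge e = {s, s'} := by
      refine (Finset.eq_of_subset_of_card_le ?_ ?_).symm
      · simp [Finset.insert_subset_iff, mem_lozenge, he.1, he.2]
      · rw [Finset.card_pair hne, card_lozenge]
    -- The edge `e` is not in `D`, so its indicator is 0 on all valid edges and the boundary
    -- coefficient of `w` at `e` is 0.
    have := hw (fun f => if f = e then 1 else 0) 0 ?_
    · rw [chainSum_indicator w hne hl] at this
      linarith
    · intro f hf
      refine if_neg ?_
      rintro rfl
      obtain ⟨t, ht, hft⟩ := mem_edges.1 hf.1
      rw [← mem_lozenge, hl] at hft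
      simp only [Finset.mem_insert, Finset.mem_singleton] at hft
      rcases hft with rfl | rfl <;> contradiction
  have hout : ∀ t, t ∉ D → w t = 0 := by
    intro t ht
    have := Tri.infinite
    -- The propagation starts from a triangle outside both `D` and the finite support of `w`.
    obtain ⟨s, hs⟩ := Infinite.exists_notMem_finset (D ∪ w.support)
    simp only [Finset.mem_union, not_or, Finsupp.mem_support_iff, not_not] at hs
    have key : t ∉ D ∧ w t = 0 := by
      have := hD s hs.1 t ht
      clear ht
      induction this with
      | refl => exact hs
      | tail _ h ih => exact ⟨h.1, hadj _ _ ih.1 h.1 h.2 ih.2⟩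
    exact key.2
  have := hw (slope T) 1 fun e he => by simp [slope, he.2]
  rw [chainSum_eq_zero] at this
  · linarith
  · intro t
    by_cases ht : t ∈ D
    · exact Or.inr (hT.sum_slope ht)
    · exact Or.inl (hout t ht)

/-- Every simply connected domain admits heights. -/
theorem IsPolygon.admitsHeights {D : Domain} (hD : IsPolygon D) : AdmitsHeights D := by
  have hclosed : ∀ T, IsTiling D T → ∀ v n, ValidPath D T v v n → n = 0 :=
    fun T hT v n p => closed_path_of_connected_complement hD.2 hT p
  refine ⟨hD.1, hclosed, ?_⟩
  intro T T' hT hT' u hu v hv n m p q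
  -- The difference of the two slopes is closed on the whole plane and vanishes on the edges of all
  -- outer triangles. Its primitive is therefore constant on the connected complement, which touches
  -- every contour vertex.
  set η : Edge → ℤ := fun e => slope T e - slope T' e with hη
  have hout : ∀ t, t ∉ D → ∀ e ∈ t.edges, η e = 0 := by
    intro t ht e he
    have h1 : e ∉ T := fun h => ht (hT.1 e h (mem_lozenge.2 he))
    have h2 : e ∉ T' := fun h => ht (hT'.1 e h (mem_lozenge.2 he))
    simp [hη, slope, h1, h2]
  have hcirc : ∀ t, circulation η t = 0 := by
    intro t
    by_cases ht : t ∈ D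
    · simp only [circulation, hη, Finset.sum_sub_distrib, hT.sum_slope ht, hT'.sum_slope ht, sub_zero]
    · exact Finset.sum_eq_zero (hout t ht)
  have hprim := exists_eq_primitive_sub hcirc
  have htri : ∀ t, t ∉ D → ∀ x ∈ t.verts, ∀ y ∈ t.verts, primitive η x = primitive η y := by
    intro t ht x hx y hy
    obtain ⟨e, he, rfl⟩ := Finset.mem_image.1 hx
    obtain ⟨f, g, heq, -, -, -, h1, h2, h3⟩ := Tri.exists_edges_eq_of_mem he
    have a1 := hprim e
    have a2 := hprim f
    have a3 := hprim g
    rw [hout t ht _ he, h1] at a1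
    rw [hout t ht _ (by simp [heq]), h2] at a2
    rw [hout t ht _ (by simp [heq]), h3] at a3
    obtain ⟨e', he', rfl⟩ := Finset.mem_image.1 hy
    rw [heq] at he'
    simp only [Finset.mem_insert, Finset.mem_singleton] at he'
    rcases he' with rfl | rfl | rfl <;> linarith
  have hcomp : ∀ t, t ∉ D → ∀ t', t' ∉ D → ∀ x ∈ t.verts, ∀ y ∈ t'.verts,
      primitive η x = primitive η y := by
    intro t ht t' ht' x hx
    have key : t' ∉ D ∧ ∀ y ∈ t'.verts, primitive η x = primitive η y := by
      have := hD.2 t ht t' ht'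
      clear ht'
      induction this with
      | refl => exact ⟨ht, fun y hy => htri _ ht x hx y hy⟩
      | tail _ h ih =>
        obtain ⟨h, e, he⟩ := h
        rw [Finset.mem_inter] at he
        exact ⟨h, fun y hy => (ih.2 _ (Tri.src_mem_verts he.1)).trans
          (htri _ h _ (Tri.src_mem_verts he.2) y hy)⟩
    exact key.2
  have hvert : ∀ x ∈ contourVerts D, ∃ t, t ∉ D ∧ x ∈ t.verts := by
    intro x hx
    obtain ⟨e, he, h⟩ := mem_contourVerts.1 hx
    obtain ⟨t, t', hl, -, ht'⟩ := mem_contour.1 he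
    have het : e ∈ t'.edges := mem_lozenge.1 (by simp [hl])
    refine ⟨t', ht', ?_⟩
    rcases h with rfl | rfl
    exacts [Tri.src_mem_verts het, Tri.tgt_mem_verts het]
  obtain ⟨t, ht, hut⟩ := hvert u hu
  obtain ⟨t', ht', hvt⟩ := hvert v hv
  have e1 := hcomp t ht t' ht' u hut v hvt
  have hh := hT.isHeightOf_height hD.1 (hclosed T hT)
  have hh' := hT'.isHeightOf_height hD.1 (hclosed T' hT')
  have e2 := p.eq_add hh
  have e3 := q.eq_add hh'
  -- On `D` the difference of the heights has the same variation as the primitive of `η`, which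
  -- takes equal values at `u` and `v` by `e1`.
  have e4 := ValidPath.eq_of_forall_edge
    (h := fun x => height D T x - height D T' x - primitive η x) (fun e he => by
      have := hprim e
      simp only [hη] at this
      simp only [hh e he, hh' e he]
      linarith) p
  linarith

/-! ### Contours are unions of cycles -/

theorem Edge.eq_of_src_tgt {e f : Edge} (h : s(e.src, e.tgt) = s(f.src, f.tgt)) : e = f := by
  rcases e with ⟨⟨x, y⟩, d⟩
  rcases f with ⟨⟨p, q⟩, k⟩
  fin_cases d <;> fin_cases k <;> simp [Edge.tgt, step] at h ⊢ <;> omega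

theorem Edge.src_ne_tgt (e : Edge) : e.src ≠ e.tgt := by
  rcases e with ⟨⟨x, y⟩, d⟩
  fin_cases d <;> simp [Edge.tgt, step]

/-- The graph formed by a set of edges. -/
def edgeGraph (S : Set Edge) : SimpleGraph Vertex :=
  SimpleGraph.fromRel fun u v => ∃ e, e ∈ S ∧ e.src = u ∧ e.tgt = v

theorem edgeGraph_adj {S : Set Edge} {e : Edge} : (edgeGraph S).Adj e.src e.tgt ↔ e ∈ S := by
  simp only [edgeGraph, SimpleGraph.fromRel_adj]
  constructor
  · rintro ⟨-, ⟨f, hf, h1, h2⟩ | ⟨f, hf, h1, h2⟩⟩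
    · rwa [← Edge.eq_of_src_tgt (e := f) (f := e) (by rw [h1, h2])]
    · rwa [← Edge.eq_of_src_tgt (e := f) (f := e) (by rw [h1, h2, Sym2.eq_swap])]
  · intro h
    exact ⟨e.src_ne_tgt, Or.inl ⟨e, h, rfl, rfl⟩⟩

theorem validGraph_eq (D : Domain) (T : Finset Edge) :
    validGraph D T = edgeGraph {e | ValidEdge D T e} := rfl

theorem edgeGraph_mono {S S' : Set Edge} (h : S ⊆ S') : edgeGraph S ≤ edgeGraph S' := by
  intro u v
  simp only [edgeGraph, SimpleGraph.fromRel_adj]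
  rintro ⟨h0, ⟨f, hf, h1⟩ | ⟨f, hf, h1⟩⟩
  exacts [⟨h0, Or.inl ⟨f, h hf, h1⟩⟩, ⟨h0, Or.inr ⟨f, h hf, h1⟩⟩]

/-- Every vertex has an even number of contour edges. -/
theorem sum_contour_sub (F : Domain) (f : Vertex → ZMod 2) :
    ∑ e ∈ contour F, (f e.tgt - f e.src) = 0 := by
  have h1 : ∑ t ∈ F, ∑ e ∈ t.edges, (f e.tgt - f e.src) = 0 :=
    Finset.sum_eq_zero fun t _ => t.sum_edges_sub f
  -- After regrouping by edges, an edge counts once for each triangle of `F` that contains it; off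
  -- the contour it counts twice and disappears mod 2.
  rw [Finset.sum_comm' (t' := edges F) (s' := fun e => F.filter fun t => e ∈ t.edges)
    (by intro t e; simp only [Finset.mem_filter, mem_edges]; exact
          ⟨fun h => ⟨h, t, h⟩, fun h => h.1⟩)] at h1
  rw [← h1, contour, Finset.sum_filter]
  refine Finset.sum_congr rfl fun e he => ?_
  rw [Finset.sum_const]
  split_ifs with h
  · rw [h, one_smul]
  · have h2 := lozenge_subset_of_notMem_contour he (fun h' => h (Finset.mem_filter.1 h').2)
    rw [filter_mem_edges, Finset.inter_eq_right.2 h2, card_lozenge, two_nsmul, CharTwo.add_self_eq_zero]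

/-- An edge on no cycle is a bridge. The indicator of one side of the bridge varies along this
contour edge only, which contradicts the parity in `sum_contour_sub`. -/
theorem exists_cycle_of_mem_contour {F : Domain} {e : Edge} (he : e ∈ contour F) :
    ∃ (v : Vertex) (p : (edgeGraph (contour F : Set Edge)).Walk v v),
      p.IsCycle ∧ s(e.src, e.tgt) ∈ p.edges := by
  classical
  rw [← SimpleGraph.adj_and_reachable_delete_edges_iff_exists_cycle]
  refine ⟨edgeGraph_adj.2 he, ?_⟩
  set G := edgeGraph (contour F : Set Edge) with hG
  by_contra hr
  have key := sum_contour_sub F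
    (fun v => if (G.deleteEdges {s(e.src, e.tgt)}).Reachable e.src v then 1 else 0)
  rw [Finset.sum_eq_single_of_mem e he] at key
  · simp [hr] at key
  · intro f hf hne
    have hadj : (G.deleteEdges {s(e.src, e.tgt)}).Adj f.src f.tgt := by
      rw [SimpleGraph.deleteEdges_adj]
      exact ⟨edgeGraph_adj.2 hf, fun h => hne (Edge.eq_of_src_tgt h)⟩
    have : (G.deleteEdges {s(e.src, e.tgt)}).Reachable e.src f.tgt ↔
        (G.deleteEdges {s(e.src, e.tgt)}).Reachable e.src f.src :=
      ⟨fun h => h.trans hadj.symm.reachable, fun h => h.trans hadj.reachable⟩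
    simp [this]

/-! ### Solid edges and fracture zones -/

/-- An edge with solid ends that is valid for every tiling. -/
def IsSolidEdge (D : Domain) (e : Edge) : Prop :=
  e ∈ edges D ∧ IsSolid D e.src ∧ IsSolid D e.tgt ∧ e ∉ minTiling D

namespace AdmitsHeights

variable {D F F' : Domain} {T T' : Finset Edge}

theorem height_eq_of_isSolid (hD : AdmitsHeights D) {v : Vertex} (hv : IsSolid D v)
    (hT : IsTiling D T) (hT' : IsTiling D T') : height D T v = height D T' v := by
  have h1 := hD.minTiling_le hT v hv.1
  have h2 := hD.le_maxTiling hT v hv.1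
  have h3 := hD.minTiling_le hT' v hv.1
  have h4 := hD.le_maxTiling hT' v hv.1
  have := hv.2
  omega

theorem isSolid_of_forall (hD : AdmitsHeights D) (hT : IsTiling D T) {v : Vertex}
    (hv : v ∈ verts D) (h : ∀ T', IsTiling D T' → height D T' v = height D T v) : IsSolid D v :=
  ⟨hv, by rw [h _ (hD.isTiling_maxTiling ⟨T, hT⟩), h _ (hD.isTiling_minTiling ⟨T, hT⟩), sub_self]⟩

theorem isSolid_of_mem_contourVerts (hD : AdmitsHeights D) (hT : IsTiling D T) {v : Vertex}
    (hv : v ∈ contourVerts D) : IsSolid D v :=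
  hD.isSolid_of_forall hT (contourVerts_subset_verts D hv) fun _ hT' => hD.height_contour hT' hT hv

theorem mem_iff_of_isSolid (hD : AdmitsHeights D) {e : Edge} (he : e ∈ edges D)
    (h1 : IsSolid D e.src) (h2 : IsSolid D e.tgt) (hT : IsTiling D T) (hT' : IsTiling D T') :
    e ∈ T ↔ e ∈ T' := by
  rw [hD.mem_iff_height hT he, hD.mem_iff_height hT' he, hD.height_eq_of_isSolid h1 hT hT',
    hD.height_eq_of_isSolid h2 hT hT']

theorem notMem_of_isSolidEdge (hD : AdmitsHeights D) (hT : IsTiling D T) {e : Edge}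
    (he : IsSolidEdge D e) : e ∉ T := fun h =>
  he.2.2.2 ((hD.mem_iff_of_isSolid he.1 he.2.1 he.2.2.1 hT (hD.isTiling_minTiling ⟨T, hT⟩)).1 h)

theorem isSolidEdge_of_mem_contour (hD : AdmitsHeights D) (hT : IsTiling D T) {e : Edge}
    (he : e ∈ contour D) : IsSolidEdge D e :=
  ⟨contour_subset_edges D he,
    hD.isSolid_of_mem_contourVerts hT (mem_contourVerts.2 ⟨e, he, Or.inl rfl⟩),
    hD.isSolid_of_mem_contourVerts hT (mem_contourVerts.2 ⟨e, he, Or.inr rfl⟩),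
    (hD.isTiling_minTiling ⟨T, hT⟩).notMem_of_contour he⟩

/-- A part of `D` is delimited by fracture lines iff its contour is made of solid edges. -/
theorem isDelimited_iff (hD : AdmitsHeights D) (hT : IsTiling D T) :
    IsDelimitedByFractureLines D F ↔
      F.Nonempty ∧ F ⊆ D ∧ ∀ e ∈ contour F, IsSolidEdge D e := by
  classical
  refine and_congr_right fun hne => and_congr_right fun hFD => ⟨fun h e he => ?_, fun h e he => ?_⟩
  · obtain ⟨L, ⟨T', hT', v, p, hp, hs, hL⟩, heL, -⟩ := h e he
    have hep := (hL e).1 heL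
    have hval : ValidEdge D T' e := by
      have := p.adj_of_mem_edges hep
      rwa [validGraph_eq, edgeGraph_adj] at this
    have h1 := hs _ (p.fst_mem_support_of_mem_edges hep)
    have h2 := hs _ (p.snd_mem_support_of_mem_edges hep)
    refine ⟨hval.1, h1, h2, fun h => hval.2 ?_⟩
    exact (hD.mem_iff_of_isSolid hval.1 h1 h2 (hD.isTiling_minTiling ⟨T, hT⟩) hT').1 h
  · obtain ⟨v, p, hp, hep⟩ := exists_cycle_of_mem_contour he
    -- Solid edges are valid for `Min(D)`, so the cycle found in the contour of `F` is a fracture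
    -- line with `Min(D)` as its witness.
    have hle : edgeGraph (contour F : Set Edge) ≤ validGraph D (minTiling D) := by
      rw [validGraph_eq]
      exact edgeGraph_mono fun f hf => ⟨(h f hf).1, (h f hf).2.2.2⟩
    have hmem : ∀ f : Edge, s(f.src, f.tgt) ∈ p.edges → f ∈ contour F := fun f hf =>
      edgeGraph_adj.1 (p.adj_of_mem_edges hf)
    refine ⟨(contour F).filter fun f => s(f.src, f.tgt) ∈ p.edges,
      ⟨minTiling D, hD.isTiling_minTiling ⟨T, hT⟩, v, p.mapLe hle, hp.mapLe hle, ?_, ?_⟩,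
      Finset.mem_filter.2 ⟨he, hep⟩, Finset.filter_subset _ _⟩
    · intro u hu
      rw [SimpleGraph.Walk.support_mapLe_eq_support] at hu
      obtain ⟨x, hx, hux⟩ := (SimpleGraph.Walk.mem_support_iff_exists_mem_edges_of_not_nil
        hp.not_nil).1 hu
      have hx' := SimpleGraph.Walk.edges_subset_edgeSet p hx
      induction x using Sym2.ind with
      | _ a b =>
        rw [SimpleGraph.mem_edgeSet] at hx'
        simp only [edgeGraph, SimpleGraph.fromRel_adj] at hx'
        rw [Sym2.mem_iff] at hux
        obtain ⟨-, ⟨f, hf, rfl, rfl⟩ | ⟨f, hf, rfl, rfl⟩⟩ := hx' <;>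
        · have := h f hf
          rcases hux with rfl | rfl
          exacts [by first | exact this.2.1 | exact this.2.2.1,
            by first | exact this.2.1 | exact this.2.2.1]
    · intro f
      rw [Finset.mem_filter, SimpleGraph.Walk.edges_mapLe_eq_edges]
      exact ⟨fun h => h.2, fun h => ⟨hmem f h, h⟩⟩

/-! ### Fracture zones as components of the domain cut along solid edges -/

/-- Two triangles of `D` are linked if they share an edge that is not solid. -/
def Linked (D : Domain) (t t' : Tri) : Prop :=
  t' ∈ D ∧ ∃ e, e ∈ t.edges ∧ e ∈ t'.edges ∧ ¬ IsSolidEdge D e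

open Classical in
/-- The connected component of `t` in `D` cut along the solid edges. -/
noncomputable def zoneOf (D : Domain) (t : Tri) : Domain :=
  D.filter (Relation.ReflTransGen (Linked D) t)

theorem mem_zoneOf {t t' : Tri} :
    t' ∈ zoneOf D t ↔ t' ∈ D ∧ Relation.ReflTransGen (Linked D) t t' := by
  simp [zoneOf]

theorem linked_mem (hD : AdmitsHeights D) (hT : IsTiling D T)
    (hF : IsDelimitedByFractureLines D F) {t t' : Tri} (ht : t ∈ F) (h : Linked D t t') :
    t' ∈ F := by
  obtain ⟨ht', e, h1, h2, h3⟩ := h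
  rw [hD.isDelimited_iff hT] at hF
  by_contra hn
  exact hn (lozenge_subset_of_notMem_contour (mem_edges_of_mem ht h1) (fun h => h3 (hF.2.2 e h))
    (mem_lozenge.2 h2))

theorem zoneOf_subset (hD : AdmitsHeights D) (hT : IsTiling D T)
    (hF : IsDelimitedByFractureLines D F) {t : Tri} (ht : t ∈ F) : zoneOf D t ⊆ F := by
  intro t' ht'
  have := (mem_zoneOf.1 ht').2
  clear ht'
  induction this with
  | refl => exact ht
  | tail _ h ih => exact hD.linked_mem hT hF ih h

/-- A contour edge of the component is solid, since otherwise it would link a further triangle or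
lie on the contour of `D`, where edges are solid anyway. For minimality, a delimited part is closed
under links; links inside `D` are symmetric, so a delimited part that meets the component contains
`t` and then the whole component. -/
theorem isFractureZone_zoneOf (hD : AdmitsHeights D) (hT : IsTiling D T) {t : Tri} (ht : t ∈ D) :
    IsFractureZone D (zoneOf D t) := by
  have htz : t ∈ zoneOf D t := mem_zoneOf.2 ⟨ht, Relation.ReflTransGen.refl⟩
  refine ⟨(hD.isDelimited_iff hT).2 ⟨⟨t, htz⟩, fun s hs => (mem_zoneOf.1 hs).1,
    fun e he => ?_⟩,
    fun F' hF' hsub => ?_⟩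
  · obtain ⟨s, s', hl, hs, hs'⟩ := mem_contour.1 he
    have h1 : e ∈ s.edges := mem_lozenge.1 (by simp [hl])
    have h2 : e ∈ s'.edges := mem_lozenge.1 (by simp [hl])
    rw [mem_zoneOf] at hs hs'
    by_contra hn
    by_cases hsD : s' ∈ D
    · exact hs' ⟨hsD, hs.2.tail ⟨hsD, e, h1, h2, hn⟩⟩
    · exact hn (hD.isSolidEdge_of_mem_contour hT (mem_contour.2 ⟨s, s', hl, hs.1, hsD⟩))
  · obtain ⟨s, hs⟩ := hF'.1
    refine hsub.antisymm ?_
    have hts := (mem_zoneOf.1 (hsub hs)).2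
    have : t ∈ F' := by
      have key : ∀ s, Relation.ReflTransGen (Linked D) t s → s ∈ F' → t ∈ F' := by
        intro s hr
        induction hr with
        | refl => exact id
        | @tail b c hb h ih =>
          intro hc
          refine ih (hD.linked_mem hT hF' hc ⟨?_, ?_⟩)
          · cases hb with
            | refl => exact ht
            | tail _ h => exact h.1
          · obtain ⟨-, e, h1, h2, h3⟩ := h
            exact ⟨e, h2, h1, h3⟩
      exact key s hts hs
    exact hD.zoneOf_subset hT hF' this

theorem mem_fractureZones : F ∈ fractureZones D ↔ IsFractureZone D F := by
  simp only [fractureZones, Finset.mem_filter, Finset.mem_powerset, and_iff_right_iff_imp]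
  exact fun h => h.1.2.1

theorem eq_zoneOf (hD : AdmitsHeights D) (hT : IsTiling D T) (hF : F ∈ fractureZones D) {t : Tri}
    (ht : t ∈ F) : F = zoneOf D t := by
  have hF' := mem_fractureZones.1 hF
  exact (hF'.2 _ (hD.isFractureZone_zoneOf hT (hF'.1.2.1 ht)).1 (hD.zoneOf_subset hT hF'.1 ht)).symm

theorem zone_subset (hF : F ∈ fractureZones D) : F ⊆ D := (mem_fractureZones.1 hF).1.2.1

theorem zone_nonempty (hF : F ∈ fractureZones D) : F.Nonempty := (mem_fractureZones.1 hF).1.1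

theorem exists_zone_mem (hD : AdmitsHeights D) (hT : IsTiling D T) {t : Tri} (ht : t ∈ D) :
    ∃ F ∈ fractureZones D, t ∈ F :=
  ⟨zoneOf D t, mem_fractureZones.2 (hD.isFractureZone_zoneOf hT ht),
    mem_zoneOf.2 ⟨ht, Relation.ReflTransGen.refl⟩⟩

theorem zone_unique (hD : AdmitsHeights D) (hT : IsTiling D T) (hF : F ∈ fractureZones D)
    (hF' : F' ∈ fractureZones D) {t : Tri} (ht : t ∈ F) (ht' : t ∈ F') : F = F' :=
  (hD.eq_zoneOf hT hF ht).trans (hD.eq_zoneOf hT hF' ht').symm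

theorem isSolidEdge_of_mem_contour_zone (hD : AdmitsHeights D) (hT : IsTiling D T)
    (hF : F ∈ fractureZones D) {e : Edge} (he : e ∈ contour F) : IsSolidEdge D e :=
  ((hD.isDelimited_iff hT).1 (mem_fractureZones.1 hF).1).2.2 e he

theorem edges_zone_subset (hF : F ∈ fractureZones D) : edges F ⊆ edges D :=
  Finset.biUnion_subset_biUnion_of_subset_left _ (zone_subset hF)

theorem verts_zone_subset (hF : F ∈ fractureZones D) : verts F ⊆ verts D :=
  Finset.biUnion_subset_biUnion_of_subset_left _ (zone_subset hF)

theorem isConnectedDomain_zone (hD : AdmitsHeights D) (hT : IsTiling D T)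
    (hF : F ∈ fractureZones D) : IsConnectedDomain F := by
  intro t ht t' ht'
  rw [hD.eq_zoneOf hT hF ht, mem_zoneOf] at ht'
  have := ht'.2
  have key : t' ∈ F ∧ Relation.ReflTransGen
      (fun s s' : Tri => s' ∈ F ∧ (s.verts ∩ s'.verts).Nonempty) t t' := by
    clear ht'
    induction this with
    | refl => exact ⟨ht, Relation.ReflTransGen.refl⟩
    | tail _ h ih =>
      have hF' := hD.linked_mem hT (mem_fractureZones.1 hF).1 ih.1 h
      obtain ⟨-, e, h1, h2, -⟩ := h
      exact ⟨hF', ih.2.tail ⟨hF', e.src, Finset.mem_inter.2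
        ⟨Tri.src_mem_verts h1, Tri.src_mem_verts h2⟩⟩⟩
  exact key.2

/-! ### Restriction of tilings to the zones, and gluing -/

/-- A lozenge leaving the zone would have its middle segment on the contour of the zone, but solid
edges are valid for every tiling. -/
theorem lozenge_subset_zone (hD : AdmitsHeights D) (hT : IsTiling D T)
    (hF : F ∈ fractureZones D) {e : Edge} (he : e ∈ T) (heF : e ∈ edges F) : lozenge e ⊆ F :=
  lozenge_subset_of_notMem_contour heF fun h =>
    hD.notMem_of_isSolidEdge hT (hD.isSolidEdge_of_mem_contour_zone hT hF h) he

theorem mem_restrict {e : Edge} : e ∈ restrict T F ↔ e ∈ T ∧ lozenge e ⊆ F := by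
  simp [restrict]

theorem mem_restrict_iff (hD : AdmitsHeights D) (hT : IsTiling D T) (hF : F ∈ fractureZones D)
    {e : Edge} (he : e ∈ edges F) : e ∈ restrict T F ↔ e ∈ T :=
  mem_restrict.trans ⟨fun h => h.1, fun h => ⟨h, hD.lozenge_subset_zone hT hF h he⟩⟩

theorem isTiling_restrict (hD : AdmitsHeights D) (hT : IsTiling D T) (hF : F ∈ fractureZones D) :
    IsTiling F (restrict T F) := by
  refine isTiling_iff.2 ⟨fun e he => (mem_restrict.1 he).2, fun t ht => ?_⟩
  obtain ⟨e, ⟨he, hte⟩, hu⟩ := (isTiling_iff.1 hT).2 t (zone_subset hF ht)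
  refine ⟨e, ⟨(hD.mem_restrict_iff hT hF (mem_edges_of_mem ht hte)).2 he, hte⟩, ?_⟩
  rintro f ⟨hf, htf⟩
  exact hu f ⟨(mem_restrict.1 hf).1, htf⟩

theorem biUnion_restrict (hD : AdmitsHeights D) (hT : IsTiling D T) :
    (fractureZones D).biUnion (restrict T) = T := by
  ext e
  rw [Finset.mem_biUnion]
  constructor
  · rintro ⟨F, -, he⟩; exact (mem_restrict.1 he).1
  · intro he
    obtain ⟨t, ht⟩ := lozenge_nonempty e
    obtain ⟨F, hF, htF⟩ := hD.exists_zone_mem hT (hT.1 e he ht)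
    exact ⟨F, hF, (hD.mem_restrict_iff hT hF (mem_edges_of_mem htF (mem_lozenge.1 ht))).2 he⟩

theorem isTiling_glue (hD : AdmitsHeights D) (hT : IsTiling D T) {S : Domain → Finset Edge}
    (hS : ∀ F ∈ fractureZones D, IsTiling F (S F)) :
    IsTiling D ((fractureZones D).biUnion S) := by
  refine isTiling_iff.2 ⟨fun e he => ?_, fun t ht => ?_⟩
  · obtain ⟨F, hF, he⟩ := Finset.mem_biUnion.1 he
    exact ((hS F hF).1 e he).trans (zone_subset hF)
  · obtain ⟨F, hF, htF⟩ := hD.exists_zone_mem hT ht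
    obtain ⟨e, ⟨he, hte⟩, hu⟩ := (isTiling_iff.1 (hS F hF)).2 t htF
    refine ⟨e, ⟨Finset.mem_biUnion.2 ⟨F, hF, he⟩, hte⟩, ?_⟩
    rintro f ⟨hf, htf⟩
    obtain ⟨F', hF', hf⟩ := Finset.mem_biUnion.1 hf
    obtain rfl := hD.zone_unique hT hF hF' htF ((hS F' hF').1 f hf (mem_lozenge.2 htf))
    exact hu f ⟨hf, htf⟩

theorem restrict_glue (hD : AdmitsHeights D) (hT : IsTiling D T) {S : Domain → Finset Edge}
    (hS : ∀ F ∈ fractureZones D, IsTiling F (S F)) (hF : F ∈ fractureZones D) :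
    restrict ((fractureZones D).biUnion S) F = S F := by
  ext e
  rw [mem_restrict, Finset.mem_biUnion]
  constructor
  · rintro ⟨⟨F', hF', he⟩, hl⟩
    obtain ⟨t, ht⟩ := lozenge_nonempty e
    rwa [hD.zone_unique hT hF hF' (hl ht) ((hS F' hF').1 e he ht)]
  · exact fun he => ⟨⟨F, hF, he⟩, (hS F hF).1 e he⟩

-- It realizes every tiling of a zone as the restriction of a tiling of `D`, which lets the zones
-- inherit properties stated for tilings of `D`, and allows one zone to be changed while the others
-- are kept.
open Classical in
theorem exists_extension (hD : AdmitsHeights D) (hT : IsTiling D T) (hF : F ∈ fractureZones D)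
    (hT' : IsTiling F T') : ∃ R, IsTiling D R ∧ restrict R F = T' ∧
      ∀ F' ∈ fractureZones D, F' ≠ F → restrict R F' = restrict T F' := by
  have hS : ∀ G ∈ fractureZones D, IsTiling G (if G = F then T' else restrict T G) := by
    intro G hG
    split_ifs with h
    · rwa [h]
    · exact hD.isTiling_restrict hT hG
  refine ⟨_, hD.isTiling_glue hT hS, by rw [hD.restrict_glue hT hS hF, if_pos rfl], ?_⟩
  intro F' hF' hne
  rw [hD.restrict_glue hT hS hF', if_neg hne]

theorem validPath_of_restrict (hD : AdmitsHeights D) (hT : IsTiling D T)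
    (hF : F ∈ fractureZones D) {u v : Vertex} {n : ℤ} (p : ValidPath F (restrict T F) u v n) :
    ValidPath D T u v n := by
  have key : ∀ e, ValidEdge F (restrict T F) e → ValidEdge D T e := fun e he =>
    ⟨edges_zone_subset hF he.1, fun h => he.2 ((hD.mem_restrict_iff hT hF he.1).2 h)⟩
  induction p with
  | nil => exact ValidPath.nil _
  | fwd e _ he ih => exact ih.fwd e (key e he)
  | bwd e _ he ih => exact ih.bwd e (key e he)

theorem isSolid_of_mem_contourVerts_zone (hD : AdmitsHeights D) (hT : IsTiling D T)
    (hF : F ∈ fractureZones D) {v : Vertex} (hv : v ∈ contourVerts F) : IsSolid D v := by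
  obtain ⟨e, he, rfl | rfl⟩ := mem_contourVerts.1 hv
  exacts [(hD.isSolidEdge_of_mem_contour_zone hT hF he).2.1,
    (hD.isSolidEdge_of_mem_contour_zone hT hF he).2.2.1]

/-- Valid paths in the zone are valid in `D` for an extension of the tiling, so closed ones have
evaluation 0. Contour vertices of the zone are solid in `D`, which fixes the height differences
between them. -/
theorem admitsHeights_zone (hD : AdmitsHeights D) (hT : IsTiling D T) (hF : F ∈ fractureZones D) :
    AdmitsHeights F where
  connected := hD.isConnectedDomain_zone hT hF
  closed_path T₁ hT₁ v n p := by
    obtain ⟨R, hR, rfl, -⟩ := hD.exists_extension hT hF hT₁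
    exact hD.closed_path R hR v n (hD.validPath_of_restrict hR hF p)
  contour_height T₁ T₂ hT₁ hT₂ u hu v hv n m p q := by
    obtain ⟨R, hR, rfl, -⟩ := hD.exists_extension hT hF hT₁
    obtain ⟨R', hR', rfl, -⟩ := hD.exists_extension hT hF hT₂
    have e1 := (hD.validPath_of_restrict hR hF p).eq_add (hD.isHeightOf hR)
    have e2 := (hD.validPath_of_restrict hR' hF q).eq_add (hD.isHeightOf hR')
    have e3 := hD.height_eq_of_isSolid (hD.isSolid_of_mem_contourVerts_zone hT hF hu) hR hR'
    have e4 := hD.height_eq_of_isSolid (hD.isSolid_of_mem_contourVerts_zone hT hF hv) hR hR'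
    omega

theorem height_zone (hD : AdmitsHeights D) (hT : IsTiling D T) (hF : F ∈ fractureZones D)
    {v : Vertex} (hv : v ∈ verts F) :
    height D T v = height F (restrict T F) v + height D T (baseVertex F) := by
  refine (hD.admitsHeights_zone hT hF).eq_height_add (hD.isTiling_restrict hT hF) ?_ hv
  intro e he
  rw [hD.isHeightOf hT e (edges_zone_subset hF he), slope, slope]
  simp only [hD.mem_restrict_iff hT hF he]

theorem height_base_zone (hD : AdmitsHeights D) (hT : IsTiling D T) (hT' : IsTiling D T')
    (hF : F ∈ fractureZones D) : height D T (baseVertex F) = height D T' (baseVertex F) :=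
  hD.height_eq_of_isSolid (hD.isSolid_of_mem_contourVerts_zone hT hF
    (baseVertex_mem (zone_nonempty hF))) hT hT'

/-- Heights in `D` and in a zone differ by the height in `D` of the zone's reference vertex. This
vertex is solid, so the constant is the same for both tilings. -/
theorem tilingLE_iff_zones (hD : AdmitsHeights D) (hT : IsTiling D T) (hT' : IsTiling D T') :
    TilingLE D T T' ↔ ∀ F ∈ fractureZones D, TilingLE F (restrict T F) (restrict T' F) := by
  constructor
  · intro h F hF v hv
    have := h v (verts_zone_subset hF hv)
    rw [hD.height_zone hT hF hv, hD.height_zone hT' hF hv, hD.height_base_zone hT hT' hF] at this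
    omega
  · intro h v hv
    obtain ⟨t, ht, hvt⟩ := mem_verts.1 hv
    obtain ⟨F, hF, htF⟩ := hD.exists_zone_mem hT ht
    have hvF := mem_verts.2 ⟨t, htF, hvt⟩
    have := h F hF v hvF
    rw [hD.height_zone hT hF hvF, hD.height_zone hT' hF hvF, hD.height_base_zone hT hT' hF]
    omega

/-- A zone with a single tiling is a lozenge. -/
theorem zone_eq_lozenge (hD : AdmitsHeights D) (hT : IsTiling D T) (hF : F ∈ fractureZones D)
    (h : ∀ T₁ T₂, IsTiling F T₁ → IsTiling F T₂ → T₁ = T₂) : ∃ e, F = lozenge e := by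
  have hmin := hD.isTiling_minTiling ⟨T, hT⟩
  have hsolid : ∀ v ∈ verts F, IsSolid D v := by
    intro v hv
    refine hD.isSolid_of_forall hT (verts_zone_subset hF hv) fun T' hT' => ?_
    rw [hD.height_zone hT hF hv, hD.height_zone hT' hF hv, hD.height_base_zone hT hT' hF,
      h _ _ (hD.isTiling_restrict hT hF) (hD.isTiling_restrict hT' hF)]
  obtain ⟨t, ht⟩ := zone_nonempty hF
  obtain ⟨e, ⟨he, hte⟩, -⟩ := (isTiling_iff.1 hmin).2 t (zone_subset hF ht)
  have hsub := hD.lozenge_subset_zone hmin hF he (mem_edges_of_mem ht hte)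
  -- All vertices of `F` being solid, the contour of a lozenge of `Min(D)` inside `F` consists of
  -- solid edges. Minimality of `F` then identifies `F` with this lozenge.
  refine ⟨e, ((mem_fractureZones.1 hF).2 _ ((hD.isDelimited_iff hT).2 ⟨lozenge_nonempty e,
    hsub.trans (zone_subset hF), fun f hf => ?_⟩) hsub).symm⟩
  obtain ⟨s, hs, hfs⟩ := mem_edges.1 (contour_subset_edges _ hf)
  have hfF := mem_edges_of_mem (hsub hs) hfs
  refine ⟨edges_zone_subset hF hfF, hsolid _ (src_mem_verts hfF), hsolid _ (tgt_mem_verts hfF),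
    fun hfm => ?_⟩
  obtain rfl := hmin.eq_of_mem hfm he hfs (mem_lozenge.1 hs)
  exact notMem_contour_of_lozenge_subset (Finset.Subset.refl _) hf

end AdmitsHeights

/-! ### Inner vertices -/

theorem Edge.tgt_sub_step (v : Vertex) (d : Fin 3) : (⟨v - step d, d⟩ : Edge).tgt = v := by
  simp [Edge.tgt]

theorem Edge.eq_of_tgt_eq {e : Edge} {v : Vertex} (h : e.tgt = v) : e = ⟨v - step e.dir, e.dir⟩ := by
  subst h
  rcases e with ⟨s, d⟩
  simp [Edge.tgt]

/-- All the triangles around `v` are in `D`. -/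
def IsInner (D : Domain) (v : Vertex) : Prop := ∀ t : Tri, v ∈ t.verts → t ∈ D

theorem isInner_iff {D : Domain} {v : Vertex} :
    IsInner D v ↔ ∀ d, lozenge ⟨v - step d, d⟩ ⊆ D := by
  constructor
  · intro h d t ht
    have := Tri.tgt_mem_verts (mem_lozenge.1 ht)
    rw [Edge.tgt_sub_step] at this
    exact h t this
  · intro h t ht
    obtain ⟨e, he, rfl⟩ := Finset.mem_image.1 ht
    obtain ⟨f, g, heq, -, -, -, -, -, h3⟩ := Tri.exists_edges_eq_of_mem he
    refine h g.dir (mem_lozenge.2 ?_)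
    rw [← Edge.eq_of_tgt_eq h3]
    simp [heq]

theorem IsInner.lozenge_src_subset {D : Domain} {e : Edge} (h : IsInner D e.src) :
    lozenge e ⊆ D := fun t ht => h t (Tri.src_mem_verts (mem_lozenge.1 ht))

theorem IsInner.lozenge_tgt_subset {D : Domain} {e : Edge} (h : IsInner D e.tgt) :
    lozenge e ⊆ D := fun t ht => h t (Tri.tgt_mem_verts (mem_lozenge.1 ht))

theorem IsInner.mem_edges_src {D : Domain} {e : Edge} (h : IsInner D e.src) : e ∈ edges D :=
  mem_edges_of_lozenge_subset h.lozenge_src_subset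

theorem IsInner.mem_edges_tgt {D : Domain} {e : Edge} (h : IsInner D e.tgt) : e ∈ edges D :=
  mem_edges_of_lozenge_subset h.lozenge_tgt_subset

theorem IsInner.mem_edges_sub_step {D : Domain} {v : Vertex} (h : IsInner D v) (d : Fin 3) :
    (⟨v - step d, d⟩ : Edge) ∈ edges D :=
  IsInner.mem_edges_tgt (by rwa [Edge.tgt_sub_step])

theorem IsInner.mem_verts {D : Domain} {v : Vertex} (h : IsInner D v) : v ∈ verts D :=
  src_mem_verts (e := ⟨v, 0⟩) (IsInner.mem_edges_src h)

theorem IsInner.notMem_contourVerts {D : Domain} {v : Vertex} (h : IsInner D v) :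
    v ∉ contourVerts D := by
  intro hv
  obtain ⟨e, he, rfl | rfl⟩ := mem_contourVerts.1 hv
  · exact notMem_contour_of_lozenge_subset h.lozenge_src_subset he
  · exact notMem_contour_of_lozenge_subset h.lozenge_tgt_subset he

theorem isInner_of_notMem_contourVerts {D : Domain} {v : Vertex} (hv : v ∈ verts D)
    (h : v ∉ contourVerts D) : IsInner D v := by
  have key : ∀ e : Edge, (e.src = v ∨ e.tgt = v) → ∀ t t', lozenge e = {t, t'} →
      (t ∈ D ↔ t' ∈ D) := by
    intro e he t t' hl
    have hc : e ∉ contour D := fun h' => h (mem_contourVerts.2 ⟨e, h', he⟩)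
    have h1 : e ∈ t.edges := mem_lozenge.1 (by simp [hl])
    have h2 : e ∈ t'.edges := mem_lozenge.1 (by simp [hl])
    exact ⟨fun ht => lozenge_subset_of_notMem_contour (mem_edges_of_mem ht h1) hc (mem_lozenge.2 h2),
      fun ht => lozenge_subset_of_notMem_contour (mem_edges_of_mem ht h2) hc (mem_lozenge.2 h1)⟩
  rcases v with ⟨x, y⟩
  -- Five of the six edges at the vertex chain together the six triangles around it, so one triangle
  -- in `D` brings in all the others.
  have k1 := key ⟨(x + 1, y + 1), 2⟩ (by simp [Edge.tgt, step]) ⟨(x, y), false⟩ ⟨(x, y), true⟩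
    (by simp [lozenge, step])
  have k2 := key ⟨(x, y), 1⟩ (by simp) ⟨(x, y), true⟩ ⟨(x - 1, y), false⟩
    (by simp [lozenge, step])
  have k3 := key ⟨(x - 1, y), 0⟩ (by simp [Edge.tgt, step]) ⟨(x - 1, y), false⟩
    ⟨(x - 1, y - 1), true⟩ (by simp [lozenge, step])
  have k4 := key ⟨(x, y), 2⟩ (by simp) ⟨(x - 1, y - 1), false⟩ ⟨(x - 1, y - 1), true⟩
    (by simp [lozenge, step, sub_eq_add_neg])
  have k5 := key ⟨(x, y - 1), 1⟩ (by simp [Edge.tgt, step]) ⟨(x, y - 1), true⟩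
    ⟨(x - 1, y - 1), false⟩ (by simp [lozenge, step])
  have hall : ∀ t : Tri, (x, y) ∈ t.verts → t = ⟨(x, y), false⟩ ∨ t = ⟨(x, y), true⟩ ∨
      t = ⟨(x - 1, y), false⟩ ∨ t = ⟨(x - 1, y - 1), true⟩ ∨ t = ⟨(x - 1, y - 1), false⟩ ∨
      t = ⟨(x, y - 1), true⟩ := by
    rintro ⟨⟨p, q⟩, k⟩ ht
    cases k <;> simp [Tri.verts, Tri.edges, step] at ht ⊢ <;> omega
  obtain ⟨t, ht, hvt⟩ := mem_verts.1 hv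
  intro t' ht'
  have h4 : (⟨(x - 1, y - 1), false⟩ : Tri) ∈ D := by
    rcases hall t hvt with rfl | rfl | rfl | rfl | rfl | rfl
    exacts [k4.2 (k3.1 (k2.1 (k1.1 ht))), k4.2 (k3.1 (k2.1 ht)), k4.2 (k3.1 ht), k4.2 ht, ht, k5.1 ht]
  have h3 := k4.1 h4
  rcases hall t' ht' with rfl | rfl | rfl | rfl | rfl | rfl
  exacts [k1.2 (k2.2 (k3.2 h3)), k2.2 (k3.2 h3), k3.2 h3, h3, h4, k5.2 h4]

/-! ### Seeds and flips -/

theorem IsSeed.isInner {D : Domain} {T : Finset Edge} {v : Vertex} (hs : IsSeed T v)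
    (hT : IsTiling D T) : IsInner D v :=
  isInner_iff.2 fun d => hT.1 _ (hs d)

/-- A triangle on an edge leaving the seed also has an edge entering the seed, and this one is
already its edge in `T`. -/
theorem IsSeed.notMem {D : Domain} {T : Finset Edge} {e : Edge} (hs : IsSeed T e.src)
    (hT : IsTiling D T) : e ∉ T := by
  intro he
  obtain ⟨t, ht⟩ := lozenge_nonempty e
  rw [mem_lozenge] at ht
  obtain ⟨f, g, heq, -, -, heg, -, -, h3⟩ := Tri.exists_edges_eq_of_mem ht
  have hg : g ∈ T := by rw [Edge.eq_of_tgt_eq h3]; exact hs g.dir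
  exact heg (hT.eq_of_mem he hg ht (by simp [heq]))

namespace AdmitsHeights

variable {D : Domain} {T T' : Finset Edge} {v : Vertex}

theorem height_sub_step (hD : AdmitsHeights D) (hT : IsTiling D T) (d : Fin 3)
    (he : (⟨v - step d, d⟩ : Edge) ∈ T) : height D T (v - step d) = height D T v + 2 := by
  have := hD.isHeightOf hT _ (hT.mem_edges he)
  rw [Edge.tgt_sub_step, slope, if_pos he] at this
  simp only at this
  omega

/-- At an inner local minimum no entering edge can rise by 1, so all three are cut. Around a seed
the neighbours lie 1 or 2 above it. -/
theorem mem_localMinima (hD : AdmitsHeights D) (hT : IsTiling D T) :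
    v ∈ localMinima D T ↔ IsSeed T v := by
  simp only [localMinima, Finset.mem_filter, Finset.mem_sdiff]
  constructor
  · rintro ⟨⟨hv, hc⟩, h⟩ d
    have hi := isInner_of_notMem_contourVerts hv hc
    rw [hD.mem_iff_height hT (hi.mem_edges_sub_step d), Edge.tgt_sub_step]
    have := (h d).2
    simp only
    omega
  · intro hs
    have hi := hs.isInner hT
    refine ⟨⟨hi.mem_verts, hi.notMem_contourVerts⟩, fun d => ⟨?_, ?_⟩⟩
    · have := hD.isHeightOf hT ⟨v, d⟩ (IsInner.mem_edges_src hi)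
      rw [slope, if_neg (IsSeed.notMem (e := ⟨v, d⟩) hs hT)] at this
      simp only [Edge.tgt] at this
      omega
    · have := hD.height_sub_step hT d (hs d)
      omega

/-- A cube can be added on a seed. -/
theorem exists_flip (hD : AdmitsHeights D) (hT : IsTiling D T) (hs : IsSeed T v) :
    ∃ T', IsTiling D T' ∧ ∀ w ∈ verts D, height D T' w = height D T w + if w = v then 3 else 0 := by
  have hi := hs.isInner hT
  -- Edges leaving the seed rise by 1 and those entering it fall by 2. Raising `v` by 3 exchanges
  -- these two values, so all bounds still hold.
  have key : ∀ e ∈ edges D, (e.src = v → e.tgt ≠ v ∧ height D T e.tgt = height D T e.src + 1) ∧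
      (e.tgt = v → height D T e.tgt = height D T e.src - 2) := by
    intro e he
    constructor
    · intro h
      refine ⟨fun h' => e.src_ne_tgt (h.trans h'.symm), ?_⟩
      rw [hD.isHeightOf hT e he, slope, if_neg (IsSeed.notMem (h ▸ hs) hT)]
    · intro h
      rw [hD.isHeightOf hT e he, slope, if_pos]
      · ring
      · rw [Edge.eq_of_tgt_eq h]; exact hs _
  have := hD.ofHeight_spec hT (h := fun w => height D T w + if w = v then 3 else 0) ?_ ?_ ?_ ?_
  · exact ⟨_, this⟩
  · intro e he
    have h1 := hD.height_tgt_le hT he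
    have h2 := key e he
    by_cases a : e.src = v
    · obtain ⟨b, c⟩ := h2.1 a
      simp only [if_pos a, if_neg b]; omega
    · by_cases b : e.tgt = v
      · simp only [if_neg a, if_pos b]; have := h2.2 b; omega
      · simp only [if_neg a, if_neg b]; omega
  · intro e he
    have h1 := hD.height_src_le hT he
    have h2 := key e he
    by_cases a : e.src = v
    · obtain ⟨b, c⟩ := h2.1 a
      simp only [if_pos a, if_neg b]; omega
    · by_cases b : e.tgt = v
      · simp only [if_neg a, if_pos b]; have := h2.2 b; omega
      · simp only [if_neg a, if_neg b]; omega
  · intro w _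
    split_ifs <;> simp
  · intro w hw
    have : w ≠ v := by rintro rfl; exact hi.notMem_contourVerts hw
    simp [this]

/-- Among the vertices where `T'` is strictly higher, take one of least height in `T`. If an
entering edge were uncut, its source would be lower, so both tilings would agree there; `T'` could
then rise by at most 1 to `v`, which is the height of `T`. -/
theorem exists_seed_of_lt (hD : AdmitsHeights D) (hT : IsTiling D T) (hT' : IsTiling D T')
    (h : TilingLE D T T') (hne : T ≠ T') :
    ∃ v ∈ verts D, IsSeed T v ∧ height D T v + 3 ≤ height D T' v := by
  have hex : ((verts D).filter fun v => height D T v < height D T' v).Nonempty := by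
    by_contra hn
    rw [Finset.not_nonempty_iff_eq_empty, Finset.filter_eq_empty_iff] at hn
    exact hne (hD.tilingLE_antisymm hT hT' h fun v hv => not_lt.1 (hn hv))
  obtain ⟨v, hv, hmin⟩ := Finset.exists_min_image _ (height D T) hex
  rw [Finset.mem_filter] at hv
  have hmin' : ∀ w ∈ verts D, height D T w < height D T v → height D T' w = height D T w := by
    intro w hw hlt
    by_contra hne
    have := hmin w (Finset.mem_filter.2 ⟨hw, lt_of_le_of_ne (h w hw) (Ne.symm hne)⟩)
    omega
  have hi : IsInner D v := isInner_of_notMem_contourVerts hv.1 fun hc => by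
    have := hD.height_contour hT hT' hc
    omega
  have hc := hD.height_congr hT' hT hv.1
  refine ⟨v, hv.1, fun d => ?_, by omega⟩
  have he := hi.mem_edges_sub_step d
  by_contra hn
  have h1 := hD.isHeightOf hT _ he
  rw [slope, if_neg hn, Edge.tgt_sub_step] at h1
  have h2 := hD.height_tgt_le hT' he
  rw [Edge.tgt_sub_step] at h2
  have h3 := hmin' (v - step d) (src_mem_verts he) (by simp only at h1; omega)
  simp only at h1 h2
  omega

/-! ### Cubes -/

theorem mem_cubes {c : Cube} : c ∈ cubes D T ↔ c.1 ∈ verts D ∧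
    height D (minTiling D) c.1 ≤ c.2 ∧ c.2 < height D T c.1 ∧
      (3 : ℤ) ∣ c.2 - height D (minTiling D) c.1 := by
  rcases c with ⟨v, h⟩
  simp only [cubes, Finset.mem_biUnion, Finset.mem_image, Finset.mem_filter, Finset.mem_Ico,
    Prod.mk.injEq]
  constructor
  · rintro ⟨w, hw, k, hk, rfl, rfl⟩
    exact ⟨hw, hk.1.1, hk.1.2, hk.2⟩
  · rintro ⟨h1, h2, h3, h4⟩
    exact ⟨v, h1, h, ⟨⟨h2, h3⟩, h4⟩, rfl, rfl⟩

theorem isInner_of_mem_cubes (hD : AdmitsHeights D) (hT : IsTiling D T) {c : Cube}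
    (hc : c ∈ cubes D T) : IsInner D c.1 := by
  rw [mem_cubes] at hc
  refine isInner_of_notMem_contourVerts hc.1 fun h => ?_
  have := hD.height_contour hT (hD.isTiling_minTiling ⟨T, hT⟩) h
  omega

/-- If `T` exceeds `T'` at `v`, the cube above `v` at height `height D T' v` belongs to `T` but not
to `T'`. -/
theorem cubes_subset_iff (hD : AdmitsHeights D) (hT : IsTiling D T) (hT' : IsTiling D T') :
    cubes D T ⊆ cubes D T' ↔ TilingLE D T T' := by
  constructor
  · intro h v hv
    by_contra hlt
    have h1 := hD.height_congr hT hT' hv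
    have h2 := hD.height_congr hT' (hD.isTiling_minTiling ⟨T, hT⟩) hv
    have h3 := hD.minTiling_le hT' v hv
    have := @h (v, height D T' v) (mem_cubes.2 ⟨hv, h3, by simpa using hlt, h2⟩)
    rw [mem_cubes] at this
    simp at this
  · intro h c hc
    rw [mem_cubes] at hc ⊢
    have := h c.1 hc.1
    exact ⟨hc.1, hc.2.1, by omega, hc.2.2.2⟩

theorem cubes_injective (hD : AdmitsHeights D) (hT : IsTiling D T) (hT' : IsTiling D T')
    (h : cubes D T = cubes D T') : T = T' :=
  hD.tilingLE_antisymm hT hT' ((hD.cubes_subset_iff hT hT').1 h.subset)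
    ((hD.cubes_subset_iff hT' hT).1 h.symm.subset)

theorem cubes_infTiling_pair (hD : AdmitsHeights D) (hT : IsTiling D T) (hT' : IsTiling D T') :
    cubes D (infTiling D {T, T'}) = cubes D T ∩ cubes D T' := by
  ext c
  rw [Finset.mem_inter, mem_cubes, mem_cubes, mem_cubes]
  by_cases hc : c.1 ∈ verts D
  · rw [hD.height_infTiling_pair hT hT' hc, lt_min_iff]; tauto
  · simp [hc]

theorem cubes_supTiling_pair (hD : AdmitsHeights D) (hT : IsTiling D T) (hT' : IsTiling D T') :
    cubes D (supTiling D {T, T'}) = cubes D T ∪ cubes D T' := by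
  ext c
  rw [Finset.mem_union, mem_cubes, mem_cubes, mem_cubes]
  by_cases hc : c.1 ∈ verts D
  · rw [hD.height_supTiling_pair hT hT' hc, lt_max_iff]; tauto
  · simp [hc]

theorem card_cubes_filter (hD : AdmitsHeights D) (hT : IsTiling D T) (hv : v ∈ verts D) :
    3 * (((cubes D T).filter fun c => c.1 = v).card : ℤ) =
      height D T v - height D (minTiling D) v := by
  have h1 := hD.height_congr hT (hD.isTiling_minTiling ⟨T, hT⟩) hv
  have h2 := hD.minTiling_le hT v hv
  obtain ⟨n, hn⟩ := h1
  lift n to ℕ using by omega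
  have : (cubes D T).filter (fun c => c.1 = v) =
      (Finset.range n).image fun i : ℕ => (v, height D (minTiling D) v + 3 * (i : ℤ)) := by
    ext ⟨w, h⟩
    simp only [Finset.mem_filter, mem_cubes, Finset.mem_image, Finset.mem_range, Prod.mk.injEq]
    constructor
    · rintro ⟨⟨-, a, b, k, hk⟩, rfl⟩
      exact ⟨k.toNat, by omega, rfl, by omega⟩
    · rintro ⟨i, hi, rfl, rfl⟩
      exact ⟨⟨hv, by omega, by omega, by simp⟩, rfl⟩
  rw [this, Finset.card_image_of_injective, Finset.card_range, hn]
  intro i j h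
  simpa using h

/-- Adding cubes to a tiling, when the outcome is the pile of cubes of a tiling. -/
theorem addCubes_eq (hD : AdmitsHeights D) (hT : IsTiling D T) (hT' : IsTiling D T')
    {C : Finset Cube} (hdisj : Disjoint (cubes D T) C) (h : cubes D T' = cubes D T ∪ C) :
    addCubes D T C = T' := by
  refine hD.ofHeight_height hT' fun v hv => ?_
  have h1 := hD.card_cubes_filter hT hv
  have h2 := hD.card_cubes_filter hT' hv
  rw [h, Finset.filter_union, Finset.card_union_of_disjoint
    (Finset.disjoint_filter_filter hdisj)] at h2
  push_cast at h2
  linarith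

theorem cubes_flip (hD : AdmitsHeights D) (hT : IsTiling D T)
    (hv : v ∈ verts D)
    (h : ∀ w ∈ verts D, height D T' w = height D T w + if w = v then 3 else 0) :
    cubes D T' = insert (v, height D T v) (cubes D T) := by
  have h1 := hD.height_congr hT (hD.isTiling_minTiling ⟨T, hT⟩) hv
  have h2 := hD.minTiling_le hT v hv
  ext ⟨w, k⟩
  rw [Finset.mem_insert, mem_cubes, mem_cubes, Prod.mk.injEq]
  by_cases hw : w ∈ verts D
  · simp only [hw, h w hw, true_and]
    by_cases hwv : w = v
    · subst hwv
      simp only [if_pos, true_and]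
      constructor
      · rintro ⟨a, b, c⟩; omega
      · rintro (rfl | ⟨a, b, c⟩)
        · exact ⟨h2, by omega, h1⟩
        · exact ⟨a, by omega, c⟩
    · simp [hwv]
  · have : w ≠ v := by rintro rfl; exact hw hv
    simp [hw, this]

theorem notMem_cubes_self : (v, height D T v) ∉ cubes D T := by simp [mem_cubes]

/-- Adding a cube on a seed. -/
theorem addCubes_singleton (hD : AdmitsHeights D) (hT : IsTiling D T) (hs : IsSeed T v) :
    IsTiling D (addCubes D T {(v, height D T v)}) ∧
      ∀ w ∈ verts D, height D (addCubes D T {(v, height D T v)}) w =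
        height D T w + if w = v then 3 else 0 := by
  obtain ⟨T', hT', h⟩ := hD.exists_flip hT hs
  have := hD.addCubes_eq hT hT' (C := {(v, height D T v)})
    (Finset.disjoint_singleton_right.2 notMem_cubes_self)
    (by rw [hD.cubes_flip hT (hs.isInner hT).mem_verts h, Finset.union_comm,
      Finset.singleton_union])
  rw [this]
  exact ⟨hT', h⟩

/-! ### Covering pairs -/

/-- Below any larger tiling there is room for a cube on some seed, so a cover is such an addition.
Conversely nothing fits strictly between, since heights at one vertex change by multiples of 3. -/
theorem tilingCovBy_iff (hD : AdmitsHeights D) :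
    TilingCovBy D T T' ↔
      IsTiling D T ∧ ∃ v, IsSeed T v ∧ T' = addCubes D T {(v, height D T v)} := by
  constructor
  · rintro ⟨hT, hT', ⟨hle, hne⟩, hcov⟩
    refine ⟨hT, ?_⟩
    obtain ⟨v, hv, hs, h3⟩ := hD.exists_seed_of_lt hT hT' hle hne
    refine ⟨v, hs, ?_⟩
    obtain ⟨hR, h⟩ := hD.addCubes_singleton hT hs
    by_contra hne'
    refine hcov _ hR ⟨⟨fun w hw => ?_, fun heq => ?_⟩, ⟨fun w hw => ?_, Ne.symm hne'⟩⟩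
    · rw [h w hw]; split_ifs <;> omega
    · have := h v hv
      rw [← heq, if_pos rfl] at this
      omega
    · rw [h w hw]
      split_ifs with hwv
      · rwa [hwv]
      · simpa using hle w hw
  · rintro ⟨hT, v, hs, rfl⟩
    obtain ⟨hR, h⟩ := hD.addCubes_singleton hT hs
    have hv := (hs.isInner hT).mem_verts
    refine ⟨hT, hR, ⟨fun w hw => by rw [h w hw]; split_ifs <;> omega, fun heq => ?_⟩, ?_⟩
    · have := h v hv
      rw [← heq, if_pos rfl] at this
      omega
    · rintro S hS ⟨⟨h1, h2⟩, ⟨h3, h4⟩⟩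
      have hne : ∀ w ∈ verts D, w ≠ v → height D S w = height D T w := by
        intro w hw hwv
        have a := h1 w hw
        have b := h3 w hw
        rw [h w hw, if_neg hwv] at b
        omega
      have a := h1 v hv
      have b := h3 v hv
      have c := hD.height_congr hS hT hv
      rw [h v hv, if_pos rfl] at b
      by_cases heq : height D S v = height D T v
      · refine h2 (hD.eq_of_height_eq hT hS fun w hw => ?_)
        by_cases hwv : w = v
        · rw [hwv, heq]
        · exact (hne w hw hwv).symm
      · refine h4 (hD.eq_of_height_eq hS hR fun w hw => ?_)
        rw [h w hw]
        split_ifs with hwv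
        · subst hwv; omega
        · simpa using hne w hw hwv

theorem tilingLE_refl (D : Domain) (T : Finset Edge) : TilingLE D T T := fun _ _ => le_rfl

theorem tilingLE_trans {T₁ T₂ T₃ : Finset Edge} (h : TilingLE D T₁ T₂) (h' : TilingLE D T₂ T₃) :
    TilingLE D T₁ T₃ := fun v hv => (h v hv).trans (h' v hv)

/-- One climbs from `T` to `T'` by adding a cube on a seed below `T'`; the total height gap
decreases each time. -/
theorem tilingLE_iff_reflTransGen (hD : AdmitsHeights D) (hT : IsTiling D T)
    (hT' : IsTiling D T') : TilingLE D T T' ↔ Relation.ReflTransGen (TilingCovBy D) T T' := by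
  constructor
  · intro h
    obtain ⟨n, hn⟩ : ∃ n, n = ∑ v ∈ verts D, (height D T' v - height D T v).toNat := ⟨_, rfl⟩
    induction n using Nat.strong_induction_on generalizing T with
    | _ n ih =>
      by_cases hne : T = T'
      · rw [hne]
      obtain ⟨v, hv, hs, h3⟩ := hD.exists_seed_of_lt hT hT' h hne
      obtain ⟨hR, hh⟩ := hD.addCubes_singleton hT hs
      refine Relation.ReflTransGen.head (hD.tilingCovBy_iff.2 ⟨hT, v, hs, rfl⟩)
        (ih _ ?_ hR (fun w hw => ?_) rfl)
      · rw [hn]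
        refine Finset.sum_lt_sum (fun w hw => ?_) ⟨v, hv, ?_⟩
        · rw [hh w hw]; split_ifs <;> omega
        · rw [hh v hv, if_pos rfl]; omega
      · rw [hh w hw]
        split_ifs with hwv
        · rwa [hwv]
        · simpa using h w hw
  · intro h
    clear hT'
    induction h with
    | refl => exact tilingLE_refl D T
    | tail _ h ih => exact tilingLE_trans ih h.2.2.1.1

/-! ### Adding a downward closed set of cubes -/

/-- The cubes of `A` lie above `T`, and each of them rests on `T` or on other cubes of `A`. -/
structure RestsOn (D : Domain) (T : Finset Edge) (A : Finset Cube) : Prop where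
  inner : ∀ c ∈ A, IsInner D c.1
  le : ∀ c ∈ A, height D T c.1 ≤ c.2
  dvd : ∀ c ∈ A, (3 : ℤ) ∣ c.2 - height D T c.1
  pred : ∀ c ∈ A, ∀ d : Fin 3, (c.1 - step d, c.2 - 1) ∈ A ∨ c.2 - 1 < height D T (c.1 - step d)

theorem RestsOn.disjoint {A : Finset Cube} (hA : RestsOn D T A) : Disjoint (cubes D T) A := by
  rw [Finset.disjoint_left]
  intro c hc hcA
  rw [mem_cubes] at hc
  have := hA.le c hcA
  omega

/-- A lowest cube of `A` can rest on no other cube of `A`, hence it lies on a seed of `T`. Adding it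
and removing it from `A` preserves the hypothesis. -/
theorem RestsOn.exists_tiling (hD : AdmitsHeights D) {A : Finset Cube} (hT : IsTiling D T)
    (hA : RestsOn D T A) : ∃ T', IsTiling D T' ∧ cubes D T' = cubes D T ∪ A := by
  obtain ⟨n, hn⟩ : ∃ n, n = A.card := ⟨_, rfl⟩
  induction n generalizing T A with
  | zero => exact ⟨T, hT, by rw [Finset.card_eq_zero.1 hn.symm, Finset.union_empty]⟩
  | succ n ih =>
    have hne : A.Nonempty := Finset.card_pos.1 (by omega)
    obtain ⟨⟨v, k⟩, hc, hmin⟩ := A.exists_min_image (fun c => c.2) hne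
    have hi := hA.inner _ hc
    have h1 := hA.le _ hc
    have h2 := hA.dvd _ hc
    simp only at h1 h2 hi
    have hpred : ∀ d : Fin 3, k - 1 < height D T (v - step d) := by
      intro d
      rcases hA.pred _ hc d with h | h
      · have := hmin _ h
        simp only at this
        omega
      · exact h
    -- The neighbour at `v - step 0` is at least as high as `k` and at most 2 above `v`, so `v` is
    -- higher than `k - 3`; it is at most `k` and congruent to `k` mod 3.
    have hk : height D T v = k := by
      have := hD.height_src_le hT (hi.mem_edges_sub_step 0)
      rw [Edge.tgt_sub_step] at this
      have := hpred 0
      simp only at *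
      omega
    have hs : IsSeed T v := by
      intro d
      rw [hD.mem_iff_height hT (hi.mem_edges_sub_step d), Edge.tgt_sub_step]
      have := hpred d
      simp only
      omega
    obtain ⟨hR, hh⟩ := hD.addCubes_singleton hT hs
    have hcub := hD.cubes_flip hT hi.mem_verts hh
    set R := addCubes D T {(v, height D T v)}
    have hmono : ∀ w ∈ verts D, height D T w ≤ height D R w := by
      intro w hw; rw [hh w hw]; split_ifs <;> omega
    have hA' : RestsOn D R (A.erase (v, k)) := by
      refine ⟨fun c hc' => hA.inner c (Finset.mem_of_mem_erase hc'), fun c hc' => ?_,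
        fun c hc' => ?_, fun c hc' d => ?_⟩
      · obtain ⟨hne, hcA⟩ := Finset.mem_erase.1 hc'
        have := hA.le c hcA
        rw [hh _ (hA.inner c hcA).mem_verts]
        split_ifs with hcv
        · have a := hmin c hcA
          have b := hA.dvd c hcA
          have : c.2 ≠ k := fun h => hne (Prod.ext hcv h)
          rw [hcv] at *
          simp only at a
          omega
        · omega
      · obtain ⟨hne, hcA⟩ := Finset.mem_erase.1 hc'
        have := hA.dvd c hcA
        rw [hh _ (hA.inner c hcA).mem_verts]
        split_ifs <;> omega
      · obtain ⟨hne, hcA⟩ := Finset.mem_erase.1 hc'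
        have hw : c.1 - step d ∈ verts D := src_mem_verts ((hA.inner c hcA).mem_edges_sub_step d)
        rcases hA.pred c hcA d with h | h
        · by_cases heq : (c.1 - step d, c.2 - 1) = (v, k)
          · right
            rw [Prod.mk.injEq] at heq
            rw [hh _ hw, heq.1, if_pos rfl]
            omega
          · exact Or.inl (Finset.mem_erase.2 ⟨heq, h⟩)
        · exact Or.inr (h.trans_le (hmono _ hw))
    obtain ⟨T', hT', h'⟩ := ih hR hA' (by rw [Finset.card_erase_of_mem hc]; omega)
    refine ⟨T', hT', ?_⟩
    rw [h', hcub, hk, Finset.insert_union, ← Finset.union_insert, Finset.insert_erase hc]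

theorem RestsOn.addCubes (hD : AdmitsHeights D) {A : Finset Cube} (hT : IsTiling D T)
    (hA : RestsOn D T A) :
    IsTiling D (addCubes D T A) ∧ cubes D (addCubes D T A) = cubes D T ∪ A := by
  obtain ⟨T', hT', h⟩ := hA.exists_tiling hD hT
  rw [hD.addCubes_eq hT hT' hA.disjoint h]
  exact ⟨hT', h⟩

/-- Piles of cubes are downward closed. -/
theorem pred_mem_cubes (hD : AdmitsHeights D) (hT : IsTiling D T) {c : Cube} (hc : c ∈ cubes D T)
    (d : Fin 3) (h : height D (minTiling D) (c.1 - step d) ≤ c.2 - 1) :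
    (c.1 - step d, c.2 - 1) ∈ cubes D T := by
  have hi := hD.isInner_of_mem_cubes hT hc
  have hmin := hD.isTiling_minTiling ⟨T, hT⟩
  have he := hi.mem_edges_sub_step d
  rw [mem_cubes] at hc ⊢
  have h1 := hD.height_tgt_le hT he
  have h2 := hD.height_congr hT hmin hc.1
  have h3 := hD.isHeightOf hmin _ he
  rw [Edge.tgt_sub_step] at h1 h3
  have h4 : slope (minTiling D) ⟨c.1 - step d, d⟩ = 1 ∨
      slope (minTiling D) ⟨c.1 - step d, d⟩ = -2 := by unfold slope; split_ifs <;> simp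
  simp only at h1 h3 ⊢
  exact ⟨src_mem_verts he, h, by omega, by omega⟩

end AdmitsHeights

/-! ### Piles of cubes placed on a seed -/

theorem CompactPile.of_dec {P : Pile} (h0 : ∀ i j k, (i + 1, j, k) ∈ P → (i, j, k) ∈ P)
    (h1 : ∀ i j k, (i, j + 1, k) ∈ P → (i, j, k) ∈ P)
    (h2 : ∀ i j k, (i, j, k + 1) ∈ P → (i, j, k) ∈ P) : CompactPile P := by
  intro i j k h
  refine ⟨fun i' hi => ?_, fun j' hj => ?_, fun k' hk => ?_⟩
  · induction hi using Nat.decreasingInduction with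
    | self => exact h
    | of_succ m _ ih => exact h0 _ _ _ ih
  · induction hj using Nat.decreasingInduction with
    | self => exact h
    | of_succ m _ ih => exact h1 _ _ _ ih
  · induction hk using Nat.decreasingInduction with
    | self => exact h
    | of_succ m _ ih => exact h2 _ _ _ ih

/-- The coordinates of a cube of a pile. -/
def coord (q : ℕ × ℕ × ℕ) : Fin 3 → ℕ := ![q.1, q.2.1, q.2.2]

/-- The sum of the coordinates of a cube of a pile. -/
def weight (q : ℕ × ℕ × ℕ) : ℕ := q.1 + q.2.1 + q.2.2

/-- The vertex below a cube of a pile placed at `v`. -/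
def foot (v : Vertex) (q : ℕ × ℕ × ℕ) : Vertex := proj v q.1 q.2.1 q.2.2

theorem coord_ext {q q' : ℕ × ℕ × ℕ} (h : ∀ d, coord q d = coord q' d) : q = q' := by
  have h0 := h 0
  have h1 := h 1
  have h2 := h 2
  simp only [coord, Fin.isValue, Matrix.cons_val_zero, Matrix.cons_val_one,
    Matrix.cons_val] at h0 h1 h2
  exact Prod.ext h0 (Prod.ext h1 h2)

theorem foot_zero (v : Vertex) : foot v (0, 0, 0) = v := by simp [foot, proj]

theorem foot_inj_left {v v' : Vertex} {q : ℕ × ℕ × ℕ} (h : foot v q = foot v' q) : v = v' := by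
  simpa [foot, proj] using h

theorem foot_succ_zero (v : Vertex) (i j k : ℕ) :
    foot v (i + 1, j, k) - step 0 = foot v (i, j, k) := by
  simp only [foot, proj]; push_cast; rw [add_smul, one_smul]; abel

theorem foot_succ_one (v : Vertex) (i j k : ℕ) :
    foot v (i, j + 1, k) - step 1 = foot v (i, j, k) := by
  simp only [foot, proj]; push_cast; rw [add_smul, one_smul]; abel

theorem foot_succ_two (v : Vertex) (i j k : ℕ) :
    foot v (i, j, k + 1) - step 2 = foot v (i, j, k) := by
  simp only [foot, proj]; push_cast; rw [add_smul, one_smul]; abel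

theorem cubeAt_eq (D : Domain) (T : Finset Edge) (v : Vertex) (q : ℕ × ℕ × ℕ) :
    cubeAt D T v q = (foot v q, height D T v + weight q) := rfl

theorem mem_walls {v : Vertex} {P : Pile} {e : Edge} : e ∈ walls v P ↔ ∃ q ∈ P,
    e = ⟨proj v 0 q.2.1 q.2.2 - step 0, 0⟩ ∨ e = ⟨proj v q.1 0 q.2.2 - step 1, 1⟩ ∨
      e = ⟨proj v q.1 q.2.1 0 - step 2, 2⟩ := by
  simp only [walls, Finset.mem_biUnion, Finset.mem_insert, Finset.mem_singleton]

/-- The neighbour of a cube of a compact pile in a negative direction is in the pile, unless the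
cube touches a base plane. -/
theorem CompactPile.exists_pred {P : Pile} (hP : CompactPile P) {q : ℕ × ℕ × ℕ} (hq : q ∈ P)
    (v : Vertex) (d : Fin 3) :
    (coord q d = 0 ∧ (⟨foot v q - step d, d⟩ : Edge) ∈ walls v P) ∨
    ∃ q' ∈ P, foot v q' = foot v q - step d ∧ weight q' + 1 = weight q ∧
      coord q' d + 1 = coord q d ∧ ∀ d' ≠ d, coord q' d' = coord q d' := by
  obtain ⟨i, j, k⟩ := q
  fin_cases d
  · rcases i with - | i
    · exact Or.inl ⟨rfl, mem_walls.2 ⟨_, hq, Or.inl rfl⟩⟩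
    · refine Or.inr ⟨(i, j, k), (hP _ _ _ hq).1 i (Nat.le_succ i), (foot_succ_zero v i j k).symm,
        by simp only [weight]; omega, rfl, ?_⟩
      intro d' hd'
      fin_cases d' <;> first | rfl | exact absurd rfl hd'
  · rcases j with - | j
    · exact Or.inl ⟨rfl, mem_walls.2 ⟨_, hq, Or.inr (Or.inl rfl)⟩⟩
    · refine Or.inr ⟨(i, j, k), (hP _ _ _ hq).2.1 j (Nat.le_succ j), (foot_succ_one v i j k).symm,
        by simp only [weight]; omega, rfl, ?_⟩
      intro d' hd'
      fin_cases d' <;> first | rfl | exact absurd rfl hd'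
  · rcases k with - | k
    · exact Or.inl ⟨rfl, mem_walls.2 ⟨_, hq, Or.inr (Or.inr rfl)⟩⟩
    · refine Or.inr ⟨(i, j, k), (hP _ _ _ hq).2.2 k (Nat.le_succ k), (foot_succ_two v i j k).symm,
        by simp only [weight]; omega, rfl, ?_⟩
      intro d' hd'
      fin_cases d' <;> first | rfl | exact absurd rfl hd'

theorem eq_zero_of_coord {q : ℕ × ℕ × ℕ} (h : ∀ d, coord q d = 0) : q = (0, 0, 0) :=
  coord_ext fun d => by rw [h d]; fin_cases d <;> rfl

/-- A compact pile placed at `v`, on whose base planes `T` is the minimal tiling. -/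
structure FitsAt (T : Finset Edge) (v : Vertex) (P : Pile) : Prop where
  compact : CompactPile P
  walls_subset : walls v P ⊆ T

theorem walls_mono (v : Vertex) {P P' : Pile} (h : P ⊆ P') : walls v P ⊆ walls v P' :=
  Finset.biUnion_subset_biUnion_of_subset_left _ h

/-- By induction on the weight, each lozenge cut by an edge entering the foot is either a wall,
hence in the tiling, or surrounds an edge leaving the foot of an earlier cube, already inner. -/
theorem FitsAt.isInner {D : Domain} {T : Finset Edge} {v : Vertex} {P : Pile} (hP : FitsAt T v P)
    (hT : IsTiling D T) {q : ℕ × ℕ × ℕ} (hq : q ∈ P) : IsInner D (foot v q) := by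
  obtain ⟨n, hn⟩ : ∃ n, n = weight q := ⟨_, rfl⟩
  induction n using Nat.strong_induction_on generalizing q with
  | _ n ih =>
    refine isInner_iff.2 fun d => ?_
    rcases hP.compact.exists_pred hq v d with ⟨-, h⟩ | ⟨q', hq', h1, h2, -⟩
    · exact hT.1 _ (hP.walls_subset h)
    · rw [← h1]
      exact IsInner.lozenge_src_subset (e := ⟨foot v q', d⟩) (ih _ (by omega) hq' rfl)

/-- A lozenge cut by an edge that enters `u` and a lozenge cut by an edge that leaves `u` overlap if
the edges have different directions. -/
theorem IsTiling.notMem_of_mem_of_ne {D : Domain} {T : Finset Edge} (hT : IsTiling D T)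
    {u : Vertex} {d d' : Fin 3} (hne : d ≠ d') (h : (⟨u - step d, d⟩ : Edge) ∈ T) :
    (⟨u, d'⟩ : Edge) ∉ T := by
  intro h'
  have key : ∃ t : Tri, (⟨u - step d, d⟩ : Edge) ∈ t.edges ∧ (⟨u, d'⟩ : Edge) ∈ t.edges := by
    rcases u with ⟨x, y⟩
    fin_cases d <;> fin_cases d' <;> first | exact absurd rfl hne | skip
    · exact ⟨⟨(x - 1, y), false⟩, by simp [Tri.edges, step]⟩
    · exact ⟨⟨(x - 1, y - 1), true⟩, by simp [Tri.edges, step]⟩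
    · exact ⟨⟨(x, y - 1), true⟩, by simp [Tri.edges, step]⟩
    · exact ⟨⟨(x - 1, y - 1), false⟩, by simp [Tri.edges, step]⟩
    · exact ⟨⟨(x, y), false⟩, by simp [Tri.edges, step]⟩
    · exact ⟨⟨(x, y), true⟩, by simp [Tri.edges, step]⟩
  obtain ⟨t, h1, h2⟩ := key
  have := hT.eq_of_mem h h' h1 h2
  rw [Edge.mk.injEq] at this
  exact hne this.2

namespace FitsAt

variable {D : Domain} {T : Finset Edge} {v v' : Vertex} {P P' : Pile} {q q' : ℕ × ℕ × ℕ}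

theorem height_foot (hD : AdmitsHeights D) (hT : IsTiling D T) (hP : FitsAt T v P) (hq : q ∈ P) :
    height D T (foot v q) ≤ height D T v + weight q ∧
      (3 : ℤ) ∣ height D T v + weight q - height D T (foot v q) := by
  obtain ⟨n, hn⟩ : ∃ n, n = weight q := ⟨_, rfl⟩
  induction n using Nat.strong_induction_on generalizing q with
  | _ n ih =>
    by_cases h0 : ∀ d, coord q d = 0
    · rw [eq_zero_of_coord h0, foot_zero]
      simp [weight]
    · push Not at h0
      obtain ⟨d, hd⟩ := h0
      rcases hP.compact.exists_pred hq v d with ⟨h, -⟩ | ⟨q', hq', h1, h2, -⟩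
      · contradiction
      · have := ih _ (by omega) hq' rfl
        have he := hD.isHeightOf hT ⟨foot v q', d⟩ (IsInner.mem_edges_src (hP.isInner hT hq'))
        have ht : (⟨foot v q', d⟩ : Edge).tgt = foot v q := by rw [h1, Edge.tgt_sub_step]
        have h4 : slope T ⟨foot v q', d⟩ = 1 ∨ slope T ⟨foot v q', d⟩ = -2 := by
          unfold slope; split_ifs <;> simp
        rw [ht] at he
        simp only at he
        omega

/-- Along the base plane orthogonal to `d`, each foot is entered by a cut edge of direction `d`. An
edge leaving it in another direction cannot be cut as well, so each step raises the height by
exactly 1. -/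
theorem height_foot_of_coord (hD : AdmitsHeights D) (hT : IsTiling D T) (hP : FitsAt T v P)
    (hq : q ∈ P) {d : Fin 3} (hd : coord q d = 0) :
    height D T (foot v q) = height D T v + weight q := by
  obtain ⟨n, hn⟩ : ∃ n, n = weight q := ⟨_, rfl⟩
  induction n using Nat.strong_induction_on generalizing q with
  | _ n ih =>
    by_cases h0 : ∀ d, coord q d = 0
    · rw [eq_zero_of_coord h0, foot_zero]
      simp [weight]
    · push Not at h0
      obtain ⟨d', hd'⟩ := h0
      have hne : d ≠ d' := by rintro rfl; exact hd' hd
      rcases hP.compact.exists_pred hq v d' with ⟨h, -⟩ | ⟨q', hq', h1, h2, -, h3⟩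
      · contradiction
      · have hd0 : coord q' d = 0 := by rw [h3 d hne, hd]
        have := ih _ (by omega) hq' hd0 rfl
        have he := hD.isHeightOf hT ⟨foot v q', d'⟩ (IsInner.mem_edges_src (hP.isInner hT hq'))
        have ht : (⟨foot v q', d'⟩ : Edge).tgt = foot v q := by rw [h1, Edge.tgt_sub_step]
        have hw : (⟨foot v q' - step d, d⟩ : Edge) ∈ T := by
          rcases hP.compact.exists_pred hq' v d with ⟨-, h⟩ | ⟨_, _, _, _, h, _⟩
          · exact hP.walls_subset h
          · omega
        rw [ht, slope, if_neg (hT.notMem_of_mem_of_ne hne hw)] at he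
        simp only at he
        omega

/-- Below a cube that touches a base plane lies the surface of the tiling. -/
theorem lt_height (hD : AdmitsHeights D) (hT : IsTiling D T) (hP : FitsAt T v P)
    (hq : q ∈ P) {d : Fin 3} (hd : coord q d = 0) :
    height D T v + weight q - 1 < height D T (foot v q - step d) := by
  have h1 := hP.height_foot_of_coord hD hT hq hd
  have hw : (⟨foot v q - step d, d⟩ : Edge) ∈ T := by
    rcases hP.compact.exists_pred hq v d with ⟨-, h⟩ | ⟨_, _, _, _, h, _⟩
    · exact hP.walls_subset h
    · omega
  have := hD.height_sub_step hT d hw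
  omega

theorem mono (hP : FitsAt T v P) (h : P' ⊆ P) (hc : CompactPile P') : FitsAt T v P' :=
  ⟨hc, (walls_mono v h).trans hP.walls_subset⟩

theorem restsOn (hD : AdmitsHeights D) (hT : IsTiling D T) (hP : FitsAt T v P) :
    AdmitsHeights.RestsOn D T (P.image (cubeAt D T v)) := by
  refine ⟨fun c hc => ?_, fun c hc => ?_, fun c hc => ?_, fun c hc d => ?_⟩ <;>
    obtain ⟨q, hq, rfl⟩ := Finset.mem_image.1 hc <;> rw [cubeAt_eq]
  · exact hP.isInner hT hq
  · exact (hP.height_foot hD hT hq).1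
  · exact (hP.height_foot hD hT hq).2
  · rcases hP.compact.exists_pred hq v d with ⟨h, -⟩ | ⟨q', hq', h1, h2, -⟩
    · exact Or.inr (hP.lt_height hD hT hq h)
    · left
      refine Finset.mem_image.2 ⟨q', hq', ?_⟩
      rw [cubeAt_eq, h1, ← h2]
      push_cast
      simp only [Prod.mk.injEq, true_and]
      ring

/-- Going backwards in direction `d`, one stays on or above the surface for as many steps as the
coordinate, and the next step goes strictly below it. This number depends on the cube and on `T`
only, so it is the same for both piles. -/
theorem coord_eq (hD : AdmitsHeights D) (hT : IsTiling D T) (hP : FitsAt T v P)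
    (hP' : FitsAt T v' P') (hq : q ∈ P) (hq' : q' ∈ P')
    (h : cubeAt D T v q = cubeAt D T v' q') (d : Fin 3) : coord q d = coord q' d := by
  obtain ⟨n, hn⟩ : ∃ n, n = coord q d := ⟨_, rfl⟩
  induction n generalizing q q' with
  | zero =>
    rw [cubeAt_eq, cubeAt_eq, Prod.mk.injEq] at h
    rcases hP'.compact.exists_pred hq' v' d with ⟨h', -⟩ | ⟨r, hr, h1, h2, -⟩
    · omega
    · have a := hP.lt_height hD hT hq hn.symm
      have b := (hP'.height_foot hD hT hr).1
      rw [h1, ← h.1] at b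
      have := h.2
      omega
  | succ n ih =>
    rcases hP.compact.exists_pred hq v d with ⟨h', -⟩ | ⟨r, hr, h1, h2, h3, -⟩
    · omega
    rcases hP'.compact.exists_pred hq' v' d with ⟨h', -⟩ | ⟨r', hr', h1', h2', h3', -⟩
    · rw [cubeAt_eq, cubeAt_eq, Prod.mk.injEq] at h
      have a := hP'.lt_height hD hT hq' h'
      have b := (hP.height_foot hD hT hr).1
      rw [h1, h.1] at b
      have := h.2
      omega
    · have := ih hr hr' ?_ (by omega)
      · omega
      · rw [cubeAt_eq, cubeAt_eq, Prod.mk.injEq] at h ⊢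
        exact ⟨by rw [h1, h1', h.1], by have := h.2; omega⟩

/-- A cube that rests in some way on `T` determines the seed and its coordinates. -/
theorem eq_of_cubeAt_eq (hD : AdmitsHeights D) (hT : IsTiling D T) (hP : FitsAt T v P)
    (hP' : FitsAt T v' P') (hq : q ∈ P) (hq' : q' ∈ P')
    (h : cubeAt D T v q = cubeAt D T v' q') : v = v' ∧ q = q' := by
  have hqq : q = q' := coord_ext fun d => hP.coord_eq hD hT hP' hq hq' h d
  subst hqq
  rw [cubeAt_eq, cubeAt_eq, Prod.mk.injEq] at h
  exact ⟨foot_inj_left h.1, rfl⟩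

/-- Along each axis the pile has as many distinct walls as cubes, all of them in `T`. This shows
that the finite box in `rangePile` loses nothing. -/
theorem lt_card (hP : FitsAt T v P) (hq : q ∈ P) :
    q.1 < T.card + 1 ∧ q.2.1 < T.card + 1 ∧ q.2.2 < T.card + 1 := by
  obtain ⟨i, j, k⟩ := q
  have key : ∀ (n : ℕ) (f : ℕ → Edge), Function.Injective f → (∀ m ≤ n, f m ∈ walls v P) →
      n < T.card + 1 := by
    intro n f hf h
    have : ((Finset.range (n + 1)).image f).card ≤ T.card := Finset.card_le_card (by
      intro e he
      obtain ⟨m, hm, rfl⟩ := Finset.mem_image.1 he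
      exact hP.walls_subset (h m (by simpa [Nat.lt_succ_iff] using hm)))
    rw [Finset.card_image_of_injective _ hf, Finset.card_range] at this
    omega
  refine ⟨key i (fun m => ⟨proj v m 0 k - step 1, 1⟩) ?_ fun m hm =>
      mem_walls.2 ⟨_, (hP.compact _ _ _ hq).1 m hm, Or.inr (Or.inl rfl)⟩,
    key j (fun m => ⟨proj v 0 m k - step 0, 0⟩) ?_ fun m hm =>
      mem_walls.2 ⟨_, (hP.compact _ _ _ hq).2.1 m hm, Or.inl rfl⟩,
    key k (fun m => ⟨proj v 0 j m - step 0, 0⟩) ?_ fun m hm =>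
      mem_walls.2 ⟨_, (hP.compact _ _ _ hq).2.2 m hm, Or.inl rfl⟩⟩
  all_goals
    intro m n h
    simp [proj, step] at h
    exact h

end FitsAt

/-! ### Ranges of seeds -/

section Range

variable {D : Domain} {T : Finset Edge} {v w : Vertex} {q : ℕ × ℕ × ℕ}

theorem mem_rangePile : q ∈ rangePile T v ↔ ∃ P, FitsAt T v P ∧ q ∈ P := by
  simp only [rangePile, Finset.mem_filter, Finset.mem_product, Finset.mem_range]
  constructor
  · rintro ⟨-, P, h1, h2, h3⟩; exact ⟨P, ⟨h1, h3⟩, h2⟩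
  · rintro ⟨P, h1, h2⟩; exact ⟨h1.lt_card h2, P, h1.1, h2, h1.2⟩

/-- Compactness and the inclusion of the walls in `T` both pass to unions of piles, so the range is
itself a pile that fits. -/
theorem fitsAt_rangePile (T : Finset Edge) (v : Vertex) : FitsAt T v (rangePile T v) := by
  constructor
  · intro i j k h
    obtain ⟨P, hP, hq⟩ := mem_rangePile.1 h
    have := hP.compact i j k hq
    exact ⟨fun i' hi => mem_rangePile.2 ⟨P, hP, this.1 i' hi⟩,
      fun i' hi => mem_rangePile.2 ⟨P, hP, this.2.1 i' hi⟩,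
      fun i' hi => mem_rangePile.2 ⟨P, hP, this.2.2 i' hi⟩⟩
  · intro e he
    obtain ⟨q, hq, h⟩ := mem_walls.1 he
    obtain ⟨P, hP, hqP⟩ := mem_rangePile.1 hq
    exact hP.walls_subset (mem_walls.2 ⟨q, hqP, h⟩)

theorem IsSeed.zero_mem_rangePile (hs : IsSeed T v) : (0, 0, 0) ∈ rangePile T v := by
  refine mem_rangePile.2 ⟨{(0, 0, 0)}, ⟨?_, ?_⟩, Finset.mem_singleton_self _⟩
  · exact CompactPile.of_dec (by simp) (by simp) (by simp)
  · intro e he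
    have hv : proj v 0 0 0 = v := foot_zero v
    simp only [mem_walls, Finset.mem_singleton, exists_eq_left, hv] at he
    rcases he with rfl | rfl | rfl
    exacts [hs 0, hs 1, hs 2]

/-- The only seed inside a pseudo-hexagon with its minimal tiling is its origin. -/
theorem isProperSeed_iff (hT : IsTiling D T) : IsProperSeed T v ↔ IsSeed T v := by
  refine ⟨fun h => h.1, fun hs => ⟨hs, fun w _ hsub => ?_⟩⟩
  have hv : proj v 0 0 0 = v := foot_zero v
  -- The three lozenges at `v` lie in the region of `w`; a triangle belongs to one lozenge of `T`
  -- only, so they are walls of the range of `w`.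
  have key : ∀ d : Fin 3, (⟨v - step d, d⟩ : Edge) ∈ walls w (rangePile T w) := by
    intro d
    have hd : (⟨v - step d, d⟩ : Edge) ∈ walls v (rangePile T v) := by
      refine mem_walls.2 ⟨_, hs.zero_mem_rangePile, ?_⟩
      simp only [hv]
      fin_cases d <;> simp
    obtain ⟨t, ht⟩ := lozenge_nonempty ⟨v - step d, d⟩
    obtain ⟨f, hf, htf⟩ := Finset.mem_biUnion.1 (hsub (Finset.mem_biUnion.2 ⟨_, hd, ht⟩))
    have := hT.eq_of_mem (hs d) ((fitsAt_rangePile T w).walls_subset hf) (mem_lozenge.1 ht)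
      (mem_lozenge.1 htf)
    rwa [this]
  obtain ⟨q0, -, h0⟩ := mem_walls.1 (key 0)
  obtain ⟨q1, -, h1⟩ := mem_walls.1 (key 1)
  obtain ⟨q2, -, h2⟩ := mem_walls.1 (key 2)
  rcases v with ⟨x, y⟩
  rcases w with ⟨x', y'⟩
  -- Walls of direction `d` have zero coordinate along `d`. So `v - w` is a combination with natural
  -- coefficients of each pair of the three directions, which forces it to be 0.
  simp [proj, step] at h0 h1 h2 ⊢
  omega

theorem mem_properSeeds (hT : IsTiling D T) : v ∈ properSeeds D T ↔ IsSeed T v := by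
  simp only [properSeeds, Finset.mem_filter, isProperSeed_iff hT, and_iff_right_iff_imp]
  exact fun h => (h.isInner hT).mem_verts

/-- All the cubes of the ranges of the seeds of `T`. -/
noncomputable def rangeCubes (D : Domain) (T : Finset Edge) : Finset Cube :=
  (properSeeds D T).biUnion fun v => (rangePile T v).image (cubeAt D T v)

theorem restsOn_biUnion {ι : Type*} [DecidableEq ι] {s : Finset ι} {A : ι → Finset Cube}
    (h : ∀ i ∈ s, AdmitsHeights.RestsOn D T (A i)) :
    AdmitsHeights.RestsOn D T (s.biUnion A) := by
  refine ⟨fun c hc => ?_, fun c hc => ?_, fun c hc => ?_, fun c hc d => ?_⟩ <;>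
    obtain ⟨i, hi, hc⟩ := Finset.mem_biUnion.1 hc
  · exact (h i hi).inner c hc
  · exact (h i hi).le c hc
  · exact (h i hi).dvd c hc
  · exact ((h i hi).pred c hc d).imp_left fun h' => Finset.mem_biUnion.2 ⟨i, hi, h'⟩

theorem restsOn_rangeCubes (hD : AdmitsHeights D) (hT : IsTiling D T) :
    AdmitsHeights.RestsOn D T (rangeCubes D T) :=
  restsOn_biUnion fun v _ => (fitsAt_rangePile T v).restsOn hD hT

/-- The sets of cubes that can be added inside the ranges are the unions of fillings. -/
theorem restsOn_iff_fillings (hD : AdmitsHeights D) (hT : IsTiling D T) {C : Finset Cube} :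
    (C ⊆ rangeCubes D T ∧ AdmitsHeights.RestsOn D T C) ↔
      ∃ P : Vertex → Pile, (∀ v ∈ properSeeds D T, CompactPile (P v) ∧ P v ⊆ rangePile T v) ∧
        C = (properSeeds D T).biUnion fun v => (P v).image (cubeAt D T v) := by
  constructor
  · rintro ⟨hsub, hC⟩
    -- Inside a range a preceding cube lies on or above the surface, so the alternative of `RestsOn`
    -- that puts it below is excluded. The cubes of `C` in one range thus form a compact pile.
    have hstep : ∀ (v : Vertex) (d : Fin 3) (q q' : ℕ × ℕ × ℕ), q' ∈ rangePile T v →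
        foot v q - step d = foot v q' → weight q' + 1 = weight q →
        cubeAt D T v q ∈ C → cubeAt D T v q' ∈ C := by
      intro v d q q' hq' hf hw hc
      have := hC.pred _ hc d
      rw [cubeAt_eq] at this ⊢
      have hle := ((fitsAt_rangePile T v).height_foot hD hT hq').1
      have e : height D T v + (weight q : ℤ) - 1 = height D T v + weight q' := by
        rw [← hw]; push_cast; ring
      simp only [hf, e] at this
      exact this.resolve_right (not_lt.2 hle)
    refine ⟨fun v => (rangePile T v).filter fun q => cubeAt D T v q ∈ C,
      fun v _ => ⟨CompactPile.of_dec ?_ ?_ ?_, Finset.filter_subset _ _⟩, ?_⟩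
    · intro i j k h
      rw [Finset.mem_filter] at h ⊢
      have h' := ((fitsAt_rangePile T v).compact _ _ _ h.1).1 i (Nat.le_succ i)
      exact ⟨h', hstep v 0 _ _ h' (foot_succ_zero v i j k) (by simp only [weight]; omega) h.2⟩
    · intro i j k h
      rw [Finset.mem_filter] at h ⊢
      have h' := ((fitsAt_rangePile T v).compact _ _ _ h.1).2.1 j (Nat.le_succ j)
      exact ⟨h', hstep v 1 _ _ h' (foot_succ_one v i j k) (by simp only [weight]; omega) h.2⟩
    · intro i j k h
      rw [Finset.mem_filter] at h ⊢
      have h' := ((fitsAt_rangePile T v).compact _ _ _ h.1).2.2 k (Nat.le_succ k)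
      exact ⟨h', hstep v 2 _ _ h' (foot_succ_two v i j k) (by simp only [weight]; omega) h.2⟩
    · ext c
      simp only [Finset.mem_biUnion, Finset.mem_image, Finset.mem_filter]
      constructor
      · intro hc
        obtain ⟨v, hv, h⟩ := Finset.mem_biUnion.1 (hsub hc)
        obtain ⟨q, hq, rfl⟩ := Finset.mem_image.1 h
        exact ⟨v, hv, q, ⟨hq, hc⟩, rfl⟩
      · rintro ⟨v, -, q, ⟨-, hc⟩, rfl⟩
        exact hc
  · rintro ⟨P, hP, rfl⟩
    refine ⟨Finset.biUnion_mono fun v hv => Finset.image_subset_image (hP v hv).2,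
      restsOn_biUnion fun v hv => ?_⟩
    exact ((fitsAt_rangePile T v).mono (hP v hv).2 (hP v hv).1).restsOn hD hT

theorem cubeAt_injOn (hD : AdmitsHeights D) (hT : IsTiling D T) (v : Vertex) :
    Set.InjOn (cubeAt D T v) (rangePile T v) := fun _ hq _ hq' h =>
  ((fitsAt_rangePile T v).eq_of_cubeAt_eq hD hT (fitsAt_rangePile T v) hq hq' h).2

theorem disjoint_ranges (hD : AdmitsHeights D) (hT : IsTiling D T) (hne : v ≠ w) :
    Disjoint ((rangePile T v).image (cubeAt D T v)) ((rangePile T w).image (cubeAt D T w)) := by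
  rw [Finset.disjoint_left]
  intro c hc hc'
  obtain ⟨q, hq, rfl⟩ := Finset.mem_image.1 hc
  obtain ⟨q', hq', h⟩ := Finset.mem_image.1 hc'
  exact hne ((fitsAt_rangePile T v).eq_of_cubeAt_eq hD hT (fitsAt_rangePile T w) hq hq' h.symm).1

end Range

/-! ### The chain of the tilings `D^k` -/

namespace AdmitsHeights

variable {D : Domain}

theorem isTiling_stage (hD : AdmitsHeights D) (hne : ∃ T, IsTiling D T) (k : ℕ) :
    IsTiling D (stage D k) := by
  induction k with
  | zero => exact hD.isTiling_minTiling hne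
  | succ k ih => exact ((restsOn_rangeCubes hD ih).addCubes hD ih).1

theorem cubes_stage_succ (hD : AdmitsHeights D) (hne : ∃ T, IsTiling D T) (k : ℕ) :
    cubes D (stage D (k + 1)) = cubes D (stage D k) ∪ rangeCubes D (stage D k) :=
  ((restsOn_rangeCubes hD (hD.isTiling_stage hne k)).addCubes hD (hD.isTiling_stage hne k)).2

theorem stage_le_succ (hD : AdmitsHeights D) (hne : ∃ T, IsTiling D T) (k : ℕ) :
    TilingLE D (stage D k) (stage D (k + 1)) := by
  rw [← hD.cubes_subset_iff (hD.isTiling_stage hne k) (hD.isTiling_stage hne _),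
    hD.cubes_stage_succ hne]
  exact Finset.subset_union_left

/-- Below `Max(D)` there is a seed, and the cube resting directly on it is in its range but not yet
in the pile. -/
theorem stage_ssubset (hD : AdmitsHeights D) (hne : ∃ T, IsTiling D T) {k : ℕ}
    (hk : stage D k ≠ maxTiling D) : cubes D (stage D k) ⊂ cubes D (stage D (k + 1)) := by
  have hT := hD.isTiling_stage hne k
  obtain ⟨v, -, hs, -⟩ := hD.exists_seed_of_lt hT (hD.isTiling_maxTiling hne) (hD.le_maxTiling hT) hk
  rw [hD.cubes_stage_succ hne, Finset.ssubset_iff_of_subset Finset.subset_union_left]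
  refine ⟨(v, height D (stage D k) v), Finset.mem_union_right _ (Finset.mem_biUnion.2
    ⟨v, (mem_properSeeds hT).2 hs, Finset.mem_image.2 ⟨_, hs.zero_mem_rangePile, ?_⟩⟩),
    notMem_cubes_self⟩
  rw [cubeAt_eq, foot_zero]
  simp [weight]

/-- The degree is an `sInf`, meaningful only if some stage equals `Max(D)`. Otherwise the numbers of
cubes would increase strictly forever while staying bounded by that of `Max(D)`. -/
theorem stage_degree (hD : AdmitsHeights D) (hne : ∃ T, IsTiling D T) :
    stage D (degree D) = maxTiling D := by
  have : {n | stage D n = maxTiling D}.Nonempty := by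
    by_contra hn
    rw [Set.not_nonempty_iff_eq_empty, Set.eq_empty_iff_forall_notMem] at hn
    have hcard : ∀ n, n ≤ (cubes D (stage D n)).card := by
      intro n
      induction n with
      | zero => exact Nat.zero_le _
      | succ n ih =>
        have := Finset.card_lt_card (hD.stage_ssubset hne (hn n))
        omega
    have h1 := hcard ((cubes D (maxTiling D)).card + 1)
    have h2 := Finset.card_le_card ((hD.cubes_subset_iff (hD.isTiling_stage hne _)
      (hD.isTiling_maxTiling hne)).2 (hD.le_maxTiling
        (hD.isTiling_stage hne ((cubes D (maxTiling D)).card + 1))))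
    omega
  exact Nat.sInf_mem this

theorem stage_lt_succ (hD : AdmitsHeights D) (hne : ∃ T, IsTiling D T) {k : ℕ}
    (hk : k < degree D) : TilingLT D (stage D k) (stage D (k + 1)) := by
  have hk' : stage D k ≠ maxTiling D := Nat.notMem_of_lt_sInf hk
  refine ⟨hD.stage_le_succ hne k, fun h => ?_⟩
  have := hD.stage_ssubset hne hk'
  rw [← h] at this
  exact this.ne rfl

end AdmitsHeights

/-! ### Limited partitions -/

/-- `l` is a partition limited by `p`, written with the same number of (possibly zero) parts. -/
structure IsLimited (p l : List ℕ) : Prop where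
  length_eq : l.length = p.length
  le : ∀ i, l.getD i 0 ≤ p.getD i 0
  anti : ∀ i, l.getD (i + 1) 0 ≤ l.getD i 0

theorem isLimited_cons {p k : ℕ} {ps l : List ℕ} :
    IsLimited (p :: ps) (k :: l) ↔ k ≤ p ∧ IsLimited ps l ∧ l.getD 0 0 ≤ k := by
  constructor
  · rintro ⟨h1, h2, h3⟩
    exact ⟨by simpa using h2 0, ⟨by simpa using h1, fun i => by simpa using h2 (i + 1),
      fun i => by simpa using h3 (i + 1)⟩, by simpa using h3 0⟩
  · rintro ⟨h1, ⟨h2, h3, h4⟩, h5⟩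
    refine ⟨by simpa using h2, fun i => ?_, fun i => ?_⟩
    · rcases i with - | i
      · simpa using h1
      · simpa using h3 i
    · rcases i with - | i
      · simpa using h5
      · simpa using h4 i

theorem isLimited_nil_iff {l : List ℕ} : IsLimited [] l ↔ l = [] := by
  constructor
  · intro h; exact List.length_eq_zero_iff.1 h.length_eq
  · rintro rfl; exact ⟨rfl, by simp, by simp⟩

theorem IsLimited.exists_cons {p : ℕ} {ps l : List ℕ} (h : IsLimited (p :: ps) l) :
    ∃ k l', l = k :: l' := by
  cases l with
  | nil => simpa using h.length_eq
  | cons k l => exact ⟨k, l, rfl⟩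

/-- No part exceeds the first one, hence none exceeds `a`. It shows that the filter in the recursion
discards no valid first part. -/
theorem IsLimited.sum_le {ps l : List ℕ} {a : ℕ} (h : IsLimited ps l) (ha : l.getD 0 0 ≤ a) :
    l.sum ≤ (ps.map fun x => min x a).sum := by
  induction ps generalizing l a with
  | nil => rw [isLimited_nil_iff.1 h]; simp
  | cons p ps ih =>
    obtain ⟨k, l, rfl⟩ := h.exists_cons
    rw [isLimited_cons] at h
    have ha : k ≤ a := by simpa using ha
    have := ih h.2.1 (h.2.2.trans ha)
    simp only [List.sum_cons, List.map_cons]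
    have : k ≤ min p a := le_min h.1 ha
    omega

theorem IsLimited.sum_le_sum {ps l : List ℕ} (h : IsLimited ps l) : l.sum ≤ ps.sum := by
  refine (h.sum_le le_rfl).trans ?_
  conv_rhs => rw [← List.map_id ps]
  exact List.sum_le_sum fun x _ => min_le_left _ _

theorem isLimited_sum_zero_iff {ps l : List ℕ} :
    (IsLimited ps l ∧ l.sum = 0) ↔ l = List.replicate ps.length 0 := by
  constructor
  · rintro ⟨h, h0⟩
    rw [List.sum_eq_zero_iff] at h0
    exact List.eq_replicate_iff.2 ⟨h.length_eq, h0⟩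
  · rintro rfl
    exact ⟨⟨by simp, fun i => by simp, fun i => by simp⟩, by simp⟩

/-- The hypothesis on `t` is the invariant of the recursion, and the filter hands it on to the
recursive call. It also justifies the one-part case, which returns `t` without any test. -/
theorem mem_limitedPartitionsLoop {t a : ℕ} {ps l : List ℕ}
    (ht : t ≤ (ps.map fun x => min x a).sum) :
    l ∈ limitedPartitionsLoop t a ps ↔ IsLimited ps l ∧ l.getD 0 0 ≤ a ∧ l.sum = t := by
  induction ps generalizing t a l with
  | nil =>
    have : t = 0 := by simpa using ht
    subst this
    rw [limitedPartitionsLoop, if_pos rfl, isLimited_nil_iff, List.mem_singleton]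
    constructor
    · rintro rfl; simp
    · exact fun h => h.1
  | cons p ps ih =>
    rw [limitedPartitionsLoop]
    split_ifs with h0 h1
    · subst h0
      have := isLimited_sum_zero_iff (ps := p :: ps) (l := l)
      rw [List.mem_singleton, ← List.length_cons (a := p), ← this]
      constructor
      · rintro ⟨h, h'⟩
        refine ⟨h, ?_, h'⟩
        rw [this.1 ⟨h, h'⟩]
        simp
      · rintro ⟨h, -, h'⟩; exact ⟨h, h'⟩
    · rw [List.length_eq_zero_iff] at h1
      subst h1
      simp only [List.map_cons, List.map_nil, List.sum_cons, List.sum_nil, add_zero, le_min_iff] at ht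
      rw [List.mem_singleton]
      constructor
      · rintro rfl
        exact ⟨isLimited_cons.2 ⟨ht.1, isLimited_nil_iff.2 rfl, by simp⟩, by simpa using ht.2, by simp⟩
      · rintro ⟨h, -, hs⟩
        obtain ⟨k, l, rfl⟩ := h.exists_cons
        obtain rfl := isLimited_nil_iff.1 (isLimited_cons.1 h).2.1
        simp only [List.sum_cons, List.sum_nil, add_zero] at hs
        rw [hs]
    · simp only [List.mem_flatMap, List.mem_filter, List.mem_reverse, List.mem_range'_1,
        List.mem_map, decide_eq_true_eq]
      constructor
      · rintro ⟨k, ⟨⟨hk1, hk2⟩, hk3⟩, l', hl', rfl⟩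
        rw [ih (by omega)] at hl'
        obtain ⟨h2, h3, h4⟩ := hl'
        refine ⟨isLimited_cons.2 ⟨by omega, h2, h3⟩, by simp; omega, ?_⟩
        simp only [List.sum_cons]
        omega
      · rintro ⟨h, ha, hs⟩
        obtain ⟨k, l, rfl⟩ := h.exists_cons
        rw [isLimited_cons] at h
        have ha : k ≤ a := by simpa using ha
        simp only [List.sum_cons] at hs
        have hb := h.2.1.sum_le h.2.2
        -- The range of first parts starts at 1: a first part 0 would force all parts to be 0, while
        -- `t` is positive here.
        have hk : 1 ≤ k := by
          by_contra hk
          have : k = 0 := by omega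
          subst this
          simp only [Nat.min_zero, List.map_const', List.sum_replicate, smul_zero] at hb
          omega
        exact ⟨k, ⟨⟨hk, by omega⟩, by omega⟩, l, (ih (by omega)).2 ⟨h.2.1, h.2.2, by omega⟩, rfl⟩

theorem nodup_limitedPartitionsLoop (t a : ℕ) (ps : List ℕ) :
    (limitedPartitionsLoop t a ps).Nodup := by
  induction ps generalizing t a with
  | nil => rw [limitedPartitionsLoop]; split_ifs <;> simp
  | cons p ps ih =>
    rw [limitedPartitionsLoop]
    split_ifs
    · simp
    · simp
    · rw [List.nodup_flatMap]
      refine ⟨fun k _ => (ih _ _).map fun l l' h => (List.cons.inj h).2, ?_⟩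
      refine List.Pairwise.imp ?_ ((List.nodup_reverse.2 List.nodup_range').filter _)
      intro k k' hne l hl hl'
      obtain ⟨m, -, rfl⟩ := List.mem_map.1 hl
      obtain ⟨m', -, h⟩ := List.mem_map.1 hl'
      exact hne (List.cons.inj h).1.symm

/-- The initial bound `s` on the parts is no restriction: one part that large suffices, and
otherwise no part is truncated. -/
theorem le_sum_min {s : ℕ} {p : List ℕ} (h : s ≤ p.sum) : s ≤ (p.map fun x => min x s).sum := by
  by_cases hx : ∃ x ∈ p, s ≤ x
  · obtain ⟨x, hx, hsx⟩ := hx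
    have := List.single_le_sum (l := p.map fun x => min x s) (by simp) _
      (List.mem_map.2 ⟨x, hx, rfl⟩)
    rwa [min_eq_right hsx] at this
  · push Not at hx
    rw [List.map_congr_left (g := id) fun x hxp => by simpa using (hx x hxp).le, List.map_id]
    exact h

theorem mem_limitedPartitions {s : ℕ} {p l : List ℕ} (h : s ≤ p.sum) :
    l ∈ limitedPartitions s p ↔ IsLimited p l ∧ l.sum = s := by
  rw [limitedPartitions, mem_limitedPartitionsLoop (le_sum_min h)]
  constructor
  · rintro ⟨h1, -, h2⟩; exact ⟨h1, h2⟩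
  · rintro ⟨h1, h2⟩
    refine ⟨h1, ?_, h2⟩
    cases l with
    | nil => simp
    | cons k l => simp at h2 ⊢; omega

/-! ### Limited plane partitions -/

/-- The entry of an array of numbers. -/
def entry (A : List (List ℕ)) (i j : ℕ) : ℕ := (A.getD i []).getD j 0

/-- `L` is a plane partition limited by the slices `Ps`, with first slice limited by `A`. -/
structure IsPlaneLimited (A : List ℕ) (Ps L : List (List ℕ)) : Prop where
  length_eq : L.length = Ps.length
  length_slice : ∀ i, (L.getD i []).length = (Ps.getD i []).length
  le : ∀ i j, entry L i j ≤ entry Ps i j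
  anti_right : ∀ i j, entry L i (j + 1) ≤ entry L i j
  anti_down : ∀ i j, entry L (i + 1) j ≤ entry L i j
  le_first : ∀ j, entry L 0 j ≤ A.getD j 0

/-- The lengths of the slices decrease, starting from `n`. -/
def DecreasingShape (n : ℕ) : List (List ℕ) → Prop
  | [] => True
  | P :: Ps => P.length ≤ n ∧ DecreasingShape P.length Ps

theorem getD_zipWith_min (A P : List ℕ) (j : ℕ) :
    (List.zipWith min A P).getD j 0 = min (A.getD j 0) (P.getD j 0) := by
  induction A generalizing P j with
  | nil => simp
  | cons a A ih =>
    cases P with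
    | nil => simp
    | cons p P =>
      cases j with
      | zero => simp
      | succ j => simpa using ih P j

theorem sum_zipWith_min_mono {k A Q : List ℕ} (h : ∀ j, k.getD j 0 ≤ A.getD j 0) :
    (List.zipWith min k Q).sum ≤ (List.zipWith min A Q).sum := by
  induction Q generalizing k A with
  | nil => simp
  | cons q Q ih =>
    cases k with
    | nil => simp
    | cons x k =>
      have hx := h 0
      have hk : ∀ j, k.getD j 0 ≤ A.tail.getD j 0 := by
        intro j
        have := h (j + 1)
        cases A <;> simpa using this
      have := ih hk
      cases A with
      | nil => simp at hx this ⊢; exact ⟨Or.inl hx, this⟩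
      | cons a A =>
        simp at hx this ⊢
        omega

theorem isPlaneLimited_nil_iff {A : List ℕ} {L : List (List ℕ)} :
    IsPlaneLimited A [] L ↔ L = [] := by
  constructor
  · intro h; exact List.length_eq_zero_iff.1 h.length_eq
  · rintro rfl
    exact ⟨rfl, by simp, by simp [entry], by simp [entry], by simp [entry], by simp [entry]⟩

theorem IsPlaneLimited.exists_cons {A : List ℕ} {P : List ℕ} {Ps L : List (List ℕ)}
    (h : IsPlaneLimited A (P :: Ps) L) : ∃ k L', L = k :: L' := by
  cases L with
  | nil => simpa using h.length_eq
  | cons k L => exact ⟨k, L, rfl⟩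

theorem entry_cons_zero (k : List ℕ) (L : List (List ℕ)) (j : ℕ) :
    entry (k :: L) 0 j = k.getD j 0 := by simp [entry]

theorem entry_cons_succ (k : List ℕ) (L : List (List ℕ)) (i j : ℕ) :
    entry (k :: L) (i + 1) j = entry L i j := by simp [entry]

/-- The first slice is limited both by the previous slice and by its own limit, and then limits the
next one. The inequality of lengths keeps `zipWith` from cutting `P` short. -/
theorem isPlaneLimited_cons {A P k : List ℕ} {Ps L : List (List ℕ)} (hA : P.length ≤ A.length) :
    IsPlaneLimited A (P :: Ps) (k :: L) ↔
      IsLimited (List.zipWith min A P) k ∧ IsPlaneLimited k Ps L := by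
  constructor
  · rintro ⟨h1, h2, h3, h4, h5, h6⟩
    refine ⟨⟨?_, fun j => ?_, fun j => ?_⟩, ⟨?_, fun i => ?_, fun i j => ?_, fun i j => ?_,
      fun i j => ?_, fun j => ?_⟩⟩
    · have := h2 0
      simp only [List.getD_cons_zero] at this
      simp [this, hA]
    · rw [getD_zipWith_min, le_min_iff]
      have a := h6 j
      have b := h3 0 j
      simp only [entry_cons_zero] at a b
      exact ⟨a, b⟩
    · simpa only [entry_cons_zero] using h4 0 j
    · simpa using h1
    · simpa only [List.getD_cons_succ] using h2 (i + 1)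
    · simpa only [entry_cons_succ] using h3 (i + 1) j
    · simpa only [entry_cons_succ] using h4 (i + 1) j
    · simpa only [entry_cons_succ] using h5 (i + 1) j
    · simpa only [entry_cons_succ, entry_cons_zero] using h5 0 j
  · rintro ⟨⟨h1, h2, h3⟩, ⟨g1, g2, g3, g4, g5, g6⟩⟩
    simp only [getD_zipWith_min, le_min_iff] at h2
    refine ⟨by simpa using g1, fun i => ?_, fun i j => ?_, fun i j => ?_, fun i j => ?_, fun j => ?_⟩
    · rcases i with - | i
      · simpa [hA] using h1
      · simpa only [List.getD_cons_succ] using g2 i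
    · rcases i with - | i
      · simpa only [entry_cons_zero] using (h2 j).2
      · simpa only [entry_cons_succ] using g3 i j
    · rcases i with - | i
      · simpa only [entry_cons_zero] using h3 j
      · simpa only [entry_cons_succ] using g4 i j
    · rcases i with - | i
      · simpa only [entry_cons_zero, entry_cons_succ] using g6 j
      · simpa only [entry_cons_succ] using g5 i j
    · simpa only [entry_cons_zero] using (h2 j).1

theorem IsPlaneLimited.sum_le {A : List ℕ} {Ps L : List (List ℕ)}
    (hs : DecreasingShape A.length Ps) (h : IsPlaneLimited A Ps L) :
    (L.map List.sum).sum ≤ (Ps.map fun Q => (List.zipWith min A Q).sum).sum := by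
  induction Ps generalizing A L with
  | nil => rw [isPlaneLimited_nil_iff.1 h]; simp
  | cons P Ps ih =>
    obtain ⟨k, L, rfl⟩ := h.exists_cons
    rw [isPlaneLimited_cons hs.1] at h
    have hk : k.length = P.length := by
      rw [h.1.length_eq, List.length_zipWith, min_eq_right hs.1]
    have h1 := ih (hk ▸ hs.2) h.2
    have h2 := h.1.sum_le_sum
    have h3 : (Ps.map fun Q => (List.zipWith min k Q).sum).sum ≤
        (Ps.map fun Q => (List.zipWith min A Q).sum).sum := by
      refine List.sum_le_sum fun Q _ => sum_zipWith_min_mono fun j => ?_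
      have := h.1.le j
      rw [getD_zipWith_min, le_min_iff] at this
      exact this.1
    simp only [List.map_cons, List.sum_cons]
    omega

theorem isPlaneLimited_sum_zero_iff {A : List ℕ} {Ps L : List (List ℕ)}
    (hs : DecreasingShape A.length Ps) : (IsPlaneLimited A Ps L ∧ (L.map List.sum).sum = 0) ↔
      L = Ps.map fun Q => List.replicate Q.length 0 := by
  induction Ps generalizing A L with
  | nil =>
    rw [isPlaneLimited_nil_iff, List.map_nil]
    exact ⟨fun h => h.1, fun h => ⟨h, by simp [h]⟩⟩
  | cons P Ps ih =>
    have hlen : (List.zipWith min A P).length = P.length := by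
      rw [List.length_zipWith, min_eq_right hs.1]
    constructor
    · rintro ⟨h, h0⟩
      obtain ⟨k, L, rfl⟩ := h.exists_cons
      rw [isPlaneLimited_cons hs.1] at h
      simp only [List.map_cons, List.sum_cons] at h0 ⊢
      have hk := isLimited_sum_zero_iff.1 ⟨h.1, (by omega : k.sum = 0)⟩
      rw [hlen] at hk
      rw [(ih (by rw [hk, List.length_replicate]; exact hs.2)).1 ⟨h.2, by omega⟩, hk]
    · rintro rfl
      have h1 := (isLimited_sum_zero_iff (ps := List.zipWith min A P)).2 (by rw [hlen])
      have h2 := (ih (A := List.replicate P.length 0) (by rw [List.length_replicate]; exact hs.2)).2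
        rfl
      refine ⟨?_, ?_⟩
      · rw [List.map_cons, isPlaneLimited_cons hs.1]
        exact ⟨h1.1, h2.1⟩
      · rw [List.map_cons, List.map_cons, List.sum_cons, h1.2, h2.2]

/-- As for partitions, the bound on `t` is an invariant kept up by the filter, and
`IsPlaneLimited.sum_le` shows that no valid slice is lost. The shape condition passes on because
each generated slice has the length of its limit. -/
theorem mem_limitedPlanePartitionsLoop {t : ℕ} {A : List ℕ} {Ps L : List (List ℕ)}
    (hs : DecreasingShape A.length Ps)
    (ht : t ≤ (Ps.map fun Q => (List.zipWith min A Q).sum).sum) :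
    L ∈ limitedPlanePartitionsLoop t A Ps ↔ IsPlaneLimited A Ps L ∧ (L.map List.sum).sum = t := by
  induction Ps generalizing t A L with
  | nil =>
    have : t = 0 := by simpa using ht
    subst this
    rw [limitedPlanePartitionsLoop, if_pos rfl, isPlaneLimited_nil_iff, List.mem_singleton]
    exact ⟨fun h => ⟨h, by simp [h]⟩, fun h => h.1⟩
  | cons P Ps ih =>
    have hlen : ∀ k, IsLimited (List.zipWith min A P) k → k.length = P.length := fun k hk => by
      rw [hk.length_eq, List.length_zipWith, min_eq_right hs.1]
    simp only [List.map_cons, List.sum_cons] at ht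
    rw [limitedPlanePartitionsLoop]
    split_ifs with h0 h1
    · subst h0
      rw [List.mem_singleton, isPlaneLimited_sum_zero_iff hs]
    · rw [List.length_eq_zero_iff] at h1
      subst h1
      simp only [List.map_nil, List.sum_nil, add_zero] at ht
      simp only [List.mem_map, mem_limitedPartitions ht]
      constructor
      · rintro ⟨k, ⟨hk, rfl⟩, rfl⟩
        exact ⟨(isPlaneLimited_cons hs.1).2 ⟨hk, isPlaneLimited_nil_iff.2 rfl⟩, by simp⟩
      · rintro ⟨h, hsum⟩
        obtain ⟨k, L, rfl⟩ := h.exists_cons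
        rw [isPlaneLimited_cons hs.1, isPlaneLimited_nil_iff] at h
        obtain ⟨hk, rfl⟩ := h
        exact ⟨k, ⟨hk, by simpa using hsum⟩, rfl⟩
    · simp only [List.mem_flatMap, List.mem_filter, List.mem_range, List.mem_map,
        decide_eq_true_eq]
      constructor
      · rintro ⟨k, ⟨⟨u, hu, hk⟩, hk3⟩, L', hL', rfl⟩
        rw [mem_limitedPartitions (by omega)] at hk
        rw [ih (hlen k hk.1 ▸ hs.2) (by omega)] at hL'
        refine ⟨(isPlaneLimited_cons hs.1).2 ⟨hk.1, hL'.1⟩, ?_⟩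
        simp only [List.map_cons, List.sum_cons, hL'.2]
        have := hk.2
        omega
      · rintro ⟨h, hsum⟩
        obtain ⟨k, L, rfl⟩ := h.exists_cons
        rw [isPlaneLimited_cons hs.1] at h
        simp only [List.map_cons, List.sum_cons] at hsum
        have hb := h.2.sum_le (hlen k h.1 ▸ hs.2)
        have hk := h.1.sum_le_sum
        exact ⟨k, ⟨⟨k.sum, by omega, (mem_limitedPartitions hk).2 ⟨h.1, rfl⟩⟩, by omega⟩, L,
          (ih (hlen k h.1 ▸ hs.2) (by omega)).2 ⟨h.2, by omega⟩, rfl⟩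

theorem nodup_limitedPlanePartitionsLoop (t : ℕ) (A : List ℕ) (Ps : List (List ℕ)) :
    (limitedPlanePartitionsLoop t A Ps).Nodup := by
  induction Ps generalizing t A with
  | nil => rw [limitedPlanePartitionsLoop]; split_ifs <;> simp
  | cons P Ps ih =>
    rw [limitedPlanePartitionsLoop]
    split_ifs
    · simp
    · exact (nodup_limitedPartitionsLoop _ _ _).map fun l l' h => (List.cons.inj h).1
    · rw [List.nodup_flatMap]
      refine ⟨fun k _ => (ih _ _).map fun l l' h => (List.cons.inj h).2, ?_⟩
      refine List.Pairwise.imp ?_ (List.Nodup.filter _ (List.nodup_flatMap.2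
        ⟨fun u _ => nodup_limitedPartitionsLoop _ _ _, ?_⟩))
      · intro k k' hne l hl hl'
        obtain ⟨m, -, rfl⟩ := List.mem_map.1 hl
        obtain ⟨m', -, h⟩ := List.mem_map.1 hl'
        exact hne (List.cons.inj h).1.symm
      · refine List.Pairwise.imp_of_mem ?_ List.nodup_range
        intro u u' hu hu' hne k hk hk'
        rw [List.mem_range] at hu hu'
        rw [mem_limitedPartitions (by omega)] at hk hk'
        exact hne (hk.2.symm.trans hk'.2)

/-! ### Fillings of a compact pile -/

/-- An initial segment of an injective sequence is determined by its cardinality. This turns the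
rows and columns of a compact pile into numbers. -/
theorem mem_iff_lt_card {α : Type*} [DecidableEq α] {f : ℕ → α} (hf : Function.Injective f)
    {S : Finset α} (hS : ∀ x ∈ S, ∃ m, x = f m) (hdown : ∀ m, ∀ m' ≤ m, f m ∈ S → f m' ∈ S)
    (m : ℕ) : f m ∈ S ↔ m < S.card := by
  constructor
  · intro h
    have : ((Finset.range (m + 1)).image f).card ≤ S.card := Finset.card_le_card (by
      intro x hx
      obtain ⟨m', hm', rfl⟩ := Finset.mem_image.1 hx
      exact hdown m m' (by simpa [Nat.lt_succ_iff] using hm') h)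
    rw [Finset.card_image_of_injective _ hf, Finset.card_range] at this
    omega
  · intro h
    by_contra hn
    have : S.card ≤ ((Finset.range m).image f).card := Finset.card_le_card (by
      intro x hx
      obtain ⟨m', rfl⟩ := hS x hx
      refine Finset.mem_image.2 ⟨m', Finset.mem_range.2 ?_, rfl⟩
      by_contra hle
      exact hn (hdown m' m (by omega) hx))
    rw [Finset.card_image_of_injective _ hf, Finset.card_range] at this
    omega

section Fillings

variable {P R : Pile}

theorem CompactPile.mem_iff_column (hP : CompactPile P) (i j k : ℕ) :
    (i, j, k) ∈ P ↔ k < (P.filter fun q => q.1 = i ∧ q.2.1 = j).card := by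
  rw [← mem_iff_lt_card (f := fun k => (i, j, k)) (fun a b h => by simpa using h)]
  · simp
  · rintro ⟨a, b, c⟩ h
    simp only [Finset.mem_filter] at h
    exact ⟨c, by rw [h.2.1, h.2.2]⟩
  · intro m m' hm h
    simp only [Finset.mem_filter, and_true] at h ⊢
    exact (hP _ _ _ h).2.2 m' hm

theorem CompactPile.mem_iff_row (hP : CompactPile P) (i j : ℕ) :
    (i, j, 0) ∈ P ↔ j < (P.filter fun q => q.1 = i ∧ q.2.2 = 0).card := by
  rw [← mem_iff_lt_card (f := fun j => (i, j, 0)) (fun a b h => by simpa using h)]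
  · simp
  · rintro ⟨a, b, c⟩ h
    simp only [Finset.mem_filter] at h
    exact ⟨b, by rw [h.2.1, h.2.2]⟩
  · intro m m' hm h
    simp only [Finset.mem_filter, and_true] at h ⊢
    exact (hP _ _ _ h).2.1 m' hm

theorem CompactPile.mem_iff_slice (hP : CompactPile P) (i : ℕ) :
    (i, 0, 0) ∈ P ↔ i < (P.filter fun q => q.2.1 = 0 ∧ q.2.2 = 0).card := by
  rw [← mem_iff_lt_card (f := fun i => (i, 0, 0)) (fun a b h => by simpa using h)]
  · simp
  · rintro ⟨a, b, c⟩ h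
    simp only [Finset.mem_filter] at h
    exact ⟨a, by rw [h.2.1, h.2.2]⟩
  · intro m m' hm h
    simp only [Finset.mem_filter, and_true] at h ⊢
    exact (hP _ _ _ h).1 m' hm

/-- The numbers of cubes in the columns of `P`, arranged as the plane partition of `R`. -/
def columns (R P : Pile) : List (List ℕ) :=
  (List.range (R.filter fun q => q.2.1 = 0 ∧ q.2.2 = 0).card).map fun i =>
    (List.range (R.filter fun q => q.1 = i ∧ q.2.2 = 0).card).map fun j =>
      (P.filter fun q => q.1 = i ∧ q.2.1 = j).card

theorem planePartition_eq (R : Pile) : planePartition R = columns R R := rfl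

theorem columns_getD (R P : Pile) (i : ℕ)
    (hi : i < (R.filter fun q => q.2.1 = 0 ∧ q.2.2 = 0).card) : (columns R P).getD i [] =
      (List.range (R.filter fun q => q.1 = i ∧ q.2.2 = 0).card).map fun j =>
        (P.filter fun q => q.1 = i ∧ q.2.1 = j).card := by
  rw [columns, List.getD_eq_getElem _ _ (by simpa using hi)]
  simp

theorem columns_getD_of_le (R P : Pile) (i : ℕ)
    (hi : ¬ i < (R.filter fun q => q.2.1 = 0 ∧ q.2.2 = 0).card) : (columns R P).getD i [] = [] := by
  rw [columns, List.getD_eq_default _ _ (by simpa using hi)]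

theorem entry_columns (hR : CompactPile R) (hP : CompactPile P) (h : P ⊆ R) (i j : ℕ) :
    entry (columns R P) i j = (P.filter fun q => q.1 = i ∧ q.2.1 = j).card := by
  by_cases hi : i < (R.filter fun q => q.2.1 = 0 ∧ q.2.2 = 0).card
  · rw [entry, columns_getD R P i hi]
    by_cases hj : j < (R.filter fun q => q.1 = i ∧ q.2.2 = 0).card
    · rw [List.getD_eq_getElem _ _ (by simpa using hj)]
      simp
    · rw [List.getD_eq_default _ _ (by simpa using hj)]
      by_contra hne
      have := h ((hP.mem_iff_column i j 0).2 (by omega))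
      exact hj ((hR.mem_iff_row i j).1 this)
  · rw [entry, columns_getD_of_le R P i hi, List.getD_nil]
    by_contra hne
    have := h ((hP.mem_iff_column i j 0).2 (by omega))
    exact hi ((hR.mem_iff_slice i).1 ((hR _ _ _ this).2.1 0 (Nat.zero_le _)))

theorem mem_pileOf {A : List (List ℕ)} {i j k : ℕ} : (i, j, k) ∈ pileOf A ↔ k < entry A i j := by
  simp only [pileOf, Finset.mem_biUnion, Finset.mem_range, Finset.mem_image, Prod.mk.injEq, entry]
  constructor
  · rintro ⟨i', -, j', -, k', hk, rfl, rfl, rfl⟩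
    exact hk
  · intro hk
    refine ⟨i, ?_, j, ?_, k, hk, rfl, rfl, rfl⟩
    · by_contra hi
      rw [List.getD_eq_default A _ (by omega)] at hk
      simp at hk
    · by_contra hj
      rw [List.getD_eq_default (A.getD i []) _ (by omega)] at hk
      simp at hk

theorem isPlaneLimited_columns (hR : CompactPile R) (hP : CompactPile P) (h : P ⊆ R) :
    IsPlaneLimited ((planePartition R).headD []) (planePartition R) (columns R P) := by
  have hle : ∀ {P Q : Pile}, CompactPile P → CompactPile Q → ∀ i j i' j',
      (∀ k, (i, j, k) ∈ P → (i', j', k) ∈ Q) →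
      (P.filter fun q => q.1 = i ∧ q.2.1 = j).card ≤
        (Q.filter fun q => q.1 = i' ∧ q.2.1 = j').card := by
    intro P Q hP hQ i j i' j' hk
    by_contra hlt
    have := hk _ ((hP.mem_iff_column i j _).2 (not_le.1 hlt))
    rw [hQ.mem_iff_column] at this
    omega
  have e0 : ∀ j, ((planePartition R).headD []).getD j 0 = entry (planePartition R) 0 j := by
    intro j
    rw [entry]
    cases planePartition R <;> simp
  refine ⟨?_, fun i => ?_, fun i j => ?_, fun i j => ?_, fun i j => ?_, fun j => ?_⟩
  · simp [planePartition_eq, columns]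
  · rw [planePartition_eq]
    by_cases hi : i < (R.filter fun q => q.2.1 = 0 ∧ q.2.2 = 0).card
    · rw [columns_getD _ _ _ hi, columns_getD _ _ _ hi]; simp
    · rw [columns_getD_of_le _ _ _ hi, columns_getD_of_le _ _ _ hi]
  · rw [planePartition_eq, entry_columns hR hP h, entry_columns hR hR (Finset.Subset.refl _)]
    exact hle hP hR _ _ _ _ fun k hk => h hk
  · rw [entry_columns hR hP h, entry_columns hR hP h]
    exact hle hP hP _ _ _ _ fun k hk => (hP _ _ _ hk).2.1 j (Nat.le_succ j)
  · rw [entry_columns hR hP h, entry_columns hR hP h]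
    exact hle hP hP _ _ _ _ fun k hk => (hP _ _ _ hk).1 i (Nat.le_succ i)
  · rw [e0, planePartition_eq, entry_columns hR hP h, entry_columns hR hR (Finset.Subset.refl _)]
    exact hle hP hR _ _ _ _ fun k hk => h hk

theorem decreasingShape_of_getD {L : List (List ℕ)} {n : ℕ} (h0 : (L.getD 0 []).length ≤ n)
    (h : ∀ i, (L.getD (i + 1) []).length ≤ (L.getD i []).length) : DecreasingShape n L := by
  induction L generalizing n with
  | nil => trivial
  | cons P Ps ih =>
    exact ⟨by simpa using h0, ih (by simpa using h 0) fun i => by simpa using h (i + 1)⟩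

theorem decreasingShape_planePartition (hR : CompactPile R) :
    DecreasingShape ((planePartition R).headD []).length (planePartition R) := by
  refine decreasingShape_of_getD (by cases planePartition R <;> simp) fun i => ?_
  rw [planePartition_eq]
  by_cases hi : i + 1 < (R.filter fun q => q.2.1 = 0 ∧ q.2.2 = 0).card
  · rw [columns_getD _ _ _ hi, columns_getD _ _ _ (by omega)]
    simp only [List.length_map, List.length_range]
    by_contra hlt
    have := (hR _ _ _ ((hR.mem_iff_row (i + 1) _).2 (not_le.1 hlt))).1 i (Nat.le_succ i)
    rw [hR.mem_iff_row] at this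
    omega
  · rw [columns_getD_of_le _ _ _ hi]
    simp

/-- The initial bound required by the recursion comes from `IsPlaneLimited.sum_le` applied to the
plane partition of `R`, which is limited by itself. -/
theorem mem_limitedPlanePartitions (hR : CompactPile R) {s : ℕ}
    (hs : s ≤ ((planePartition R).map List.sum).sum) {L : List (List ℕ)} :
    L ∈ limitedPlanePartitions s (planePartition R) ↔
      IsPlaneLimited ((planePartition R).headD []) (planePartition R) L ∧
        (L.map List.sum).sum = s := by
  rw [limitedPlanePartitions, mem_limitedPlanePartitionsLoop (decreasingShape_planePartition hR)]
  refine hs.trans (((isPlaneLimited_columns hR hR (Finset.Subset.refl _)).sum_le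
    (decreasingShape_planePartition hR)))

theorem mem_fillings (hR : CompactPile R) :
    P ∈ fillings R ↔ CompactPile P ∧ P ⊆ R := by
  simp only [fillings, List.mem_map, List.mem_flatMap, List.mem_range]
  constructor
  · rintro ⟨L, ⟨s, hs, hL⟩, rfl⟩
    rw [mem_limitedPlanePartitions hR (by omega)] at hL
    refine ⟨CompactPile.of_dec ?_ ?_ ?_, ?_⟩
    · intro i j k; rw [mem_pileOf, mem_pileOf]; exact fun h => h.trans_le (hL.1.anti_down i j)
    · intro i j k; rw [mem_pileOf, mem_pileOf]; exact fun h => h.trans_le (hL.1.anti_right i j)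
    · intro i j k; rw [mem_pileOf, mem_pileOf]; omega
    · rintro ⟨i, j, k⟩ h
      rw [mem_pileOf] at h
      have := h.trans_le (hL.1.le i j)
      rwa [planePartition_eq, entry_columns hR hR (Finset.Subset.refl _),
        ← hR.mem_iff_column] at this
  · rintro ⟨hP, h⟩
    have hlim := isPlaneLimited_columns hR hP h
    have hsum : ((columns R P).map List.sum).sum ≤ ((planePartition R).map List.sum).sum := by
      refine (hlim.sum_le (decreasingShape_planePartition hR)).trans
        (List.sum_le_sum fun Q _ => ?_)
      have : ∀ A Q : List ℕ, (List.zipWith min A Q).sum ≤ Q.sum := by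
        intro A Q
        induction Q generalizing A with
        | nil => simp
        | cons q Q ih =>
          cases A with
          | nil => simp
          | cons a A => simp; have := ih A; omega
      exact this _ _
    refine ⟨columns R P, ⟨_, Nat.lt_succ_of_le hsum,
      (mem_limitedPlanePartitions hR hsum).2 ⟨hlim, rfl⟩⟩, ?_⟩
    ext ⟨i, j, k⟩
    rw [mem_pileOf, entry_columns hR hP h, ← hP.mem_iff_column]

/-- A pile records the entries but not the padding zeros; the prescribed lengths of the slices
settle the rest. -/
theorem IsPlaneLimited.eq_of_pileOf_eq {A : List ℕ} {Ps L L' : List (List ℕ)}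
    (h : IsPlaneLimited A Ps L) (h' : IsPlaneLimited A Ps L') (heq : pileOf L = pileOf L') :
    L = L' := by
  have hentry : ∀ i j, entry L i j = entry L' i j := by
    intro i j
    by_contra hne
    rcases Nat.lt_or_gt_of_ne hne with hlt | hlt
    · have := mem_pileOf.2 hlt
      rw [← heq, mem_pileOf] at this
      omega
    · have := mem_pileOf.2 hlt
      rw [heq, mem_pileOf] at this
      omega
  refine List.ext_getElem (h.length_eq.trans h'.length_eq.symm) fun i hi hi' => ?_
  have e : ∀ (M : List (List ℕ)) (hi : i < M.length), M[i] = M.getD i [] := fun M hi =>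
    (List.getD_eq_getElem _ _ hi).symm
  rw [e L hi, e L' hi']
  refine List.ext_getElem ((h.length_slice i).trans (h'.length_slice i).symm) fun j hj hj' => ?_
  have := hentry i j
  rwa [entry, entry, List.getD_eq_getElem _ _ hj, List.getD_eq_getElem _ _ hj'] at this

theorem nodup_fillings (hR : CompactPile R) : (fillings R).Nodup := by
  refine List.Nodup.map_on ?_ (List.nodup_flatMap.2
    ⟨fun s _ => nodup_limitedPlanePartitionsLoop _ _ _, ?_⟩)
  · intro L hL L' hL' heq
    simp only [List.mem_flatMap, List.mem_range] at hL hL'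
    obtain ⟨s, hs, hL⟩ := hL
    obtain ⟨s', hs', hL'⟩ := hL'
    rw [mem_limitedPlanePartitions hR (by omega)] at hL hL'
    exact hL.1.eq_of_pileOf_eq hL'.1 heq
  · refine List.Pairwise.imp_of_mem ?_ List.nodup_range
    intro s s' hs hs' hne L hL hL'
    rw [List.mem_range] at hs hs'
    rw [mem_limitedPlanePartitions hR (by omega)] at hL hL'
    exact hne (hL.2.symm.trans hL'.2)

end Fillings

/-! ### Products of lists of sets -/

section UnionProd

variable {ι α : Type*} [DecidableEq α]

/-- The unions of one set from each of the lists `G i`, for `i` in `l`. -/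
def unionProd (G : ι → List (Finset α)) (l : List ι) : List (Finset α) :=
  l.foldr (fun i acc => (G i).flatMap fun A => acc.map fun C => A ∪ C) [∅]

theorem unionProd_cons (G : ι → List (Finset α)) (i : ι) (l : List ι) :
    unionProd G (i :: l) = (G i).flatMap fun A => (unionProd G l).map fun C => A ∪ C := rfl

theorem biUnion_update_of_notMem [DecidableEq ι] {i : ι} {s : Finset ι} (hi : i ∉ s)
    (A : ι → Finset α) (a : Finset α) : s.biUnion (Function.update A i a) = s.biUnion A :=
  Finset.biUnion_congr rfl fun j hj =>
    Function.update_of_ne (by rintro rfl; exact hi hj) _ _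

theorem mem_unionProd [DecidableEq ι] {G : ι → List (Finset α)} {l : List ι} (hl : l.Nodup)
    {C : Finset α} : C ∈ unionProd G l ↔
      ∃ A : ι → Finset α, (∀ i ∈ l, A i ∈ G i) ∧ C = l.toFinset.biUnion A := by
  induction l generalizing C with
  | nil => simp [unionProd]
  | cons i l ih =>
    rw [List.nodup_cons] at hl
    have hi : i ∉ l.toFinset := by simpa using hl.1
    simp only [unionProd_cons, List.mem_flatMap, List.mem_map, ih hl.2]
    constructor
    · rintro ⟨a, ha, C', ⟨A, hA, rfl⟩, rfl⟩
      refine ⟨Function.update A i a, ?_, ?_⟩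
      · intro j hj
        rcases List.mem_cons.1 hj with rfl | hjl
        · rwa [Function.update_self]
        · rw [Function.update_of_ne (by rintro rfl; exact hl.1 hjl)]
          exact hA j hjl
      · rw [List.toFinset_cons, Finset.biUnion_insert, Function.update_self,
          biUnion_update_of_notMem hi]
    · rintro ⟨A, hA, rfl⟩
      exact ⟨A i, hA i List.mem_cons_self, _,
        ⟨A, fun j hj => hA j (List.mem_cons_of_mem _ hj), rfl⟩,
        by rw [List.toFinset_cons, Finset.biUnion_insert]⟩

theorem union_inj_of_disjoint {U V : Set α} (h : Disjoint U V) {S S' T T' : Finset α}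
    (hS : (S : Set α) ⊆ U) (hS' : (S' : Set α) ⊆ U) (hT : (T : Set α) ⊆ V)
    (hT' : (T' : Set α) ⊆ V) (heq : S ∪ T = S' ∪ T') : S = S' ∧ T = T' := by
  have key : ∀ x, (x ∈ S ↔ x ∈ S') ∧ (x ∈ T ↔ x ∈ T') := by
    intro x
    have h1 := Finset.ext_iff.1 heq x
    rw [Finset.mem_union, Finset.mem_union] at h1
    have h2 : x ∈ U → x ∉ V := fun a b => Set.disjoint_left.1 h a b
    have := @hS x
    have := @hS' x
    have := @hT x
    have := @hT' x
    simp only [Finset.mem_coe] at *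
    tauto
  exact ⟨Finset.ext fun x => (key x).1, Finset.ext fun x => (key x).2⟩

theorem nodup_flatMap_union {U V : Set α} (h : Disjoint U V) {X Y : List (Finset α)}
    (hX : X.Nodup) (hY : Y.Nodup) (hXU : ∀ S ∈ X, (S : Set α) ⊆ U)
    (hYV : ∀ T ∈ Y, (T : Set α) ⊆ V) : (X.flatMap fun S => Y.map fun T => S ∪ T).Nodup := by
  rw [List.nodup_flatMap]
  constructor
  · intro S hS
    refine List.Nodup.map_on ?_ hY
    intro T hT T' hT' heq
    exact (union_inj_of_disjoint h (hXU S hS) (hXU S hS) (hYV T hT) (hYV T' hT') heq).2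
  · refine List.Pairwise.imp_of_mem ?_ hX
    intro S S' hS hS' hne x hx hx'
    obtain ⟨T, hT, rfl⟩ := List.mem_map.1 hx
    obtain ⟨T', hT', heq⟩ := List.mem_map.1 hx'
    exact hne (union_inj_of_disjoint h (hXU S hS) (hXU S' hS') (hYV T hT) (hYV T' hT') heq.symm).1

/-- When the pieces live in disjoint regions, a union determines each of its pieces. -/
theorem nodup_unionProd [DecidableEq ι] {G : ι → List (Finset α)} {l : List ι} (hl : l.Nodup)
    (U : ι → Set α) (hU : ∀ i ∈ l, ∀ j ∈ l, i ≠ j → Disjoint (U i) (U j))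
    (hGU : ∀ i ∈ l, ∀ A ∈ G i, (A : Set α) ⊆ U i) (hG : ∀ i ∈ l, (G i).Nodup) :
    (unionProd G l).Nodup := by
  induction l with
  | nil => simp [unionProd]
  | cons i l ih =>
    rw [List.nodup_cons] at hl
    have hm : ∀ j ∈ l, j ∈ i :: l := fun j hj => List.mem_cons_of_mem _ hj
    rw [unionProd_cons]
    refine nodup_flatMap_union (U := U i) (V := ⋃ j ∈ l, U j) ?_ (hG i List.mem_cons_self)
      (ih hl.2 (fun j hj k hk => hU j (hm j hj) k (hm k hk)) (fun j hj => hGU j (hm j hj))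
        fun j hj => hG j (hm j hj)) (hGU i List.mem_cons_self) ?_
    · simp only [Set.disjoint_iUnion_right]
      exact fun j hj => hU i List.mem_cons_self j (hm j hj) (by rintro rfl; exact hl.1 hj)
    · intro C hC
      obtain ⟨A, hA, rfl⟩ := (mem_unionProd hl.2).1 hC
      intro x hx
      obtain ⟨j, hj, hxj⟩ := Finset.mem_biUnion.1 (Finset.mem_coe.1 hx)
      rw [List.mem_toFinset] at hj
      exact Set.mem_iUnion₂.2 ⟨j, hj, hGU j (hm j hj) _ (hA j hj) hxj⟩

end UnionProd

/-! ### The tilings of a zone -/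

namespace AdmitsHeights

variable {D : Domain} {T t : Finset Edge} {C : Finset Cube} {k : ℕ}

theorem families_eq (D : Domain) (k : ℕ) : families D k =
    unionProd (fun v => (fillings (rangePile (stage D k) v)).map
      (Finset.image (cubeAt D (stage D k) v))) (properSeeds D (stage D k)).toList := by
  unfold families unionProd
  simp only [List.flatMap_map]

/-- This combines the enumeration of fillings with `restsOn_iff_fillings`: the generated families
are the sets of range cubes that can be added to `D^k`. -/
theorem mem_families (hD : AdmitsHeights D) (hne : ∃ T, IsTiling D T) :
    C ∈ families D k ↔ C ⊆ rangeCubes D (stage D k) ∧ RestsOn D (stage D k) C := by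
  rw [restsOn_iff_fillings hD (hD.isTiling_stage hne k), families_eq,
    mem_unionProd (Finset.nodup_toList _)]
  simp only [Finset.mem_toList, List.mem_map, Finset.toList_toFinset,
    mem_fillings (fitsAt_rangePile _ _).compact]
  constructor
  · rintro ⟨A, hA, rfl⟩
    choose! P hP using hA
    exact ⟨P, fun v hv => (hP v hv).1, Finset.biUnion_congr rfl fun v hv => (hP v hv).2.symm⟩
  · rintro ⟨P, hP, rfl⟩
    exact ⟨_, fun v hv => ⟨P v, hP v hv, rfl⟩, rfl⟩

theorem nodup_families (hD : AdmitsHeights D) (hne : ∃ T, IsTiling D T) (k : ℕ) :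
    (families D k).Nodup := by
  have hT := hD.isTiling_stage hne k
  rw [families_eq]
  refine nodup_unionProd (Finset.nodup_toList _)
    (fun v => ((rangePile (stage D k) v).image (cubeAt D (stage D k) v) : Finset Cube)) ?_ ?_ ?_
  · intro v _ w _ hvw
    exact Finset.disjoint_coe.2 (disjoint_ranges hD hT hvw)
  · intro v _ A hA
    obtain ⟨P, hP, rfl⟩ := List.mem_map.1 hA
    rw [mem_fillings (fitsAt_rangePile _ _).compact] at hP
    exact Finset.coe_subset.2 (Finset.image_subset_image hP.2)
  · intro v _
    refine List.Nodup.map_on ?_ (nodup_fillings (fitsAt_rangePile _ _).compact)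
    intro P hP P' hP' heq
    rw [mem_fillings (fitsAt_rangePile _ _).compact] at hP hP'
    have hinj := cubeAt_injOn hD hT v
    have key : ∀ {P P' : Pile}, P ⊆ rangePile (stage D k) v → P' ⊆ rangePile (stage D k) v →
        P.image (cubeAt D (stage D k) v) = P'.image (cubeAt D (stage D k) v) → P ⊆ P' := by
      intro P P' hP hP' heq q hq
      have := Finset.mem_image_of_mem (cubeAt D (stage D k) v) hq
      rw [heq] at this
      obtain ⟨q', hq', h⟩ := Finset.mem_image.1 this
      rwa [← hinj (hP' hq') (hP hq) h]
    exact (key hP.2 hP'.2 heq).antisymm (key hP'.2 hP.2 heq.symm)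

/-- The cube preceding a cube of `T` is either below the surface of `S`, or above it and then in `T`
because piles are downward closed. -/
theorem restsOn_sdiff (hD : AdmitsHeights D) {S : Finset Edge} (hS : IsTiling D S)
    (hT : IsTiling D T) : RestsOn D S (cubes D T \ cubes D S) := by
  have hmin := hD.isTiling_minTiling ⟨T, hT⟩
  have hle : ∀ c ∈ cubes D T \ cubes D S, height D S c.1 ≤ c.2 := by
    intro c hc
    rw [Finset.mem_sdiff] at hc
    by_contra hlt
    have := mem_cubes.1 hc.1
    exact hc.2 (mem_cubes.2 ⟨this.1, this.2.1, not_le.1 hlt, this.2.2.2⟩)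
  refine ⟨fun c hc => hD.isInner_of_mem_cubes hT (Finset.mem_sdiff.1 hc).1, hle,
    fun c hc => ?_, fun c hc d => ?_⟩
  · have h1 := mem_cubes.1 (Finset.mem_sdiff.1 hc).1
    have := hD.height_congr hS hmin h1.1
    omega
  · by_cases h : c.2 - 1 < height D S (c.1 - step d)
    · exact Or.inr h
    · left
      have hcT := (Finset.mem_sdiff.1 hc).1
      have hi := hD.isInner_of_mem_cubes hT hcT
      have h1 := hD.minTiling_le hS _ (src_mem_verts (hi.mem_edges_sub_step d))
      simp only at h1
      refine Finset.mem_sdiff.2 ⟨hD.pred_mem_cubes hT hcT d (by omega), fun h' => ?_⟩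
      have := mem_cubes.1 h'
      simp only at this
      omega

/-- The least tiling that contains a family of cubes. -/
theorem familyMinTiling_spec (hD : AdmitsHeights D) (hT : IsTiling D T) (hC : C ⊆ cubes D T) :
    IsTiling D (familyMinTiling D C) ∧ C ⊆ cubes D (familyMinTiling D C) ∧
      ∀ T', IsTiling D T' → C ⊆ cubes D T' → TilingLE D (familyMinTiling D C) T' := by
  have hmin := hD.isTiling_minTiling ⟨T, hT⟩
  have hne : ∀ c ∈ C, {T | IsTiling D T ∧ c ∈ cubes D T}.Nonempty := fun c hc => ⟨T, hT, hC hc⟩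
  have h1 : ∀ c ∈ C, IsTiling D (cubeMinTiling D c) := fun c hc =>
    hD.isTiling_infTiling (hne c hc) fun _ h => h.1
  have h2 : ∀ S ∈ insert (minTiling D) (cubeMinTiling D '' (C : Set Cube)), IsTiling D S := by
    rintro S (rfl | ⟨c, hc, rfl⟩)
    exacts [hmin, h1 c hc]
  have h3 : IsTiling D (familyMinTiling D C) :=
    hD.isTiling_supTiling ⟨_, Set.mem_insert _ _⟩ h2
  refine ⟨h3, fun c hc => ?_, fun T' hT' hCT' v hv => ?_⟩
  · have hle : TilingLE D (cubeMinTiling D c) (familyMinTiling D C) :=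
      hD.le_supTiling h2 (Set.mem_insert_of_mem _ ⟨c, hc, rfl⟩)
    have hmem := mem_cubes.1 (hC hc)
    obtain ⟨⟨S, hS, h⟩, -⟩ := (hD.infTiling_spec (hne c hc) fun _ h => h.1).2 c.1 hmem.1
    have hcS := mem_cubes.1 hS.2
    refine mem_cubes.2 ⟨hmem.1, hmem.2.1, lt_of_lt_of_le ?_ (hle c.1 hmem.1), hmem.2.2.2⟩
    rw [cubeMinTiling, ← h]
    exact hcS.2.2.1
  · obtain ⟨⟨S, hS, h⟩, -⟩ := (hD.supTiling_spec ⟨_, Set.mem_insert _ _⟩ h2).2 v hv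
    rw [familyMinTiling, ← h]
    rcases hS with rfl | ⟨c, hc, rfl⟩
    · exact hD.minTiling_le hT' v hv
    · exact hD.infTiling_le (fun _ h => h.1)
        (show T' ∈ {T | IsTiling D T ∧ c ∈ cubes D T} from ⟨hT', hCT' hc⟩) v hv

/-- Adding a family of cubes of order `k` to a tiling below `D^k` that contains what lies below
the family. -/
theorem addCubes_family (hD : AdmitsHeights D) (hne : ∃ T, IsTiling D T)
    (hC : C ∈ families D k) (ht : IsTiling D t)
    (hsub : cubes D (familyMinTiling D C) \ C ⊆ cubes D t) (hle : TilingLE D t (stage D k)) :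
    IsTiling D (addCubes D t C) ∧ cubes D (addCubes D t C) = cubes D t ∪ C := by
  have hS := hD.isTiling_stage hne k
  rw [hD.mem_families hne] at hC
  -- A tiling containing the family is needed for the infima defining `familyMinTiling` to be taken
  -- over non-empty sets.
  obtain ⟨W, hW, hWc⟩ := hC.2.exists_tiling hD hS
  obtain ⟨h1, h2, -⟩ := hD.familyMinTiling_spec hW (hWc ▸ Finset.subset_union_right)
  have h3 := hD.isTiling_supTiling_pair ht h1
  -- Everything in the least tiling containing `C`, apart from `C` itself, is already in `t`; so the
  -- supremum realizes `t + C`.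
  have h4 : cubes D (supTiling D {t, familyMinTiling D C}) = cubes D t ∪ C := by
    rw [hD.cubes_supTiling_pair ht h1]
    ext c
    have a := @hsub c
    have b := @h2 c
    simp only [Finset.mem_union, Finset.mem_sdiff] at a ⊢
    tauto
  have hdisj : Disjoint (cubes D t) C :=
    hC.2.disjoint.mono_left ((hD.cubes_subset_iff ht hS).2 hle)
  rw [hD.addCubes_eq ht h3 hdisj h4]
  exact ⟨h3, h4⟩

/-- Cutting along `D^k` recovers `t` and `C` from their sum, since `t` is below `D^k` and `C` above
it. This is what excludes repetitions. -/
theorem cubes_of_family (hD : AdmitsHeights D) (hne : ∃ T, IsTiling D T)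
    (hC : C ∈ families D k) (ht : IsTiling D t) (hle : TilingLE D t (stage D k)) :
    (cubes D t ∪ C) ∩ cubes D (stage D k) = cubes D t ∧
      (cubes D t ∪ C) \ cubes D (stage D k) = C := by
  have hS := hD.isTiling_stage hne k
  rw [hD.mem_families hne] at hC
  have hsub := (hD.cubes_subset_iff ht hS).2 hle
  have hdisj := hC.2.disjoint
  constructor <;>
  · ext c
    have a := @hsub c
    have b : c ∈ cubes D (stage D k) → c ∉ C := fun x y => Finset.disjoint_left.1 hdisj x y
    simp only [Finset.mem_inter, Finset.mem_union, Finset.mem_sdiff]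
    tauto

/-- The family of the cubes of `T` above `D^k`. -/
theorem sdiff_mem_families (hD : AdmitsHeights D) (hT : IsTiling D T)
    (hle : TilingLE D T (stage D (k + 1))) :
    cubes D T \ cubes D (stage D k) ∈ families D k := by
  have hne : ∃ T, IsTiling D T := ⟨T, hT⟩
  rw [hD.mem_families hne]
  refine ⟨?_, hD.restsOn_sdiff (hD.isTiling_stage hne k) hT⟩
  have h := (hD.cubes_subset_iff hT (hD.isTiling_stage hne _)).2 hle
  rw [hD.cubes_stage_succ hne] at h
  exact sdiff_le_iff.2 h

/-- A tiling below `D^(k+1)` is its infimum with `D^k` plus its cubes above `D^k`. Those cubes form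
a family of order `k`, non-empty exactly when the tiling is not below `D^k`. -/
theorem mem_newTilings_succ (hD : AdmitsHeights D) (hne : ∃ T, IsTiling D T)
    {L : List (Finset Edge)} (hk : k ≠ 0)
    (hL : ∀ T, T ∈ L ↔ IsTiling D T ∧ TilingLE D T (stage D k)) :
    T ∈ newTilings D k L ↔ IsTiling D T ∧ TilingLE D T (stage D (k + 1)) ∧
      ¬ TilingLE D T (stage D k) := by
  have hS := hD.isTiling_stage hne k
  have hS' := hD.isTiling_stage hne (k + 1)
  simp only [newTilings, if_neg hk, List.mem_flatMap, List.mem_filter, List.mem_map,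
    decide_eq_true_eq]
  constructor
  · rintro ⟨C, ⟨hC, hCne⟩, t, ⟨htL, hsub, hle⟩, rfl⟩
    have ht := ((hL t).1 htL).1
    obtain ⟨h1, h2⟩ := hD.addCubes_family hne hC ht hsub hle
    refine ⟨h1, ?_, ?_⟩
    · rw [← hD.cubes_subset_iff h1 hS', h2, hD.cubes_stage_succ hne]
      exact Finset.union_subset_union ((hD.cubes_subset_iff ht hS).2 hle)
        ((hD.mem_families hne).1 hC).1
    · rw [← hD.cubes_subset_iff h1 hS, h2]
      intro h
      refine hCne ?_
      rw [← (hD.cubes_of_family hne hC ht hle).2, Finset.sdiff_eq_empty_iff_subset]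
      exact h
  · rintro ⟨hT, hle, hnle⟩
    have hinf := hD.isTiling_infTiling_pair hT hS
    have hcinf := hD.cubes_infTiling_pair hT hS
    have hC := hD.sdiff_mem_families hT hle
    refine ⟨_, ⟨hC, ?_⟩, infTiling D {T, stage D k}, ⟨(hL _).2 ⟨hinf, ?_⟩, ?_, ?_⟩, ?_⟩
    · rwa [ne_eq, Finset.sdiff_eq_empty_iff_subset, hD.cubes_subset_iff hT hS]
    · rw [← hD.cubes_subset_iff hinf hS, hcinf]
      exact Finset.inter_subset_right
    -- `T` contains the family, hence the least tiling with that family. The cubes of this tiling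
    -- outside the family are thus cubes of `T`, and those must lie below `D^k`.
    · obtain ⟨h1, -, h2⟩ := hD.familyMinTiling_spec hT
        (C := cubes D T \ cubes D (stage D k)) Finset.sdiff_subset
      have h3 := (hD.cubes_subset_iff h1 hT).2 (h2 T hT Finset.sdiff_subset)
      rw [hcinf]
      intro c hc
      have := @h3 c
      simp only [Finset.mem_inter, Finset.mem_sdiff] at hc ⊢
      tauto
    · rw [← hD.cubes_subset_iff hinf hS, hcinf]
      exact Finset.inter_subset_right
    · refine hD.addCubes_eq hinf hT ?_ ?_
      · rw [hcinf]
        exact (Finset.disjoint_sdiff_inter _ _).symm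
      · rw [hcinf, Finset.union_comm, Finset.sdiff_union_inter]

theorem nodup_newTilings_succ (hD : AdmitsHeights D) (hne : ∃ T, IsTiling D T)
    {L : List (Finset Edge)} (hk : k ≠ 0) (hLn : L.Nodup)
    (hL : ∀ T, T ∈ L ↔ IsTiling D T ∧ TilingLE D T (stage D k)) : (newTilings D k L).Nodup := by
  classical
  simp only [newTilings, if_neg hk]
  rw [List.nodup_flatMap]
  constructor
  · intro C hC
    rw [List.mem_filter] at hC
    refine List.Nodup.map_on ?_ (hLn.filter _)
    intro t ht t' ht' heq
    simp only [List.mem_filter, decide_eq_true_eq] at ht ht'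
    have ht1 := ((hL t).1 ht.1).1
    have ht2 := ((hL t').1 ht'.1).1
    refine hD.cubes_injective ht1 ht2 ?_
    rw [← (hD.cubes_of_family hne hC.1 ht1 ht.2.2).1, ← (hD.cubes_of_family hne hC.1 ht2 ht'.2.2).1,
      ← (hD.addCubes_family hne hC.1 ht1 ht.2.1 ht.2.2).2,
      ← (hD.addCubes_family hne hC.1 ht2 ht'.2.1 ht'.2.2).2, heq]
  · refine List.Pairwise.imp_of_mem ?_ ((hD.nodup_families hne k).filter _)
    intro C C' hC hC' hCC T hT hT'
    obtain ⟨t, ht, rfl⟩ := List.mem_map.1 hT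
    obtain ⟨t', ht', heq⟩ := List.mem_map.1 hT'
    rw [List.mem_filter] at hC hC'
    simp only [List.mem_filter, decide_eq_true_eq] at ht ht'
    have ht1 := ((hL t).1 ht.1).1
    have ht2 := ((hL t').1 ht'.1).1
    refine hCC ?_
    rw [← (hD.cubes_of_family hne hC.1 ht1 ht.2.2).2, ← (hD.cubes_of_family hne hC'.1 ht2 ht'.2.2).2,
      ← (hD.addCubes_family hne hC.1 ht1 ht.2.1 ht.2.2).2,
      ← (hD.addCubes_family hne hC'.1 ht2 ht'.2.1 ht'.2.2).2, heq]

theorem mem_newTilings_zero (hD : AdmitsHeights D) (hne : ∃ T, IsTiling D T)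
    {L : List (Finset Edge)} :
    T ∈ newTilings D 0 L ↔ IsTiling D T ∧ TilingLE D T (stage D 1) := by
  have hS := hD.isTiling_stage hne 0
  have hS' := hD.isTiling_stage hne 1
  simp only [newTilings, if_true, List.mem_map]
  constructor
  · rintro ⟨C, hC, rfl⟩
    rw [hD.mem_families hne] at hC
    obtain ⟨h1, h2⟩ := hC.2.addCubes hD hS
    refine ⟨h1, ?_⟩
    rw [← hD.cubes_subset_iff h1 hS', h2, hD.cubes_stage_succ hne]
    exact Finset.union_subset_union_right hC.1
  · rintro ⟨hT, hle⟩
    refine ⟨_, hD.sdiff_mem_families hT hle, hD.addCubes_eq hS hT disjoint_sdiff_self_right ?_⟩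
    rw [Finset.union_sdiff_of_subset ((hD.cubes_subset_iff hS hT).2 (hD.minTiling_le hT))]

theorem nodup_newTilings_zero (hD : AdmitsHeights D) (hne : ∃ T, IsTiling D T)
    (L : List (Finset Edge)) : (newTilings D 0 L).Nodup := by
  have hS := hD.isTiling_stage hne 0
  simp only [newTilings, if_true]
  refine List.Nodup.map_on ?_ (hD.nodup_families hne 0)
  intro C hC C' hC' heq
  rw [← (hD.cubes_of_family hne hC hS (tilingLE_refl _ _)).2,
    ← (hD.cubes_of_family hne hC' hS (tilingLE_refl _ _)).2,
    ← (((hD.mem_families hne).1 hC).2.addCubes hD hS).2,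
    ← (((hD.mem_families hne).1 hC').2.addCubes hD hS).2, heq]

/-- After the order `n`, the list contains the tilings below `D^(n+1)`, each of them once. -/
theorem foldl_newTilings (hD : AdmitsHeights D) (hne : ∃ T, IsTiling D T) (n : ℕ) :
    ((List.range (n + 1)).foldl (fun L k => L ++ newTilings D k L) []).Nodup ∧
    ∀ T, T ∈ (List.range (n + 1)).foldl (fun L k => L ++ newTilings D k L) [] ↔
      IsTiling D T ∧ TilingLE D T (stage D (n + 1)) := by
  induction n with
  | zero =>
    simp only [zero_add, List.range_one, List.foldl_cons, List.foldl_nil, List.nil_append]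
    exact ⟨hD.nodup_newTilings_zero hne _, fun T => hD.mem_newTilings_zero hne⟩
  | succ n ih =>
    rw [List.range_succ, List.foldl_append]
    simp only [List.foldl_cons, List.foldl_nil]
    obtain ⟨h1, h2⟩ := ih
    generalize (List.range (n + 1)).foldl (fun L k => L ++ newTilings D k L) [] = L at h1 h2
    have hmem := fun T => hD.mem_newTilings_succ (T := T) hne (Nat.succ_ne_zero n) h2
    constructor
    -- The new tilings are not below `D^(n+1)` while those of the list are, so the two lists are
    -- disjoint.
    · rw [List.nodup_append']
      refine ⟨h1, hD.nodup_newTilings_succ hne (Nat.succ_ne_zero n) h1 h2, fun T hT hT' => ?_⟩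
      exact ((hmem T).1 hT').2.2 ((h2 T).1 hT).2
    · intro T
      rw [List.mem_append, h2, hmem]
      constructor
      · rintro (⟨h, h'⟩ | ⟨h, h', -⟩)
        · exact ⟨h, tilingLE_trans h' (hD.stage_le_succ hne _)⟩
        · exact ⟨h, h'⟩
      · rintro ⟨h, h'⟩
        by_cases hle : TilingLE D T (stage D (n + 1))
        · exact Or.inl ⟨h, hle⟩
        · exact Or.inr ⟨h, h', hle⟩

/-- With degree 0 no order would be processed and the list would be empty, whence the positivity
hypothesis. -/
theorem zoneTilings_spec (hD : AdmitsHeights D) (hne : ∃ T, IsTiling D T) (hd : 0 < degree D) :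
    (zoneTilings D).Nodup ∧ ∀ T, T ∈ zoneTilings D ↔ IsTiling D T := by
  obtain ⟨n, hn⟩ := Nat.exists_eq_succ_of_ne_zero hd.ne'
  have h := hD.foldl_newTilings hne n
  rw [← Nat.succ_eq_add_one, ← hn, hD.stage_degree hne] at h
  refine ⟨h.1, fun T => (h.2 T).trans ⟨fun h => h.1, fun h => ⟨h, hD.le_maxTiling h⟩⟩⟩

/-! ### Links of a zone and its diagram -/

theorem mem_zoneLinks (hD : AdmitsHeights D) (hmem : ∀ T, T ∈ zoneTilings D ↔ IsTiling D T)
    {T T' : Finset Edge} : (T, T') ∈ zoneLinks D ↔ TilingCovBy D T T' := by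
  rw [hD.tilingCovBy_iff]
  simp only [zoneLinks, List.mem_flatMap, List.mem_map, Finset.mem_toList, Prod.mk.injEq, hmem]
  constructor
  · rintro ⟨S, hS, v, hv, rfl, rfl⟩
    exact ⟨hS, v, (hD.mem_localMinima hS).1 hv, rfl⟩
  · rintro ⟨hT, v, hv, rfl⟩
    exact ⟨T, hT, v, (hD.mem_localMinima hT).2 hv, rfl, rfl⟩

theorem nodup_zoneLinks (hD : AdmitsHeights D) (hnd : (zoneTilings D).Nodup)
    (hmem : ∀ T, T ∈ zoneTilings D ↔ IsTiling D T) : (zoneLinks D).Nodup := by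
  rw [zoneLinks, List.nodup_flatMap]
  constructor
  · intro T hT
    rw [hmem] at hT
    refine List.Nodup.map_on ?_ (Finset.nodup_toList _)
    intro v hv w hw heq
    rw [Finset.mem_toList, hD.mem_localMinima hT] at hv hw
    rw [Prod.mk.injEq] at heq
    have hvD := (hv.isInner hT).mem_verts
    have h1 := (hD.addCubes_singleton hT hv).2 v hvD
    have h2 := (hD.addCubes_singleton hT hw).2 v hvD
    rw [heq.2, h2] at h1
    by_contra hne
    simp [hne] at h1
  · refine List.Pairwise.imp ?_ hnd
    rintro T T' hne ⟨A, B⟩ h h'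
    obtain ⟨v, -, hv⟩ := List.mem_map.1 h
    obtain ⟨w, -, hw⟩ := List.mem_map.1 h'
    exact hne ((Prod.mk.inj hv).1.trans (Prod.mk.inj hw).1.symm)

/-- A list of the tilings and a list of the covering pairs make up the diagram of the lattice. -/
theorem represents (hD : AdmitsHeights D) {X : Diagram} (h1 : X.tilings.Nodup)
    (h2 : ∀ T, T ∈ X.tilings ↔ IsTiling D T) (h3 : X.links.Nodup)
    (h4 : ∀ T T', (T, T') ∈ X.links ↔ TilingCovBy D T T') : X.Represents D where
  tilings_nodup := h1
  mem_tilings := h2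
  links_nodup := h3
  mem_links := h4
  le_iff T T' hT hT' := by
    rw [hD.tilingLE_iff_reflTransGen hT hT']
    have : (fun S S' => (S, S') ∈ X.links) = TilingCovBy D := by
      funext S S'
      exact propext (h4 S S')
    rw [this]
  lattice := hD.exists_distribLattice

end AdmitsHeights

theorem lozenge_subset_iff {e f : Edge} : lozenge e ⊆ lozenge f ↔ e = f := by
  refine ⟨fun h => ?_, fun h => h ▸ Finset.Subset.refl _⟩
  rcases e with ⟨⟨x, y⟩, d⟩
  rcases f with ⟨⟨p, q⟩, k⟩
  fin_cases d <;> fin_cases k <;> simp [lozenge, step, Finset.insert_subset_iff] at h ⊢ <;> omega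

theorem isTiling_lozenge_iff {e : Edge} {T : Finset Edge} : IsTiling (lozenge e) T ↔ T = {e} := by
  constructor
  · intro h
    have hsub : ∀ f ∈ T, f = e := fun f hf => lozenge_subset_iff.1 (h.1 f hf)
    obtain ⟨t, ht⟩ := lozenge_nonempty e
    obtain ⟨f, ⟨hf, -⟩, -⟩ := (isTiling_iff.1 h).2 t ht
    obtain rfl := hsub f hf
    exact Finset.eq_singleton_iff_unique_mem.2 ⟨hf, hsub⟩
  · rintro rfl
    exact ⟨by simp, by simp, by simp⟩

namespace AdmitsHeights

variable {D F : Domain} {T T' : Finset Edge}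

theorem zoneDiagram_represents (hF : AdmitsHeights F) (hne : ∃ T, IsTiling F T)
    (hd : (¬ ∃ e, F = lozenge e) → 0 < degree F) : (zoneDiagram F).Represents F := by
  unfold zoneDiagram
  split_ifs with h
  · have hmem : ∀ T, IsTiling F T ↔ T = {h.choose} := fun T => by
      conv_lhs => rw [h.choose_spec]
      exact isTiling_lozenge_iff
    refine hF.represents (by simp) (fun T => by rw [hmem]; simp) (by simp) fun T T' => ?_
    simp only [List.not_mem_nil, false_iff]
    rintro ⟨h1, h2, h3, -⟩
    exact h3.2 (((hmem T).1 h1).trans ((hmem T').1 h2).symm)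
  · obtain ⟨h1, h2⟩ := hF.zoneTilings_spec hne (hd h)
    exact hF.represents h1 h2 (hF.nodup_zoneLinks h1 h2) fun T T' => hF.mem_zoneLinks h2

/-- Degree 0 means that `Min` and `Max` coincide, so the zone has a single tiling and is a lozenge
by `zone_eq_lozenge`. -/
theorem degree_pos_of_zone (hD : AdmitsHeights D) (hT : IsTiling D T) (hF : F ∈ fractureZones D)
    (h : ¬ ∃ e, F = lozenge e) : 0 < degree F := by
  have hFh := hD.admitsHeights_zone hT hF
  have hne : ∃ T, IsTiling F T := ⟨_, hD.isTiling_restrict hT hF⟩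
  by_contra hd
  have hdeg := hFh.stage_degree hne
  rw [Nat.eq_zero_of_not_pos hd] at hdeg
  have key : ∀ S, IsTiling F S → S = maxTiling F := fun S hS =>
    hFh.tilingLE_antisymm hS (hFh.isTiling_maxTiling hne) (hFh.le_maxTiling hS)
      (hdeg ▸ hFh.minTiling_le hS)
  exact h (hD.zone_eq_lozenge hT hF fun T₁ T₂ h1 h2 => (key T₁ h1).trans (key T₂ h2).symm)

/-! ### Covering pairs and zones -/

theorem eq_of_restrict_eq (hD : AdmitsHeights D) (hT : IsTiling D T) (hT' : IsTiling D T')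
    (h : ∀ F ∈ fractureZones D, restrict T F = restrict T' F) : T = T' := by
  rw [← hD.biUnion_restrict hT, ← hD.biUnion_restrict hT']
  exact Finset.biUnion_congr rfl h

theorem tilingCovBy_iff_zones (hD : AdmitsHeights D) (hT : IsTiling D T) (hT' : IsTiling D T') :
    TilingCovBy D T T' ↔ ∃ F ∈ fractureZones D, TilingCovBy F (restrict T F) (restrict T' F) ∧
      ∀ G ∈ fractureZones D, G ≠ F → restrict T G = restrict T' G := by
  constructor
  · rintro ⟨-, -, ⟨hle, hne⟩, hcov⟩
    have hz := (hD.tilingLE_iff_zones hT hT').1 hle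
    obtain ⟨F, hF, hFne⟩ : ∃ F ∈ fractureZones D, restrict T F ≠ restrict T' F := by
      by_contra hn
      push Not at hn
      exact hne (hD.eq_of_restrict_eq hT hT' hn)
    -- A tiling that leaves the other zones as in `T` and moves up inside `F` without passing `T'`
    -- lies between the two, so covering forces it to be `T'`. Used with the part of `T'` in `F`,
    -- this freezes the other zones; used with an intermediate tiling of `F`, it gives the cover in
    -- `F`.
    have hext : ∀ S R, IsTiling D R → restrict R F = S →
        (∀ G ∈ fractureZones D, G ≠ F → restrict R G = restrict T G) →
        TilingLT F (restrict T F) S → TilingLE F S (restrict T' F) → R = T' := by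
      intro S R hR hRF hRG hlt hle'
      by_contra hRne
      refine hcov R hR ⟨⟨(hD.tilingLE_iff_zones hT hR).2 fun G hG => ?_, ?_⟩,
        ⟨(hD.tilingLE_iff_zones hR hT').2 fun G hG => ?_, hRne⟩⟩
      · by_cases hGF : G = F
        · subst hGF; rw [hRF]; exact hlt.1
        · rw [hRG G hG hGF]; exact tilingLE_refl _ _
      · rintro rfl
        exact hlt.2 hRF
      · by_cases hGF : G = F
        · subst hGF; rw [hRF]; exact hle'
        · rw [hRG G hG hGF]; exact hz G hG
    obtain ⟨R, hR, hRF, hRG⟩ := hD.exists_extension hT hF (hD.isTiling_restrict hT' hF)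
    have hRT := hext _ R hR hRF hRG ⟨hz F hF, hFne⟩ (tilingLE_refl _ _)
    subst hRT
    refine ⟨F, hF, ⟨hD.isTiling_restrict hT hF, hD.isTiling_restrict hT' hF, ⟨hz F hF, hFne⟩,
      fun S hS hSb => ?_⟩, fun G hG hGF => (hRG G hG hGF).symm⟩
    obtain ⟨Q, hQ, hQF, hQG⟩ := hD.exists_extension hT hF hS
    have := hext _ Q hQ hQF hQG hSb.1 hSb.2.1
    subst this
    exact hSb.2.2 hQF.symm
  · rintro ⟨F, hF, ⟨-, -, ⟨hle, hne⟩, hcov⟩, hG⟩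
    refine ⟨hT, hT', ⟨(hD.tilingLE_iff_zones hT hT').2 fun G hGz => ?_, ?_⟩, ?_⟩
    · by_cases hGF : G = F
      · subst hGF; exact hle
      · rw [hG G hGz hGF]; exact tilingLE_refl _ _
    · rintro rfl; exact hne rfl
    · rintro S hS ⟨⟨h1, h2⟩, ⟨h3, h4⟩⟩
      have z1 := (hD.tilingLE_iff_zones hT hS).1 h1
      have z2 := (hD.tilingLE_iff_zones hS hT').1 h3
      have hSG : ∀ G ∈ fractureZones D, G ≠ F → restrict S G = restrict T G := fun G hGz hGF =>
        (hD.admitsHeights_zone hT hGz).tilingLE_antisymm (hD.isTiling_restrict hS hGz)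
          (hD.isTiling_restrict hT hGz) (by rw [hG G hGz hGF]; exact z2 G hGz) (z1 G hGz)
      refine hcov _ (hD.isTiling_restrict hS hF) ⟨⟨z1 F hF, fun h => h2 ?_⟩, ⟨z2 F hF, fun h => h4 ?_⟩⟩
      · refine hD.eq_of_restrict_eq hT hS fun G hGz => ?_
        by_cases hGF : G = F
        · rw [hGF, h]
        · exact (hSG G hGz hGF).symm
      · refine hD.eq_of_restrict_eq hS hT' fun G hGz => ?_
        by_cases hGF : G = F
        · rw [hGF, h]
        · exact (hSG G hGz hGF).trans (hG G hGz hGF)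

end AdmitsHeights

/-! ### Products of diagrams -/

/-- A diagram without repetitions, of tilings made of lozenges of `U`. -/
structure Diagram.IsReduced (X : Diagram) (U : Set Edge) : Prop where
  nodup_tilings : X.tilings.Nodup
  subset : ∀ S ∈ X.tilings, (S : Set Edge) ⊆ U
  nodup_links : X.links.Nodup
  fst_mem : ∀ l ∈ X.links, l.1 ∈ X.tilings
  snd_mem : ∀ l ∈ X.links, l.2 ∈ X.tilings
  ne : ∀ l ∈ X.links, l.1 ≠ l.2

/-- Disjoint supports make the decomposition of a glued tiling unique, so distinct pairs of factors
give distinct products. -/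
theorem Diagram.IsReduced.prod {X Y : Diagram} {U V : Set Edge} (h : Disjoint U V)
    (hX : X.IsReduced U) (hY : Y.IsReduced V) : (X.prod Y).IsReduced (U ∪ V) := by
  have hmem : ∀ {S T}, S ∈ X.tilings → T ∈ Y.tilings → S ∪ T ∈ (X.prod Y).tilings := fun hS hT =>
    List.mem_flatMap.2 ⟨_, hS, List.mem_map.2 ⟨_, hT, rfl⟩⟩
  have hinj : ∀ {S S' T T'}, S ∈ X.tilings → S' ∈ X.tilings → T ∈ Y.tilings → T' ∈ Y.tilings →
      S ∪ T = S' ∪ T' → S = S' ∧ T = T' := fun hS hS' hT hT' =>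
    union_inj_of_disjoint h (hX.subset _ hS) (hX.subset _ hS') (hY.subset _ hT) (hY.subset _ hT')
  have hlinks : ∀ l, l ∈ (X.prod Y).links ↔
      (∃ m ∈ X.links, ∃ T ∈ Y.tilings, (m.1 ∪ T, m.2 ∪ T) = l) ∨
      (∃ S ∈ X.tilings, ∃ m ∈ Y.links, (S ∪ m.1, S ∪ m.2) = l) := by
    intro l
    simp only [Diagram.prod, List.mem_append, List.mem_flatMap, List.mem_map]
  refine ⟨nodup_flatMap_union h hX.nodup_tilings hY.nodup_tilings hX.subset hY.subset, ?_, ?_, ?_,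
    ?_, ?_⟩
  · intro R hR
    obtain ⟨S, hS, hR⟩ := List.mem_flatMap.1 hR
    obtain ⟨T, hT, rfl⟩ := List.mem_map.1 hR
    rw [Finset.coe_union]
    exact Set.union_subset_union (hX.subset S hS) (hY.subset T hT)
  · refine List.nodup_append'.2 ⟨?_, ?_, ?_⟩
    · rw [List.nodup_flatMap]
      constructor
      · intro m hm
        refine List.Nodup.map_on ?_ hY.nodup_tilings
        intro T hT T' hT' heq
        exact (hinj (hX.fst_mem m hm) (hX.fst_mem m hm) hT hT' (Prod.mk.inj heq).1).2
      · refine List.Pairwise.imp_of_mem ?_ hX.nodup_links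
        intro m m' hm hm' hne x hx hx'
        obtain ⟨T, hT, rfl⟩ := List.mem_map.1 hx
        obtain ⟨T', hT', heq⟩ := List.mem_map.1 hx'
        refine hne (Prod.ext ?_ ?_)
        · exact (hinj (hX.fst_mem m' hm') (hX.fst_mem m hm) hT' hT (Prod.mk.inj heq).1).1.symm
        · exact (hinj (hX.snd_mem m' hm') (hX.snd_mem m hm) hT' hT (Prod.mk.inj heq).2).1.symm
    · rw [List.nodup_flatMap]
      constructor
      · intro S hS
        refine List.Nodup.map_on ?_ hY.nodup_links
        intro m hm m' hm' heq
        refine Prod.ext ?_ ?_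
        · exact (hinj hS hS (hY.fst_mem m hm) (hY.fst_mem m' hm') (Prod.mk.inj heq).1).2
        · exact (hinj hS hS (hY.snd_mem m hm) (hY.snd_mem m' hm') (Prod.mk.inj heq).2).2
      · refine List.Pairwise.imp_of_mem ?_ hX.nodup_tilings
        intro S S' hS hS' hne x hx hx'
        obtain ⟨m, hm, rfl⟩ := List.mem_map.1 hx
        obtain ⟨m', hm', heq⟩ := List.mem_map.1 hx'
        exact hne (hinj hS' hS (hY.fst_mem m' hm') (hY.fst_mem m hm) (Prod.mk.inj heq).1).1.symm
    -- A link from the second factor fixes the part in `X`, whereas one from the first factor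
    -- changes it by `IsReduced.ne`; no link is of both kinds.
    · intro x hx hx'
      obtain ⟨m, hm, hx⟩ := List.mem_flatMap.1 hx
      obtain ⟨T, hT, rfl⟩ := List.mem_map.1 hx
      obtain ⟨S, hS, hx'⟩ := List.mem_flatMap.1 hx'
      obtain ⟨m', hm', heq⟩ := List.mem_map.1 hx'
      refine hX.ne m hm ?_
      rw [← (hinj hS (hX.fst_mem m hm) (hY.fst_mem m' hm') hT (Prod.mk.inj heq).1).1,
        ← (hinj hS (hX.snd_mem m hm) (hY.snd_mem m' hm') hT (Prod.mk.inj heq).2).1]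
  · intro l hl
    rcases (hlinks l).1 hl with ⟨m, hm, T, hT, rfl⟩ | ⟨S, hS, m, hm, rfl⟩
    exacts [hmem (hX.fst_mem m hm) hT, hmem hS (hY.fst_mem m hm)]
  · intro l hl
    rcases (hlinks l).1 hl with ⟨m, hm, T, hT, rfl⟩ | ⟨S, hS, m, hm, rfl⟩
    exacts [hmem (hX.snd_mem m hm) hT, hmem hS (hY.snd_mem m hm)]
  · intro l hl heq
    rcases (hlinks l).1 hl with ⟨m, hm, T, hT, rfl⟩ | ⟨S, hS, m, hm, rfl⟩
    · exact hX.ne m hm (hinj (hX.fst_mem m hm) (hX.snd_mem m hm) hT hT heq).1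
    · exact hY.ne m hm (hinj hS hS (hY.fst_mem m hm) (hY.snd_mem m hm) heq).2

section DiagramProd

variable {ι : Type*}

/-- The product of the diagrams `X i`, for `i` in `l`. -/
def diagramProd (X : ι → Diagram) (l : List ι) : Diagram :=
  l.foldr (fun i Y => (X i).prod Y) ⟨[∅], []⟩

theorem tilings_diagramProd (X : ι → Diagram) (l : List ι) :
    (diagramProd X l).tilings = unionProd (fun i => (X i).tilings) l := by
  induction l with
  | nil => rfl
  | cons i l ih =>
    rw [unionProd_cons, ← ih]
    rfl

theorem isReduced_diagramProd {X : ι → Diagram} {l : List ι} (hl : l.Nodup) (U : ι → Set Edge)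
    (hU : ∀ i ∈ l, ∀ j ∈ l, i ≠ j → Disjoint (U i) (U j)) (hX : ∀ i ∈ l, (X i).IsReduced (U i)) :
    (diagramProd X l).IsReduced (⋃ i ∈ l, U i) := by
  induction l with
  | nil => constructor <;> simp [diagramProd]
  | cons i l ih =>
    rw [List.nodup_cons] at hl
    have hm : ∀ j ∈ l, j ∈ i :: l := fun j hj => List.mem_cons_of_mem _ hj
    have h := (hX i List.mem_cons_self).prod (Y := diagramProd X l) (V := ⋃ j ∈ l, U j) ?_
      (ih hl.2 (fun j hj k hk => hU j (hm j hj) k (hm k hk)) fun j hj => hX j (hm j hj))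
    · have e : (⋃ j ∈ i :: l, U j) = U i ∪ ⋃ j ∈ l, U j := by
        ext x
        simp
      rw [e]
      exact h
    · simp only [Set.disjoint_iUnion_right]
      exact fun j hj => hU i List.mem_cons_self j (hm j hj) (by rintro rfl; exact hl.1 hj)

/-- A link of an iterated product is a link in one factor together with fixed tilings of the others.
This matches `tilingCovBy_iff_zones`. -/
theorem mem_links_diagramProd [DecidableEq ι] {X : ι → Diagram} {l : List ι} (hl : l.Nodup)
    {T T' : Finset Edge} : (T, T') ∈ (diagramProd X l).links ↔
      ∃ i ∈ l, ∃ A B : ι → Finset Edge, (A i, B i) ∈ (X i).links ∧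
        (∀ j ∈ l, j ≠ i → A j = B j ∧ A j ∈ (X j).tilings) ∧
        T = l.toFinset.biUnion A ∧ T' = l.toFinset.biUnion B := by
  induction l generalizing T T' with
  | nil => simp [diagramProd]
  | cons i l ih =>
    rw [List.nodup_cons] at hl
    have hi : i ∉ l.toFinset := by simpa using hl.1
    have hne : ∀ j ∈ l, j ≠ i := fun j hj => by rintro rfl; exact hl.1 hj
    have hcons : (T, T') ∈ (diagramProd X (i :: l)).links ↔
        (∃ m ∈ (X i).links, ∃ S ∈ (diagramProd X l).tilings, m.1 ∪ S = T ∧ m.2 ∪ S = T') ∨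
        ∃ S ∈ (X i).tilings, ∃ m ∈ (diagramProd X l).links, S ∪ m.1 = T ∧ S ∪ m.2 = T' := by
      show (T, T') ∈ ((X i).prod (diagramProd X l)).links ↔ _
      simp only [Diagram.prod, List.mem_append, List.mem_flatMap, List.mem_map, Prod.mk.injEq]
    rw [hcons]
    constructor
    · rintro (⟨m, hm, S, hS, rfl, rfl⟩ | ⟨S, hS, ⟨m1, m2⟩, hm, rfl, rfl⟩)
      · rw [tilings_diagramProd, mem_unionProd hl.2] at hS
        obtain ⟨A, hA, rfl⟩ := hS
        refine ⟨i, List.mem_cons_self, Function.update A i m.1, Function.update A i m.2, ?_, ?_,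
          ?_, ?_⟩
        · simpa only [Function.update_self] using hm
        · intro j hj hji
          rw [Function.update_of_ne hji, Function.update_of_ne hji]
          exact ⟨rfl, hA j ((List.mem_cons.1 hj).resolve_left hji)⟩
        · rw [List.toFinset_cons, Finset.biUnion_insert, Function.update_self,
            biUnion_update_of_notMem hi]
        · rw [List.toFinset_cons, Finset.biUnion_insert, Function.update_self,
            biUnion_update_of_notMem hi]
      · obtain ⟨k, hk, A, B, hAB, hj, h1, h2⟩ := (ih hl.2).1 hm
        refine ⟨k, List.mem_cons_of_mem _ hk, Function.update A i S, Function.update B i S, ?_, ?_,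
          ?_, ?_⟩
        · rwa [Function.update_of_ne (hne k hk), Function.update_of_ne (hne k hk)]
        · intro j hjl hjk
          by_cases hji : j = i
          · subst hji
            rw [Function.update_self, Function.update_self]
            exact ⟨rfl, hS⟩
          · rw [Function.update_of_ne hji, Function.update_of_ne hji]
            exact hj j ((List.mem_cons.1 hjl).resolve_left hji) hjk
        · rw [List.toFinset_cons, Finset.biUnion_insert, Function.update_self,
            biUnion_update_of_notMem hi, h1]
        · rw [List.toFinset_cons, Finset.biUnion_insert, Function.update_self,
            biUnion_update_of_notMem hi, h2]
    · rintro ⟨k, hk, A, B, hAB, hj, rfl, rfl⟩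
      rw [List.toFinset_cons, Finset.biUnion_insert, Finset.biUnion_insert]
      rcases List.mem_cons.1 hk with rfl | hkl
      · left
        refine ⟨_, hAB, l.toFinset.biUnion A, ?_, rfl, ?_⟩
        · rw [tilings_diagramProd, mem_unionProd hl.2]
          exact ⟨A, fun j hjl => (hj j (List.mem_cons_of_mem _ hjl) (hne j hjl)).2, rfl⟩
        · congr 1
          refine Finset.biUnion_congr rfl fun j hjl => ?_
          rw [List.mem_toFinset] at hjl
          exact (hj j (List.mem_cons_of_mem _ hjl) (hne j hjl)).1
      · right
        obtain ⟨h1, h2⟩ := hj i List.mem_cons_self (hne k hkl).symm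
        refine ⟨A i, h2, (l.toFinset.biUnion A, l.toFinset.biUnion B), (ih hl.2).2
          ⟨k, hkl, A, B, hAB, fun j hjl => hj j (List.mem_cons_of_mem _ hjl), rfl, rfl⟩, rfl, ?_⟩
        rw [h1]

end DiagramProd

/-! ### Correctness of the algorithm -/

theorem Diagram.Represents.isReduced {X : Diagram} {F : Domain} (h : X.Represents F) :
    X.IsReduced {e | lozenge e ⊆ F} where
  nodup_tilings := h.tilings_nodup
  subset S hS := fun e he => ((h.mem_tilings S).1 hS).1 e he
  nodup_links := h.links_nodup
  fst_mem l hl := (h.mem_tilings _).2 ((h.mem_links l.1 l.2).1 hl).1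
  snd_mem l hl := (h.mem_tilings _).2 ((h.mem_links l.1 l.2).1 hl).2.1
  ne l hl := ((h.mem_links l.1 l.2).1 hl).2.2.1.2

/-- Lozenges of different zones are different, so the product has no repetitions. Restriction and
gluing then translate tilings and covers of `D` into those of the product. -/
theorem AdmitsHeights.mainAlgorithm_represents {D : Domain} (hD : AdmitsHeights D)
    {T₀ : Finset Edge} (hT₀ : IsTiling D T₀)
    (hZ : ∀ F ∈ fractureZones D, (zoneDiagram F).Represents F) :
    (mainAlgorithm D).Represents D := by
  have hnd := (fractureZones D).nodup_toList
  have hred : (mainAlgorithm D).IsReduced (⋃ F ∈ (fractureZones D).toList, {e | lozenge e ⊆ F}) := by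
    refine isReduced_diagramProd hnd (fun F => {e | lozenge e ⊆ F}) ?_
      fun F hF => (hZ F (Finset.mem_toList.1 hF)).isReduced
    intro F hF G hG hne
    rw [Finset.mem_toList] at hF hG
    refine Set.disjoint_left.2 fun e he he' => hne ?_
    obtain ⟨t, ht⟩ := lozenge_nonempty e
    exact hD.zone_unique hT₀ hF hG (he ht) (he' ht)
  have hmem : ∀ T, T ∈ (mainAlgorithm D).tilings ↔ IsTiling D T := by
    intro T
    have : (mainAlgorithm D).tilings = unionProd (fun F => (zoneDiagram F).tilings)
        (fractureZones D).toList := tilings_diagramProd _ _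
    rw [this, mem_unionProd hnd, Finset.toList_toFinset]
    constructor
    · rintro ⟨A, hA, rfl⟩
      exact hD.isTiling_glue hT₀ fun F hF =>
        ((hZ F hF).mem_tilings _).1 (hA F (Finset.mem_toList.2 hF))
    · intro hT
      refine ⟨restrict T, fun F hF => ?_, (hD.biUnion_restrict hT).symm⟩
      rw [Finset.mem_toList] at hF
      exact ((hZ F hF).mem_tilings _).2 (hD.isTiling_restrict hT hF)
  refine hD.represents hred.nodup_tilings hmem hred.nodup_links fun T T' => ?_
  have hlinks := mem_links_diagramProd (X := zoneDiagram) hnd (T := T) (T' := T')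
  rw [Finset.toList_toFinset] at hlinks
  refine hlinks.trans ?_
  constructor
  · rintro ⟨F, hF, A, B, hAB, hG, rfl, rfl⟩
    rw [Finset.mem_toList] at hF
    have hcov := ((hZ F hF).mem_links _ _).1 hAB
    have hA : ∀ G ∈ fractureZones D, IsTiling G (A G) := by
      intro G hGz
      by_cases hGF : G = F
      · rw [hGF]; exact hcov.1
      · exact ((hZ G hGz).mem_tilings _).1 (hG G (Finset.mem_toList.2 hGz) hGF).2
    have hB : ∀ G ∈ fractureZones D, IsTiling G (B G) := by
      intro G hGz
      by_cases hGF : G = F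
      · rw [hGF]; exact hcov.2.1
      · rw [← (hG G (Finset.mem_toList.2 hGz) hGF).1]; exact hA G hGz
    refine (hD.tilingCovBy_iff_zones (hD.isTiling_glue hT₀ hA) (hD.isTiling_glue hT₀ hB)).2
      ⟨F, hF, ?_, fun G hGz hGF => ?_⟩
    · rwa [hD.restrict_glue hT₀ hA hF, hD.restrict_glue hT₀ hB hF]
    · rw [hD.restrict_glue hT₀ hA hGz, hD.restrict_glue hT₀ hB hGz]
      exact (hG G (Finset.mem_toList.2 hGz) hGF).1
  · intro hcov
    have hT := hcov.1
    have hT' := hcov.2.1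
    obtain ⟨F, hF, hFc, hG⟩ := (hD.tilingCovBy_iff_zones hT hT').1 hcov
    refine ⟨F, Finset.mem_toList.2 hF, restrict T, restrict T', ((hZ F hF).mem_links _ _).2 hFc,
      fun G hGz hGF => ?_, (hD.biUnion_restrict hT).symm, (hD.biUnion_restrict hT').symm⟩
    rw [Finset.mem_toList] at hGz
    exact ⟨hG G hGz hGF, ((hZ G hGz).mem_tilings _).2 (hD.isTiling_restrict hT hGz)⟩

end LozengeTiling

/-! ### The main theorem -/

theorem mainTheorem1 :
    -- the hypothesis below holds for every polygon
    (∀ D : Domain, IsPolygon D → AdmitsHeights D) ∧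
    ∀ D : Domain, AdmitsHeights D → (∃ T, IsTiling D T) →
      -- the output is the lattice of the tilings of `D`, each tiling being generated exactly once
      (mainAlgorithm D).Represents D ∧
      -- the fracture zones form a partition of `D`
      ((fractureZones D : Set Domain).PairwiseDisjoint id ∧ (fractureZones D).biUnion id = D) ∧
      -- the lattice of the tilings of `D` is the product of the lattices of the zones
      (∀ T, IsTiling D T → (∀ F ∈ fractureZones D, IsTiling F (restrict T F)) ∧
        (fractureZones D).biUnion (restrict T) = T) ∧
      (∀ S : Domain → Finset Edge, (∀ F ∈ fractureZones D, IsTiling F (S F)) →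
        IsTiling D ((fractureZones D).biUnion S) ∧
        ∀ F ∈ fractureZones D, restrict ((fractureZones D).biUnion S) F = S F) ∧
      (∀ T T', IsTiling D T → IsTiling D T' →
        (TilingLE D T T' ↔ ∀ F ∈ fractureZones D, TilingLE F (restrict T F) (restrict T' F))) ∧
      -- each zone is processed correctly
      ∀ F ∈ fractureZones D, AdmitsHeights F ∧ (zoneDiagram F).Represents F ∧
        -- for a zone other than a lozenge, the tilings `F^k` form a chain from `Min` to `Max`
        ((¬ ∃ e, F = lozenge e) → 0 < degree F ∧ stage F 0 = minTiling F ∧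
          stage F (degree F) = maxTiling F ∧ (∀ k ≤ degree F, IsTiling F (stage F k)) ∧
          ∀ k < degree F, TilingLT F (stage F k) (stage F (k + 1))) := by
  refine ⟨fun D hD => hD.admitsHeights, fun D hD hne => ?_⟩
  obtain ⟨T₀, hT₀⟩ := hne
  have hF : ∀ F ∈ fractureZones D, AdmitsHeights F ∧ ∃ T, IsTiling F T := fun F hF =>
    ⟨hD.admitsHeights_zone hT₀ hF, _, hD.isTiling_restrict hT₀ hF⟩
  have hZ : ∀ F ∈ fractureZones D, (zoneDiagram F).Represents F := fun F hFz =>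
    (hF F hFz).1.zoneDiagram_represents (hF F hFz).2 (hD.degree_pos_of_zone hT₀ hFz)
  refine ⟨hD.mainAlgorithm_represents hT₀ hZ, ⟨?_, ?_⟩, fun T hT => ?_, fun S hS => ?_,
    fun T T' hT hT' => hD.tilingLE_iff_zones hT hT', fun F hFz => ?_⟩
  · intro F hFz G hGz hne
    exact Finset.disjoint_left.2 fun t ht ht' => hne (hD.zone_unique hT₀ hFz hGz ht ht')
  · ext t
    simp only [Finset.mem_biUnion, id]
    exact ⟨fun ⟨F, hFz, ht⟩ => AdmitsHeights.zone_subset hFz ht, hD.exists_zone_mem hT₀⟩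
  · exact ⟨fun F hFz => hD.isTiling_restrict hT hFz, hD.biUnion_restrict hT⟩
  · exact ⟨hD.isTiling_glue hT₀ hS, fun F hFz => hD.restrict_glue hT₀ hS hFz⟩
  · obtain ⟨h1, h2⟩ := hF F hFz
    exact ⟨h1, hZ F hFz, fun hl => ⟨hD.degree_pos_of_zone hT₀ hFz hl, rfl, h1.stage_degree h2,
      fun k _ => h1.isTiling_stage h2 k, fun k hk => h1.stage_lt_succ h2 hk⟩⟩
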